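/- Let $K$ be a field of characteristic $p>0$, $n\ge 0$, $P_n=K[x_1,\dots,x_n]$, and let $\mathcal D=\mathcal D(P_n)\subseteq \mathrm{End}_K(P_n)$ be the ring of ($K$-linear) differential operators on $P_n$, with $K$-basis $x^\alpha\partial^{[\beta]}$ ($\alpha,\beta\in\mathbb N^n$), where $\partial^{[\beta]}(x^\gamma)=\prod_i\binom{\gamma_i}{\beta_i}x^{\gamma-\beta}$. Let $F_i$ be the $K$-span of the $x^\alpha\partial^{[\beta]}$ with $|\alpha|+|\beta|\le i$ (the canonical filtration); a filtration of $\mathcal D$ is of standard type if it is a finite dimensional filtration $\{F'_i\}$ equivalent to $\{F_i\}$, i.e. there are natural numbers $a,b,c,e$ with $a,c>0$ such that $F_i\subseteq F'_{ai+b}$ and $F'_i\subseteq F_{ci+e}$ for $i\gg0$. For $k\ge 0$ let $T_k\subseteq\mathcal D$ be the subalgebra generated by $P_n$ and the $\partial^{[\beta]}$ with all $\beta_j<p^k$, filtered by $\mathcal T_{k,i}=T_k\cap F_i$. For $f:\mathbb N\to\mathbb N$ put $\gamma(f)=\inf\{r\ge 0: f(i)\le i^r \text{ for } i\gg 0\}$.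 For a finitely generated $\mathcal D$-module $M$ with finite dimensional generating subspace $M_0$ put $\mathrm{Dim}(M)=\gamma(i\mapsto\dim_K F_iM_0)$. Call $f$ an almost polynomial of period $m$, degree $t$ and leading coefficient $c$ if there are polynomials $q_s\in\mathbb Q[X]$, $s\in\mathbb Z/m\mathbb Z$, all of degree $t$ and leading coefficient $c$, with $f(i)=q_{i \bmod m}(i)$ for $i\gg 0$; its multiplicity is $t!\,c$. The multiplicity $e(M)$ is the multiplicity of $i\mapsto \dim_K F_iM_0$, when this is an almost polynomial. Let $M$ be a nonzero finitely presented $\mathcal D$-module. Then $M\simeq\mathcal D\otimes_{T_k}M'$ for some $k\ge0$ and some finitely generated $T_k$-module $M'$. Moreover, for every such $k$, $M'$ and isomorphism, the number $d=\mathrm{GK}(M')$ is a natural number with $d\le n$, and there is $e(M')\in\mathbb N$ such that, for every finite dimensional generating subspace $M_0'$ of the $T_k$-module $M'$, $\dim_K(\mathcal T_{k,i}M_0')$ is for $i\gg0$ a polynomial in $i$ of degree $d$ with leading coefficient $e(M')/d!$, and, with $M_i:=F_iM'_0\subseteq M$: 1. $\dim_K(M_i)=\frac{e(M')}{p^{kn}(n+d)!}i^{n+d}+\cdots$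 is an almost polynomial of period $p^k$ and degree $n+d$, with coefficients in $\frac{1}{p^{k(n+d)}(n+d)!}\mathbb Z$; the multiplicity $e(M)$ is well defined (the Hilbert function of the canonical filtration given by any finite dimensional generating subspace of $M$ is an almost polynomial, with the same multiplicity) and $e(M)=\frac{e(M')}{p^{kn}}\in\frac1{p^{kn}}\mathbb N$. 2. $\mathrm{Dim}(M)=n+d$, and the same value is obtained from every filtration of standard type of $\mathcal D$ and every finite dimensional generating subspace of $M$. The Poincaré series $P_M(\omega)=\sum_{i\ge0}\dim_K(M_i)\omega^i$ is a rational function, $\mathrm{Dim}(M)=t-1$ where $t$ is the order of its pole at $\omega=1$, and $e(M)=(1-\omega)^{\mathrm{Dim}(M)+1}P_M(\omega)|_{\omega=1}$. Finally, for each natural number $m$ with $n\le m\le 2n$ there is a nonzero finitely presented $\mathcal D$-module $M$ with $\mathrm{Dim}(M)=m$. -/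

import Mathlib

open Filter Polynomial
open scoped NNReal ENNReal Nat TensorProduct

universe u v w

noncomputable section

namespace PrimeDiffOp

/-! ### Rings of differential operators -/

section DiffOps

variable (K : Type u) [Field K] (A : Type v) [CommRing A] [Algebra K A]

/-- The order filtration of differential operators on a commutative `K`-algebra `A`, inside
`End_K(A)`: the operators of order `0` are the `A`-linear maps, and `f` has order at most `i + 1`
if `f a - a f` has order at most `i` for all `a` in `A`. -/
def diffOpOrder : ℕ → Submodule K (Module.End K A)
  | 0 =>
    { carrier := {f | ∀ a : A, f * Algebra.lmul K A a - Algebra.lmul K A a * f = 0}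
      add_mem' := fun {f g} hf hg a => by
        have h : (f + g) * Algebra.lmul K A a - Algebra.lmul K A a * (f + g)
          = (f * Algebra.lmul K A a - Algebra.lmul K A a * f)
            + (g * Algebra.lmul K A a - Algebra.lmul K A a * g) := by noncomm_ring
        rw [h, hf a, hg a, add_zero]
      zero_mem' := fun a => by simp
      smul_mem' := fun c f hf a => by
        have h : (c • f) * Algebra.lmul K A a - Algebra.lmul K A a * (c • f)
          = c • (f * Algebra.lmul K A a - Algebra.lmul K A a * f) := by
          rw [smul_mul_assoc, mul_smul_comm, smul_sub]
        rw [h, hf a, smul_zero] }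
  | i + 1 =>
    { carrier := {f | ∀ a : A,
        f * Algebra.lmul K A a - Algebra.lmul K A a * f ∈ diffOpOrder i}
      add_mem' := fun {f g} hf hg a => by
        have h : (f + g) * Algebra.lmul K A a - Algebra.lmul K A a * (f + g)
          = (f * Algebra.lmul K A a - Algebra.lmul K A a * f)
            + (g * Algebra.lmul K A a - Algebra.lmul K A a * g) := by noncomm_ring
        rw [h]
        exact Submodule.add_mem _ (hf a) (hg a)
      zero_mem' := fun a => by simp
      smul_mem' := fun c f hf a => by
        have h : (c • f) * Algebra.lmul K A a - Algebra.lmul K A a * (c • f)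
          = c • (f * Algebra.lmul K A a - Algebra.lmul K A a * f) := by
          rw [smul_mul_assoc, mul_smul_comm, smul_sub]
        rw [h]
        exact Submodule.smul_mem _ _ (hf a) }

variable {K A}

theorem mem_diffOpOrder_zero {f : Module.End K A} :
    f ∈ diffOpOrder K A 0 ↔
      ∀ a : A, f * Algebra.lmul K A a - Algebra.lmul K A a * f = 0 := Iff.rfl

theorem mem_diffOpOrder_succ {i : ℕ} {f : Module.End K A} :
    f ∈ diffOpOrder K A (i + 1) ↔
      ∀ a : A, f * Algebra.lmul K A a - Algebra.lmul K A a * f ∈ diffOpOrder K A i := Iff.rfl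

theorem diffOpOrder_le_succ (i : ℕ) : diffOpOrder K A i ≤ diffOpOrder K A (i + 1) := by
  induction i with
  | zero =>
    intro f hf a
    rw [mem_diffOpOrder_zero.1 hf a]
    exact Submodule.zero_mem _
  | succ i ih => exact fun f hf a => ih (hf a)

theorem diffOpOrder_mono : Monotone (diffOpOrder K A) :=
  monotone_nat_of_le_succ diffOpOrder_le_succ

theorem mul_mem_diffOpOrder : ∀ (i j : ℕ) {f g : Module.End K A},
    f ∈ diffOpOrder K A i → g ∈ diffOpOrder K A j → f * g ∈ diffOpOrder K A (i + j) := by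
  have key : ∀ (f g : Module.End K A) (a : A),
      (f * g) * Algebra.lmul K A a - Algebra.lmul K A a * (f * g)
        = f * (g * Algebra.lmul K A a - Algebra.lmul K A a * g)
          + (f * Algebra.lmul K A a - Algebra.lmul K A a * f) * g := by
    intro f g a
    simp only [mul_sub, sub_mul, mul_assoc]
    abel
  intro i
  induction i with
  | zero =>
    intro j
    induction j with
    | zero =>
      intro f g hf hg a
      rw [key, mem_diffOpOrder_zero.1 hf a, mem_diffOpOrder_zero.1 hg a, mul_zero, zero_mul,
        add_zero]
    | succ j ih =>
      intro f g hf hg a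
      rw [key, mem_diffOpOrder_zero.1 hf a, zero_mul, add_zero]
      exact ih hf (hg a)
  | succ i ihi =>
    intro j
    induction j with
    | zero =>
      intro f g hf hg a
      rw [key, mem_diffOpOrder_zero.1 hg a, mul_zero, zero_add]
      exact ihi 0 (hf a) hg
    | succ j ih =>
      intro f g hf hg a
      rw [key]
      refine Submodule.add_mem _ (ih hf (hg a)) ?_
      have h := ihi (j + 1) (hf a) hg
      rwa [show i + (j + 1) = i + 1 + j by omega] at h

theorem lmul_mem_diffOpOrder (a : A) : Algebra.lmul K A a ∈ diffOpOrder K A 0 := by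
  intro b
  rw [← map_mul, ← map_mul, mul_comm, sub_self]

variable (K A)

/-- The ring of differential operators on a commutative `K`-algebra `A`, the union of the order
filtration, as a subalgebra of `End_K(A)`. -/
def diffOps : Subalgebra K (Module.End K A) where
  carrier := {f | ∃ i, f ∈ diffOpOrder K A i}
  mul_mem' := by
    rintro f g ⟨i, hf⟩ ⟨j, hg⟩
    exact ⟨i + j, mul_mem_diffOpOrder i j hf hg⟩
  add_mem' := by
    rintro f g ⟨i, hf⟩ ⟨j, hg⟩
    exact ⟨i + j, Submodule.add_mem _ (diffOpOrder_mono (Nat.le_add_right i j) hf)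
      (diffOpOrder_mono (Nat.le_add_left j i) hg)⟩
  algebraMap_mem' := fun c => ⟨0, fun a => by rw [Algebra.commutes, sub_self]⟩

end DiffOps

/-! ### The polynomial algebra, its divided power operators, and the canonical filtration -/

section Poly

variable (K : Type u) [Field K] (n : ℕ)

/-- The polynomial algebra `P_n`. -/
abbrev P : Type u := MvPolynomial (Fin n) K

/-- The ring `D(P_n)` of differential operators on `P_n`. -/
def D : Type u := ↥(diffOps K (P K n))

instance : Ring (D K n) := inferInstanceAs (Ring ↥(diffOps K (P K n)))

instance : Algebra K (D K n) := inferInstanceAs (Algebra K ↥(diffOps K (P K n)))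

/-- The divided power `∂^[β]`, that is `∂^β / β!`, as a `K`-linear map on `P_n`: it sends `x^γ` to
`(∏ i, (γ i choose β i)) x^(γ - β)`. -/
def divPowEnd (β : Fin n →₀ ℕ) : Module.End K (P K n) :=
  (MvPolynomial.basisMonomials (Fin n) K).constr K fun γ =>
    MvPolynomial.monomial (γ - β) (((∏ i, (γ i).choose (β i) : ℕ)) : K)

theorem divPowEnd_monomial (β γ : Fin n →₀ ℕ) (c : K) :
    divPowEnd K n β (MvPolynomial.monomial γ c)
      = MvPolynomial.monomial (γ - β) (c * ((∏ i, (γ i).choose (β i) : ℕ) : K)) := by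
  have h : (MvPolynomial.monomial γ c : P K n)
      = c • MvPolynomial.basisMonomials (Fin n) K γ := by
    simp [MvPolynomial.smul_monomial]
  rw [h, map_smul, divPowEnd, Module.Basis.constr_basis, MvPolynomial.smul_monomial, smul_eq_mul]

theorem divPowEnd_zero : divPowEnd K n 0 = 1 := by
  refine (MvPolynomial.basisMonomials (Fin n) K).ext fun γ => ?_
  rw [MvPolynomial.coe_basisMonomials, divPowEnd_monomial]
  simp

theorem divPowEnd_X_of_eq_zero {β : Fin n →₀ ℕ} {i : Fin n} (hi : β i = 0) :
    divPowEnd K n β * Algebra.lmul K (P K n) (MvPolynomial.X i)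
      - Algebra.lmul K (P K n) (MvPolynomial.X i) * divPowEnd K n β = 0 := by
  rw [sub_eq_zero]
  refine (MvPolynomial.basisMonomials (Fin n) K).ext fun γ => ?_
  rw [MvPolynomial.coe_basisMonomials, Module.End.mul_apply, Module.End.mul_apply,
    divPowEnd_monomial, Algebra.coe_lmul_eq_mul, LinearMap.mul_apply', LinearMap.mul_apply',
    MvPolynomial.X, MvPolynomial.monomial_mul, MvPolynomial.monomial_mul, divPowEnd_monomial]
  have h1 : Finsupp.single i 1 + γ - β = Finsupp.single i 1 + (γ - β) := by
    ext j
    by_cases hj : j = i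
    · subst hj
      simp [hi]
    · simp [Ne.symm hj]
  have h2 : ∀ j, ((Finsupp.single i 1 + γ : Fin n →₀ ℕ) j).choose (β j) = (γ j).choose (β j) := by
    intro j
    by_cases hj : j = i
    · subst hj
      simp [hi]
    · simp [Ne.symm hj]
  rw [h1]
  simp only [h2, one_mul]

theorem divPowEnd_add_single_X (β : Fin n →₀ ℕ) (i : Fin n) :
    divPowEnd K n (β + Finsupp.single i 1) * Algebra.lmul K (P K n) (MvPolynomial.X i)
      - Algebra.lmul K (P K n) (MvPolynomial.X i) * divPowEnd K n (β + Finsupp.single i 1)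
      = divPowEnd K n β := by
  rw [sub_eq_iff_eq_add]
  refine (MvPolynomial.basisMonomials (Fin n) K).ext fun γ => ?_
  rw [MvPolynomial.coe_basisMonomials, LinearMap.add_apply, Module.End.mul_apply,
    Module.End.mul_apply, divPowEnd_monomial, divPowEnd_monomial, Algebra.coe_lmul_eq_mul,
    LinearMap.mul_apply', LinearMap.mul_apply', MvPolynomial.X, MvPolynomial.monomial_mul,
    MvPolynomial.monomial_mul, divPowEnd_monomial]
  have h1 : Finsupp.single i 1 + γ - (β + Finsupp.single i 1) = γ - β := by
    rw [add_comm β, add_tsub_add_eq_tsub_left]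
  have e1 : ∀ F : Fin n → ℕ, ∏ j, F j = F i * ∏ j ∈ Finset.univ.erase i, F j := fun F =>
    (Finset.mul_prod_erase _ _ (Finset.mem_univ i)).symm
  have h2 : ∏ j, ((Finsupp.single i 1 + γ : Fin n →₀ ℕ) j).choose ((β + Finsupp.single i 1 : Fin n →₀ ℕ) j)
      = ∏ j, (γ j).choose (β j) + ∏ j, (γ j).choose ((β + Finsupp.single i 1 : Fin n →₀ ℕ) j) := by
    rw [e1, e1, e1 (fun j => (γ j).choose ((β + Finsupp.single i 1 : Fin n →₀ ℕ) j))]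
    have h3 : ∏ j ∈ Finset.univ.erase i,
        ((Finsupp.single i 1 + γ : Fin n →₀ ℕ) j).choose ((β + Finsupp.single i 1 : Fin n →₀ ℕ) j)
        = ∏ j ∈ Finset.univ.erase i, (γ j).choose (β j) := by
      refine Finset.prod_congr rfl fun j hj => ?_
      have hj' : i ≠ j := (Finset.ne_of_mem_erase hj).symm
      simp [hj']
    have h4 : ∏ j ∈ Finset.univ.erase i, (γ j).choose ((β + Finsupp.single i 1 : Fin n →₀ ℕ) j)
        = ∏ j ∈ Finset.univ.erase i, (γ j).choose (β j) := by
      refine Finset.prod_congr rfl fun j hj => ?_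
      have hj' : i ≠ j := (Finset.ne_of_mem_erase hj).symm
      simp [hj']
    rw [h3, h4]
    simp only [Finsupp.add_apply, Finsupp.single_eq_same]
    rw [add_comm 1 (γ i), Nat.choose_succ_succ, add_mul]
  rw [h1, h2]
  by_cases hγ : β i + 1 ≤ γ i
  · have h5 : Finsupp.single i 1 + (γ - (β + Finsupp.single i 1)) = γ - β := by
      ext j
      by_cases hj : j = i
      · subst hj
        simp
        omega
      · simp [Ne.symm hj]
    rw [h5, ← map_add]
    push_cast
    ring_nf
  · have h6 : ∏ j, (γ j).choose ((β + Finsupp.single i 1 : Fin n →₀ ℕ) j) = 0 := by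
      refine Finset.prod_eq_zero (Finset.mem_univ i) (Nat.choose_eq_zero_of_lt ?_)
      simp
      omega
    rw [h6]
    simp

theorem divPowEnd_mem (β : Fin n →₀ ℕ) : divPowEnd K n β ∈ diffOpOrder K (P K n) β.degree := by
  have main : ∀ (m : ℕ) (β : Fin n →₀ ℕ), β.degree = m →
      divPowEnd K n β ∈ diffOpOrder K (P K n) m := by
    intro m
    induction m with
    | zero =>
      intro β hβ
      rw [Finsupp.degree_eq_zero_iff] at hβ
      subst hβ
      rw [divPowEnd_zero]
      intro a
      rw [one_mul, mul_one, sub_self]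
    | succ m ih =>
      intro β hβ a
      induction a using MvPolynomial.induction_on with
      | C c =>
        rw [← MvPolynomial.algebraMap_eq, AlgHom.commutes, Algebra.commutes, sub_self]
        exact Submodule.zero_mem _
      | add a b ha hb =>
        rw [map_add, mul_add, add_mul, add_sub_add_comm]
        exact Submodule.add_mem _ ha hb
      | mul_X a i ha =>
        have hX : divPowEnd K n β * Algebra.lmul K (P K n) (MvPolynomial.X i)
            - Algebra.lmul K (P K n) (MvPolynomial.X i) * divPowEnd K n β
            ∈ diffOpOrder K (P K n) m := by
          by_cases hi : β i = 0
          · rw [divPowEnd_X_of_eq_zero K n hi]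
            exact Submodule.zero_mem _
          · have hle : Finsupp.single i 1 ≤ β :=
              Finsupp.single_le_iff.2 (Nat.one_le_iff_ne_zero.2 hi)
            have hb : β - Finsupp.single i 1 + Finsupp.single i 1 = β := tsub_add_cancel_of_le hle
            rw [← hb, divPowEnd_add_single_X]
            refine ih _ ?_
            have h7 := congrArg Finsupp.degree hb
            rw [map_add, Finsupp.degree_single, hβ] at h7
            omega
        have h8 : divPowEnd K n β * Algebra.lmul K (P K n) (a * MvPolynomial.X i)
            - Algebra.lmul K (P K n) (a * MvPolynomial.X i) * divPowEnd K n β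
            = (divPowEnd K n β * Algebra.lmul K (P K n) a
                - Algebra.lmul K (P K n) a * divPowEnd K n β)
                * Algebra.lmul K (P K n) (MvPolynomial.X i)
              + Algebra.lmul K (P K n) a
                * (divPowEnd K n β * Algebra.lmul K (P K n) (MvPolynomial.X i)
                  - Algebra.lmul K (P K n) (MvPolynomial.X i) * divPowEnd K n β) := by
          rw [map_mul]
          simp only [mul_sub, sub_mul, mul_assoc]
          abel
        rw [h8]
        refine Submodule.add_mem _ ?_ ?_
        · exact mul_mem_diffOpOrder m 0 ha (lmul_mem_diffOpOrder _)
        · have h9 := mul_mem_diffOpOrder 0 m (lmul_mem_diffOpOrder a) hX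
          rwa [zero_add] at h9
  exact main _ β rfl

/-- The divided power `∂^[β]` as an element of `D(P_n)`. -/
def divPow (β : Fin n →₀ ℕ) : D K n := ⟨divPowEnd K n β, β.degree, divPowEnd_mem K n β⟩

/-- The inclusion of `P_n` in `D(P_n)` as multiplication operators. -/
def polyIncl : P K n →ₐ[K] D K n :=
  show P K n →ₐ[K] ↥(diffOps K (P K n)) from
    (Algebra.lmul K (P K n)).codRestrict (diffOps K (P K n)) fun a => ⟨0, lmul_mem_diffOpOrder a⟩

/-- The canonical filtration of `D(P_n)`: `F_i` is spanned by the `x^α ∂^[β]` with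
`|α| + |β| ≤ i`. -/
def canonicalFiltration (i : ℕ) : Submodule K (D K n) :=
  Submodule.span K {y | ∃ α β : Fin n →₀ ℕ, α.degree + β.degree ≤ i ∧
    y = polyIncl K n (MvPolynomial.monomial α 1) * divPow K n β}

/-- The subalgebra `T_k = Λ_[p^k] ⊗ P_n` of `D(P_n)`, generated by `P_n` and the span `Λ_[p^k]` of
the `∂^[β]` with `β j < p ^ k` for all `j`. -/
def T (p k : ℕ) : Subalgebra K (D K n) :=
  Algebra.adjoin K (Set.range (polyIncl K n) ∪
    {y | ∃ β : Fin n →₀ ℕ, (∀ j, β j < p ^ k) ∧ y = divPow K n β})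

/-- The filtration of `T_k` induced by the canonical filtration of `D(P_n)`. -/
def inducedFiltration (p k : ℕ) (i : ℕ) : Submodule K (T K n p k) :=
  (canonicalFiltration K n i).comap (T K n p k).val.toLinearMap

end Poly

/-! ### Filtrations, growth and dimensions -/

/-- The degree `γ(f) = inf {r | f(i) ≤ i ^ r for i ≫ 0}` of a function, in `[0, ∞]`. -/
def growth (f : ℕ → ℕ) : ℝ≥0∞ :=
  ⨅ (r : ℝ≥0) (_ : ∀ᶠ i : ℕ in atTop, (f i : ℝ) ≤ (i : ℝ) ^ (r : ℝ)), (r : ℝ≥0∞)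

section Filtrations

variable {K : Type u} [Field K] {A : Type v} [Ring A] [Algebra K A]

/-- Finite dimensional (exhaustive, ascending) filtrations of a `K`-algebra. -/
structure IsFiniteFiltration (F : ℕ → Submodule K A) : Prop where
  mono : Monotone F
  exhaust : ∀ a : A, ∃ i, a ∈ F i
  one_mem : (1 : A) ∈ F 0
  mul_mem : ∀ i j, ∀ a ∈ F i, ∀ b ∈ F j, a * b ∈ F (i + j)
  finite : ∀ i, FiniteDimensional K (F i)

/-- Equivalence of filtrations. -/
def FiltrationEquiv (F G : ℕ → Submodule K A) : Prop :=
  ∃ a b c d : ℕ, 0 < a ∧ 0 < c ∧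
    ∀ᶠ i : ℕ in atTop, F i ≤ G (a * i + b) ∧ G i ≤ F (c * i + d)

variable {M : Type w} [AddCommGroup M] [Module K M] [Module A M] [IsScalarTower K A M]

/-- The Hilbert function `i ↦ dim_K (F_i M_0)`; here `F i • M₀` is the `K`-span of the products
`a • m` with `a` in `F_i` and `m` in `M_0`. -/
def hilb (F : ℕ → Submodule K A) (M₀ : Submodule K M) (i : ℕ) : ℕ :=
  Module.finrank K ↥(F i • M₀)

variable (A) in
/-- Finite dimensional subspaces that generate `M` as an `A`-module. -/
def IsGenerating (M₀ : Submodule K M) : Prop :=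
  FiniteDimensional K M₀ ∧ Submodule.span A (M₀ : Set M) = ⊤

variable (K A M) in
/-- The Gelfand-Kirillov dimension of an `A`-module: the supremum of the degrees of
`i ↦ dim_K (V ^ i W)` over finite dimensional subspaces `V` of `A` and `W` of `M`. -/
def gkDim : ℝ≥0∞ :=
  ⨆ (V : Submodule K A) (_ : FiniteDimensional K V)
    (W : Submodule K M) (_ : FiniteDimensional K W), growth (hilb (fun i => V ^ i) W)

/-- A function is an almost polynomial of period `m`, degree `d`, leading coefficient `c`, with
coefficients in `S`: for large `i` it is given by polynomials indexed by the class of `i` modulo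
`m`, all of degree `d` and leading coefficient `c`. -/
def IsAlmostPolynomial (f : ℕ → ℕ) (m d : ℕ) (c : ℚ) (S : Set ℚ) : Prop :=
  ∃ q : ZMod m → ℚ[X],
    (∀ᶠ i : ℕ in atTop, (f i : ℚ) = (q (i : ZMod m)).eval (i : ℚ)) ∧
    ∀ s, (q s).degree = d ∧ (q s).leadingCoeff = c ∧ ∀ j, (q s).coeff j ∈ S

variable (M) in
/-- `e` is the multiplicity of `M` with respect to the filtration `F` of `A`: for all finite
dimensional generating subspaces, the Hilbert function is an almost polynomial, and `d! c = e` for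
its degree `d` and leading coefficient `c`. -/
def HasMultiplicity (F : ℕ → Submodule K A) (e : ℚ) : Prop :=
  ∀ M₀ : Submodule K M, IsGenerating A M₀ →
    ∃ (m d : ℕ) (c : ℚ), 0 < m ∧ IsAlmostPolynomial (hilb F M₀) m d c Set.univ ∧ e = d ! * c

end Filtrations

section Dimension

variable (K : Type u) [Field K] (n : ℕ)

/-- Filtrations of standard type of `D(P_n)`: the finite dimensional filtrations equivalent to the
canonical one. -/
def IsStandardType (F : ℕ → Submodule K (D K n)) : Prop :=
  IsFiniteFiltration (A := D K n) F ∧ FiltrationEquiv (A := D K n) F (canonicalFiltration K n)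

/-- The dimension `Dim(M)` of a finitely generated `D(P_n)`-module, the degree of
`i ↦ dim_K (F_i M_0)` for the canonical filtration and any finite dimensional generating subspace
(the infimum is over a set of equal values). -/
def Dim (M : Type w) [AddCommGroup M] [Module K M] [Module (D K n) M]
    [IsScalarTower K (D K n) M] : ℝ≥0∞ :=
  ⨅ (M₀ : Submodule K M) (_ : IsGenerating (D K n) M₀), growth (hilb (A := D K n) (canonicalFiltration K n) M₀)

end Dimension

/-! ### Induced modules -/

section Induced

variable {K : Type u} [Field K] {A : Type v} [Ring A] [Algebra K A] (B : Subalgebra K A)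
variable (N : Type w) [AddCommGroup N] [Module K N] [Module B N] [IsScalarTower K B N]

/-- The relations `a b ⊗ x = a ⊗ b x`, for `b` in `B`, in `A ⊗_K N`. -/
def balancedRel : Submodule A (A ⊗[K] N) :=
  Submodule.span A {z | ∃ (a : A) (b : B) (x : N), z = (a * (b : A)) ⊗ₜ[K] x - a ⊗ₜ[K] (b • x)}

/-- The `A`-module `A ⊗_B N`, for a subalgebra `B` of `A` and a `B`-module `N`. -/
abbrev Induced : Type (max v w) := (A ⊗[K] N) ⧸ balancedRel B N

/-- The map `N → A ⊗_B N`, `x ↦ 1 ⊗ x`. -/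
def toInduced : N →ₗ[K] Induced B N :=
  ((balancedRel B N).mkQ.restrictScalars K).comp (TensorProduct.mk K A N 1)

end Induced

/-! ### Poincaré series -/

/-- The rational function `r` is the Poincaré series `∑ f(i) ω^i`. -/
def IsPoincareSeries (f : ℕ → ℕ) (r : RatFunc ℚ) : Prop :=
  (r.denom : PowerSeries ℚ) * PowerSeries.mk (fun i => (f i : ℚ)) = (r.num : PowerSeries ℚ)

/-- The order of the pole of a rational function at `1` (the numerator and the denominator of `r`
are coprime). -/
def poleOrderAtOne (r : RatFunc ℚ) : ℕ := r.denom.rootMultiplicity 1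

end PrimeDiffOp

end

open PrimeDiffOp

noncomputable section

namespace PrimeDiffOp

/-! ### Growth -/

/-! The ring $\mathcal D$ is far from Noetherian, but it is the union of the rings $T_k$, each of
which is finite over $P_n$. A finite presentation involves finitely many operators, all lying in one
$T_k$, so the same generators and relations define a $T_k$-module $M'$ with $M\simeq\mathcal
D\otimes_{T_k}M'$ (`exists_presentation`).

Two structural facts then determine the Hilbert function. First, beyond degree $np^k$ the filtration
of $T_k$ grows only through $P_n$ (`inducedFiltration_add_le`), so the Hilbert–Serre argument for
$P_n$ gives $M'$ the series $H(\omega)/(1-\omega)^{d+1}$ with $d\le n$ and $H(1)=e(M')\ne0$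
(`exists_polynomial_hilbertSeries`, `exists_series_hilb_inducedFiltration`). Second, $\mathcal D$ is
a free right $T_k$-module on the $\partial^{[p^k\gamma]}$, compatibly with the filtrations:
$F_i=\bigoplus_\gamma\partial^{[p^k\gamma]}\mathcal T_{k,i-p^k|\gamma|}$. Spanning is division of
exponents by $p^k$ together with a case of Lucas' theorem. Independence holds because the commutator
with $x_j^{p^k}$ annihilates $T_k$ and lowers $\gamma_j$ by one (`sumDivPow_injective`,
`exists_sumDivPow_eq`). Each of the $n$ coordinates of $\gamma$ contributes a factor
$1/(1-\omega^{p^k})$ (`ser_hilb_map_toInduced`), so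
$$P_M(\omega)=\frac{H(\omega)}{(1-\omega)^{d+1}(1-\omega^{p^k})^n}.$$ The pole at $1$ has order
$n+d+1$ and leading value $H(1)/p^{kn}$. Over the common denominator $(1-\omega^{p^k})^{n+d+1}$ the
coefficients form an almost polynomial of period $p^k$ with the stated denominators.

Independence of choices is a comparison of growth. Two generating subspaces bound each other up to a
shift of $i$, which preserves both degree and leading coefficient (`Asymp.eq_of_le`). Filtrations of
standard type are comparable only up to dilation, which preserves the degree alone
(`growth_hilb_eq`). Every dimension from $n$ to $2n$ is attained by inducing
$P_n/(x_{j+1},\dots,x_n)$ from $T_0=P_n$. -/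

/-- `f` grows like `c i ^ N`, with `c > 0`. -/
def Asymp (f : ℕ → ℕ) (N : ℕ) (c : ℝ) : Prop :=
  0 < c ∧ Tendsto (fun i : ℕ => (f i : ℝ) / (i : ℝ) ^ N) atTop (nhds c)

/-- For every `ε > 0` the constant `C` is eventually absorbed by `i ^ ε`, and the infimum does not
see `ε`. -/
theorem growth_le_of_forall {f : ℕ → ℕ} {N : ℕ} {C : ℝ}
    (h : ∀ᶠ i : ℕ in atTop, (f i : ℝ) ≤ C * (i : ℝ) ^ N) : growth f ≤ N := by
  refine ENNReal.le_of_forall_pos_le_add fun ε hε _ => ?_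
  have h1 : ∀ᶠ i : ℕ in atTop, (f i : ℝ) ≤ (i : ℝ) ^ (((N : ℝ≥0) + ε : ℝ≥0) : ℝ) := by
    have h2 : ∀ᶠ i : ℕ in atTop, C ≤ (i : ℝ) ^ (ε : ℝ) :=
      ((tendsto_rpow_atTop (by exact_mod_cast hε)).comp
        tendsto_natCast_atTop_atTop).eventually_ge_atTop C
    filter_upwards [h, h2, eventually_gt_atTop 0] with i hi h2 h0
    have h3 : (0 : ℝ) < i := by exact_mod_cast h0
    push_cast
    rw [Real.rpow_add h3, Real.rpow_natCast, mul_comm]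
    exact hi.trans (mul_le_mul_of_nonneg_right h2 (by positivity))
  refine (iInf₂_le (f := fun (r : ℝ≥0) _ => (r : ℝ≥0∞)) _ h1).trans ?_
  push_cast
  exact le_rfl

theorem eventually_affine_le (a b : ℕ) :
    ∀ᶠ i : ℕ in atTop, ((a * i + b : ℕ) : ℝ) ≤ (a + b + 1 : ℝ) * i := by
  filter_upwards [eventually_ge_atTop 1] with i hi
  have : (1 : ℝ) ≤ i := by exact_mod_cast hi
  push_cast
  nlinarith [(Nat.cast_nonneg b : (0 : ℝ) ≤ b)]

theorem Asymp.eventually_le {f : ℕ → ℕ} {N : ℕ} {c : ℝ} (hf : Asymp f N c) :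
    ∀ᶠ i : ℕ in atTop, (f i : ℝ) ≤ (2 * c) * (i : ℝ) ^ N := by
  have h1 := hf.2.eventually_le_const (u := 2 * c) (by linarith [hf.1])
  filter_upwards [h1, eventually_gt_atTop 0] with i h1 h0
  have h3 : (0 : ℝ) < i := by exact_mod_cast h0
  rwa [div_le_iff₀ (by positivity)] at h1

theorem Asymp.eventually_ge {f : ℕ → ℕ} {N : ℕ} {c : ℝ} (hf : Asymp f N c) :
    ∀ᶠ i : ℕ in atTop, (c / 2) * (i : ℝ) ^ N ≤ f i := by
  have h1 := hf.2.eventually_const_le (u := c / 2) (by linarith [hf.1])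
  filter_upwards [h1, eventually_gt_atTop 0] with i h1 h0
  have h3 : (0 : ℝ) < i := by exact_mod_cast h0
  rwa [le_div_iff₀ (by positivity)] at h1

theorem Asymp.growth_le {f g : ℕ → ℕ} {N : ℕ} {c : ℝ} (hf : Asymp f N c) {a b : ℕ}
    (ha : 0 < a) (h : ∀ᶠ i in atTop, g i ≤ f (a * i + b)) : growth g ≤ N := by
  refine growth_le_of_forall (C := 2 * c * (a + b + 1) ^ N) ?_
  have ht : Tendsto (fun i => a * i + b) atTop atTop :=
    tendsto_atTop_mono (fun i => (Nat.le_mul_of_pos_left i ha).trans (Nat.le_add_right _ b))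
      tendsto_id
  filter_upwards [h, ht.eventually hf.eventually_le, eventually_affine_le a b] with i h1 h2 h3
  have h1' : (g i : ℝ) ≤ f (a * i + b) := by exact_mod_cast h1
  refine h1'.trans (h2.trans ?_)
  rw [mul_assoc (2 * c), ← mul_pow]
  have := hf.1
  gcongr

/-- An exponent `r < N` for `g` would bound `i ^ N` by a constant times `i ^ r` along the dilated
arguments, so `i ^ (N - r)` would stay bounded. -/
theorem Asymp.le_growth {f g : ℕ → ℕ} {N : ℕ} {c : ℝ} (hf : Asymp f N c) {a b : ℕ}
    (ha : 0 < a) (h : ∀ᶠ i in atTop, f i ≤ g (a * i + b)) : (N : ℝ≥0∞) ≤ growth g := by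
  refine le_iInf₂ fun r hr => ?_
  by_contra hlt
  rw [not_le] at hlt
  have hrN : (r : ℝ) < N := by
    have : r < (N : ℝ≥0) := by exact_mod_cast hlt
    exact_mod_cast this
  have ht : Tendsto (fun i => a * i + b) atTop atTop :=
    tendsto_atTop_mono (fun i => (Nat.le_mul_of_pos_left i ha).trans (Nat.le_add_right _ b))
      tendsto_id
  -- Multiplied by `c / 2`, this threshold exceeds `(a + b + 1) ^ r` by exactly `c / 2`, which is
  -- the final contradiction.
  have h2 : ∀ᶠ i : ℕ in atTop, 2 / c * (a + b + 1 : ℝ) ^ (r : ℝ) + 1 ≤ (i : ℝ) ^ ((N : ℝ) - r) :=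
    ((tendsto_rpow_atTop (by linarith)).comp
      tendsto_natCast_atTop_atTop).eventually_ge_atTop _
  obtain ⟨i, h0, h1, h2, h3, h4, h5⟩ := ((eventually_gt_atTop 0).and (h.and (h2.and
    ((ht.eventually hr).and (hf.eventually_ge.and (eventually_affine_le a b)))))).exists
  have hi : (0 : ℝ) < i := by exact_mod_cast h0
  have hc := hf.1
  have h6 : c / 2 * (i : ℝ) ^ N ≤ (a + b + 1 : ℝ) ^ (r : ℝ) * (i : ℝ) ^ (r : ℝ) := by
    rw [← Real.mul_rpow (by positivity) hi.le]
    refine h4.trans (le_trans (by exact_mod_cast h1) (h3.trans ?_))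
    exact Real.rpow_le_rpow (Nat.cast_nonneg _) h5 r.2
  have h7 : (i : ℝ) ^ N = (i : ℝ) ^ ((N : ℝ) - r) * (i : ℝ) ^ (r : ℝ) := by
    rw [← Real.rpow_add hi, sub_add_cancel, Real.rpow_natCast]
  rw [h7, ← mul_assoc] at h6
  have h8 := le_of_mul_le_mul_right h6 (by positivity)
  have h9 : c / 2 * (2 / c * (a + b + 1 : ℝ) ^ (r : ℝ) + 1) ≤ (a + b + 1 : ℝ) ^ (r : ℝ) :=
    (mul_le_mul_of_nonneg_left h2 (by positivity)).trans h8
  have h10 : c / 2 * (2 / c * (a + b + 1 : ℝ) ^ (r : ℝ) + 1) = (a + b + 1 : ℝ) ^ (r : ℝ) + c / 2 := by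
    field_simp
  linarith

theorem Asymp.growth_eq {f : ℕ → ℕ} {N : ℕ} {c : ℝ} (hf : Asymp f N c) : growth f = N :=
  le_antisymm (hf.growth_le (a := 1) (b := 0) one_pos (by simp))
    (hf.le_growth (a := 1) (b := 0) one_pos (by simp))

theorem Asymp.tendsto_shift {f : ℕ → ℕ} {N : ℕ} {c : ℝ} (hf : Asymp f N c) (b : ℕ) :
    Tendsto (fun i : ℕ => (f (i + b) : ℝ) / (i : ℝ) ^ N) atTop (nhds c) := by
  have h1 : Tendsto (fun i : ℕ => (((i + b : ℕ) : ℝ) / i) ^ N) atTop (nhds (1 ^ N)) := by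
    refine Tendsto.pow ?_ N
    have h2 : Tendsto (fun i : ℕ => 1 + (b : ℝ) / i) atTop (nhds (1 + 0)) :=
      tendsto_const_nhds.add (tendsto_const_div_atTop_nhds_zero_nat _)
    rw [add_zero] at h2
    refine h2.congr' ?_
    filter_upwards [eventually_gt_atTop 0] with i h0
    have h3 : (0 : ℝ) < i := by exact_mod_cast h0
    push_cast
    field_simp
  have h4 := (hf.2.comp (tendsto_add_atTop_nat b)).mul h1
  rw [one_pow, mul_one] at h4
  refine h4.congr' ?_
  filter_upwards [eventually_gt_atTop 0] with i h0
  have h3 : (0 : ℝ) < i := by exact_mod_cast h0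
  have h5 : (0 : ℝ) < ((i + b : ℕ) : ℝ) := by exact_mod_cast (by omega : 0 < i + b)
  simp only [Function.comp, div_pow]
  field_simp

/-- A shift of the argument changes neither the degree nor the limit of `f i / i ^ N`. A dilation
would change the limit, so only shifts are allowed here. This is what makes the multiplicity
independent of the generating subspace. -/
theorem Asymp.eq_of_le {f g : ℕ → ℕ} {N N' : ℕ} {c c' : ℝ} (hf : Asymp f N c)
    (hg : Asymp g N' c') {b b' : ℕ} (h : ∀ i, f i ≤ g (i + b)) (h' : ∀ i, g i ≤ f (i + b')) :
    N = N' ∧ c = c' := by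
  have hN : N = N' := by
    have h1 : (N' : ℝ≥0∞) = N := by
      rw [← hg.growth_eq]
      exact le_antisymm
        (hf.growth_le (a := 1) (b := b') one_pos (Eventually.of_forall fun i => by
          simpa using h' i))
        (hf.le_growth (a := 1) (b := b) one_pos (Eventually.of_forall fun i => by
          simpa using h i))
    exact_mod_cast h1.symm
  subst hN
  refine ⟨rfl, le_antisymm ?_ ?_⟩
  · refine le_of_tendsto_of_tendsto hf.2 (hg.tendsto_shift b) (Eventually.of_forall fun i => ?_)
    have : (f i : ℝ) ≤ g (i + b) := by exact_mod_cast h i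
    simp only
    gcongr
  · refine le_of_tendsto_of_tendsto hg.2 (hf.tendsto_shift b') (Eventually.of_forall fun i => ?_)
    have : (g i : ℝ) ≤ f (i + b') := by exact_mod_cast h' i
    simp only
    gcongr

theorem asymp_add_one_pow (j : ℕ) : Asymp (fun i => (i + 1) ^ j) j 1 := by
  have h1 : Asymp (fun i => i ^ j) j 1 := by
    refine ⟨one_pos, tendsto_const_nhds.congr' ?_⟩
    filter_upwards [eventually_gt_atTop 0] with i h0
    have h3 : (0 : ℝ) < i := by exact_mod_cast h0
    push_cast
    field_simp
  exact ⟨one_pos, h1.tendsto_shift 1⟩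

theorem IsAlmostPolynomial.asymp {f : ℕ → ℕ} {m d : ℕ} {c : ℚ} {S : Set ℚ} (hm : 0 < m)
    (hf : IsAlmostPolynomial f m d c S) : Asymp f d (c : ℝ) := by
  obtain ⟨q, hq, h⟩ := hf
  have : NeZero m := ⟨hm.ne'⟩
  have key : Tendsto (fun i : ℕ => (f i : ℝ) / (i : ℝ) ^ d) atTop (nhds (c : ℝ)) := by
    have h1 : ∀ s, Tendsto (fun i : ℕ => ((q s).map (algebraMap ℚ ℝ)).eval (i : ℝ) / (i : ℝ) ^ d)
        atTop (nhds (c : ℝ)) := by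
      intro s
      have h2 := Polynomial.div_tendsto_atTop_leadingCoeff_div_of_degree_eq
        (P := (q s).map (algebraMap ℚ ℝ)) (Q := (X ^ d : ℝ[X])) (by
          rw [degree_map, (h s).1, degree_X_pow])
      rw [leadingCoeff_map, (h s).2.1] at h2
      simp only [eval_pow, eval_X, leadingCoeff_X_pow, div_one] at h2
      exact h2.comp tendsto_natCast_atTop_atTop
    -- There are finitely many residue classes and all their quotients tend to `c`, so one bound on
    -- `i` serves for all classes at once.
    rw [tendsto_def]
    intro U hU
    have h3 : ∀ᶠ i : ℕ in atTop, ∀ s,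
        ((q s).map (algebraMap ℚ ℝ)).eval (i : ℝ) / (i : ℝ) ^ d ∈ U :=
      eventually_all.2 fun s => (h1 s).eventually hU
    filter_upwards [hq, h3] with i hi h3
    have h4 : (f i : ℝ) = ((q (i : ZMod m)).map (algebraMap ℚ ℝ)).eval (i : ℝ) := by
      have h5 : ((i : ℕ) : ℝ) = algebraMap ℚ ℝ (i : ℚ) := by simp
      rw [h5, eval_map_apply, ← hi]
      simp
    rw [Set.mem_preimage, h4]
    exact h3 _
  -- The limit of nonnegative quotients is nonnegative, and `c = 0` would make `q 0` zero although
  -- its degree is `d`.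
  refine ⟨lt_of_le_of_ne ?_ ?_, key⟩
  · exact ge_of_tendsto' key fun i => by positivity
  · intro h0
    have h6 : c = 0 := by exact_mod_cast h0.symm
    have h7 := (h 0).2.1
    rw [h6, leadingCoeff_eq_zero] at h7
    have h8 := (h 0).1
    rw [h7, degree_zero] at h8
    exact absurd h8 (by simp)

/-! ### Generating series -/

/-- The generating series of `f`. -/
def ser (f : ℕ → ℕ) : PowerSeries ℤ := PowerSeries.mk fun i => (f i : ℤ)

/-- The polynomial `1 + X + ⋯ + X ^ (q - 1)`. -/
def geom (q : ℕ) : ℤ[X] := ∑ a ∈ Finset.range q, X ^ a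

theorem geom_eval_one (q : ℕ) : (geom q).eval 1 = q := by simp [geom, eval_finsetSum]

theorem geom_mul (q : ℕ) : geom q * (1 - X) = 1 - X ^ q := geom_sum_mul_neg X q

theorem coeff_geom (q i : ℕ) : (geom q).coeff i = if i < q then 1 else 0 := by
  simp [geom, finsetSum_coeff, coeff_X_pow]

/-- Lowering `i` by `q` lowers `i / q` by one, so multiplication by `1 - X ^ q` is a difference in
the upper index of the binomial, and Pascal's rule reduces `N + 1` to `N`. For `i < q` both
binomials equal `1`. -/
theorem one_sub_X_pow_mul_floor {q : ℕ} (hq : 0 < q) (N : ℕ) :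
    (1 - PowerSeries.X ^ q) ^ (N + 1)
      * PowerSeries.mk (fun i => (((i / q + N).choose N : ℕ) : ℤ)) = (geom q : PowerSeries ℤ) := by
  induction N with
  | zero =>
    ext i
    rw [zero_add, pow_one, sub_mul, one_mul, map_sub, PowerSeries.coeff_X_pow_mul',
      Polynomial.coeff_coe, coeff_geom]
    simp only [PowerSeries.coeff_mk, add_zero, Nat.choose_zero_right]
    split_ifs with h1 h2 h2
    · omega
    · simp
    · simp
    · omega
  | succ N ih =>
    rw [← ih, pow_succ _ (N + 1), mul_assoc]
    congr 1
    ext i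
    rw [sub_mul, one_mul, map_sub, PowerSeries.coeff_X_pow_mul']
    simp only [PowerSeries.coeff_mk]
    split_ifs with h
    · have h1 : i / q = (i - q) / q + 1 := by
        rw [Nat.div_eq i q, if_pos ⟨hq, h⟩]
      rw [h1, show (i - q) / q + 1 + (N + 1) = ((i - q) / q + 1 + N) + 1 by ring,
        Nat.choose_succ_succ, show (i - q) / q + (N + 1) = (i - q) / q + 1 + N by ring]
      push_cast
      ring
    · rw [Nat.div_eq_of_lt (by omega)]
      simp

theorem one_sub_X_pow_ne_zero {q : ℕ} (hq : 0 < q) :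
    (1 - PowerSeries.X ^ q : PowerSeries ℤ) ≠ 0 := by
  intro h
  have := congrArg (PowerSeries.coeff 0) h
  rw [map_sub, PowerSeries.coeff_X_pow] at this
  simp [hq.ne] at this

/-- Cancelling `(1 - X ^ q) ^ (N + 1)` exhibits `f` as the convolution of the coefficients of `H`
with the floor binomials. Once `i` reaches the degree of `H`, cutting the convolution at `i` loses
no coefficient. -/
theorem coeff_eq_sum_of_mul_eq {q N : ℕ} (hq : 0 < q) {f : ℕ → ℕ} {H : ℤ[X]}
    (h : (1 - PowerSeries.X ^ q) ^ (N + 1) * ser f = ((H * geom q : ℤ[X]) : PowerSeries ℤ))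
    {i : ℕ} (hi : H.natDegree ≤ i) :
    (f i : ℤ) = ∑ l ∈ Finset.range (H.natDegree + 1),
      H.coeff l * ((((i - l) / q + N).choose N : ℕ) : ℤ) := by
  rw [Polynomial.coe_mul, ← one_sub_X_pow_mul_floor hq N, mul_left_comm] at h
  have h2 := congrArg (PowerSeries.coeff i) (mul_left_cancel₀ (pow_ne_zero _
    (one_sub_X_pow_ne_zero hq)) h)
  rw [ser, PowerSeries.coeff_mk, PowerSeries.coeff_mul,
    Finset.Nat.sum_antidiagonal_eq_sum_range_succ_mk] at h2
  rw [h2]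
  simp only [Polynomial.coeff_coe, PowerSeries.coeff_mk]
  refine (Finset.sum_subset (Finset.range_mono (by omega)) fun l _ hl => ?_).symm
  rw [coeff_eq_zero_of_natDegree_lt (by simpa using hl), zero_mul]

/-- The monic polynomial of degree `N` whose value at `q m + c` is `q ^ N N! (m + N choose N)`. -/
def risingPoly (q N : ℕ) (c : ℤ) : ℤ[X] :=
  ∏ j ∈ Finset.range N, (X + C ((q * (j + 1) : ℕ) - c : ℤ))

theorem risingPoly_monic (q N : ℕ) (c : ℤ) : (risingPoly q N c).Monic :=
  monic_prod_of_monic _ _ fun _ _ => monic_X_add_C _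

theorem risingPoly_natDegree (q N : ℕ) (c : ℤ) : (risingPoly q N c).natDegree = N := by
  rw [risingPoly, natDegree_prod_of_monic _ _ fun _ _ => monic_X_add_C _]
  simp only [natDegree_X_add_C]
  simp

theorem risingPoly_eval (q N m : ℕ) (c : ℤ) :
    (risingPoly q N c).eval ((q * m : ℕ) + c : ℤ) = (q ^ N * N ! * (m + N).choose N : ℕ) := by
  have h1 : ∏ j ∈ Finset.range N, (m + (j + 1)) = N ! * (m + N).choose N := by
    rw [← Nat.ascFactorial_eq_factorial_mul_choose, Nat.ascFactorial_eq_prod_range]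
    exact Finset.prod_congr rfl fun j _ => by ring
  have h2 : ∀ j : ℕ, ((q * m : ℕ) + c : ℤ) + ((q * (j + 1) : ℕ) - c : ℤ)
      = (q : ℤ) * ((m + (j + 1) : ℕ) : ℤ) := by
    intro j
    push_cast
    ring
  rw [risingPoly, eval_prod]
  simp only [eval_add, eval_X, eval_C, h2]
  rw [Finset.prod_mul_distrib, Finset.prod_const, Finset.card_range, mul_assoc, ← h1]
  push_cast
  rfl

/-- On a residue class of `i`, each floor binomial is `1 / (q ^ N N!)` times a monic integral
polynomial in `i`. Weighting by the coefficients of `H` gives leading coefficient `H(1)` on every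
class, and integrality bounds the denominators. -/
theorem isAlmostPolynomial_of_series {q N : ℕ} (hq : 0 < q) {f : ℕ → ℕ} {H : ℤ[X]}
    (h : (1 - PowerSeries.X ^ q) ^ (N + 1) * ser f = ((H * geom q : ℤ[X]) : PowerSeries ℤ))
    (hH : H.eval 1 ≠ 0) :
    IsAlmostPolynomial f q N ((H.eval 1 : ℤ) / ((q : ℚ) ^ N * N !))
      {c | ∃ z : ℤ, c = (z : ℚ) / ((q : ℚ) ^ N * N !)} := by
  have : NeZero q := ⟨hq.ne'⟩
  have hD : ((q : ℚ) ^ N * N !) ≠ 0 := by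
    have := Nat.factorial_ne_zero N
    positivity
  -- If `i` is in the class `s`, the remainder of `i - l` modulo `q` is `(s - l).val`, so `i` is `q
  -- * ((i - l) / q)` plus the constant `l + (s - l).val`; this is the argument at which
  -- `risingPoly_eval` applies.
  set Q : ZMod q → ℤ[X] := fun s => ∑ l ∈ Finset.range (H.natDegree + 1),
    C (H.coeff l) * risingPoly q N (l + ((s - l).val : ℕ)) with hQ
  have hcoeff : ∀ s, (Q s).coeff N = H.eval 1 := by
    intro s
    rw [hQ, finsetSum_coeff, eval_eq_sum_range]
    refine Finset.sum_congr rfl fun l _ => ?_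
    rw [coeff_C_mul]
    have h1 := (risingPoly_monic q N (l + ((s - l).val : ℕ))).coeff_natDegree
    rw [risingPoly_natDegree] at h1
    rw [h1]
    simp
  have hdeg : ∀ s, (Q s).degree = N := by
    intro s
    refine degree_eq_of_le_of_coeff_ne_zero ?_ (by rw [hcoeff]; exact hH)
    refine (degree_sum_le _ _).trans (Finset.sup_le fun l _ => ?_)
    rw [← natDegree_le_iff_degree_le]
    exact (natDegree_C_mul_le _ _).trans (risingPoly_natDegree _ _ _).le
  have hinj : Function.Injective (Int.castRingHom ℚ) := Int.cast_injective
  refine ⟨fun s => C ((q : ℚ) ^ N * N !)⁻¹ * (Q s).map (Int.castRingHom ℚ), ?_, fun s => ?_⟩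
  · filter_upwards [eventually_ge_atTop H.natDegree] with i hi
    have h1 := coeff_eq_sum_of_mul_eq hq h hi
    have h2 : (Q (i : ZMod q)).eval (i : ℤ) = (q ^ N * N ! : ℕ) * (f i : ℤ) := by
      rw [h1, hQ, eval_finsetSum, Finset.mul_sum]
      refine Finset.sum_congr rfl fun l hl => ?_
      have hl' : l ≤ i := (Nat.lt_succ_iff.1 (Finset.mem_range.1 hl)).trans hi
      have h3 : (((i : ZMod q) - l).val : ℕ) = (i - l) % q := by
        rw [← Nat.cast_sub hl', ZMod.val_natCast]
      have h4 : (i : ℤ) = ((q * ((i - l) / q) : ℕ) : ℤ) + (l + (((i : ZMod q) - l).val : ℕ)) := by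
        rw [h3]
        have := Nat.div_add_mod (i - l) q
        exact_mod_cast (by omega : i = q * ((i - l) / q) + (l + (i - l) % q))
      rw [eval_mul, eval_C]
      conv_lhs => rw [h4]
      rw [risingPoly_eval]
      push_cast
      ring
    rw [eval_mul, eval_C]
    have h7 : ((i : ℕ) : ℚ) = Int.castRingHom ℚ (i : ℤ) := by simp
    rw [h7, eval_map_apply, h2]
    simp only [eq_intCast]
    push_cast
    field_simp
  · refine ⟨?_, ?_, fun j => ⟨(Q s).coeff j, ?_⟩⟩
    · rw [degree_C_mul (inv_ne_zero hD), degree_map_eq_of_injective hinj, hdeg]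
    · have h8 : (Q s).leadingCoeff = H.eval 1 := by
        rw [leadingCoeff, natDegree_eq_of_degree_eq_some (hdeg s), hcoeff]
      rw [leadingCoeff_mul, leadingCoeff_C, leadingCoeff_map_of_injective hinj, h8]
      simp only [eq_intCast]
      field_simp
    · rw [coeff_C_mul, coeff_map]
      simp only [eq_intCast]
      field_simp

theorem coe_one_sub_X_pow (q : ℕ) :
    ((1 - X ^ q : ℤ[X]) : PowerSeries ℤ) = 1 - PowerSeries.X ^ q := by
  simp

/-- Multiplying by `geom q ^ (d + 1)` turns `(1 - X) ^ (d + 1)` into `(1 - X ^ q) ^ (d + 1)`. One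
factor `geom q` is the one demanded by the preceding form, and the other `d` contribute `q ^ d` at
`1`, which leaves `q ^ n` in the denominator of the leading coefficient. -/
theorem isAlmostPolynomial_of_mixed_series {q n d : ℕ} (hq : 0 < q) {f : ℕ → ℕ} {H : ℤ[X]}
    (h : (1 - PowerSeries.X) ^ (d + 1) * (1 - PowerSeries.X ^ q) ^ n * ser f
      = (H : PowerSeries ℤ)) (hH : H.eval 1 ≠ 0) :
    IsAlmostPolynomial f q (n + d) ((H.eval 1 : ℤ) / ((q : ℚ) ^ n * (n + d)!))
      {c | ∃ z : ℤ, c = (z : ℚ) / ((q : ℚ) ^ (n + d) * (n + d)!)} := by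
  have h1 : (1 - PowerSeries.X ^ q) ^ (n + d + 1) * ser f
      = ((H * geom q ^ d * geom q : ℤ[X]) : PowerSeries ℤ) := by
    have h2 : (1 - PowerSeries.X ^ q : PowerSeries ℤ) = (geom q : PowerSeries ℤ) * (1 - PowerSeries.X) := by
      rw [← coe_one_sub_X_pow, ← geom_mul]
      simp
    rw [mul_assoc H, ← pow_succ, Polynomial.coe_mul, ← h, add_assoc, pow_add _ n]
    nth_rewrite 2 [h2]
    rw [mul_pow, Polynomial.coe_pow]
    ring
  have hq' : (q : ℚ) ≠ 0 := by positivity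
  have h3 := isAlmostPolynomial_of_series hq h1 (by
    rw [eval_mul, eval_pow, geom_eval_one]
    exact mul_ne_zero hH (pow_ne_zero _ (by positivity)))
  have h4 : (((H * geom q ^ d).eval 1 : ℤ) : ℚ) / ((q : ℚ) ^ (n + d) * (n + d)!)
      = (H.eval 1 : ℤ) / ((q : ℚ) ^ n * (n + d)!) := by
    rw [eval_mul, eval_pow, geom_eval_one]
    push_cast
    rw [pow_add]
    field_simp
  rwa [h4] at h3

theorem rootMultiplicity_pow_eq {P : ℚ[X]} (hP : P ≠ 0) (m : ℕ) (a : ℚ) :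
    (P ^ m).rootMultiplicity a = m * P.rootMultiplicity a := by
  induction m with
  | zero => simp
  | succ m ih =>
    rw [pow_succ, rootMultiplicity_mul (mul_ne_zero (pow_ne_zero _ hP) hP), ih]
    ring

/-- Since `1 - X ^ q = geom q * (1 - X)`, the series is `H / ((1 - X) ^ (n + d + 1) * geom q ^ n)`.
Neither `H` nor `geom q` vanishes at `1`, so the pole order and the leading value are visible. The
remaining work is the passage to the reduced fraction. -/
theorem exists_poincareSeries {q n d : ℕ} (hq : 0 < q) {f : ℕ → ℕ} {H : ℤ[X]}
    (h : (1 - PowerSeries.X) ^ (d + 1) * (1 - PowerSeries.X ^ q) ^ n * ser f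
      = (H : PowerSeries ℤ)) (hH : H.eval 1 ≠ 0) :
    ∃ r : RatFunc ℚ, IsPoincareSeries f r ∧ poleOrderAtOne r = n + d + 1 ∧
      ((1 - RatFunc.X) ^ (n + d + 1) * r).eval (RingHom.id ℚ) 1 = (H.eval 1 : ℤ) / (q : ℚ) ^ n := by
  set A : ℚ[X] := H.map (Int.castRingHom ℚ) with hA
  set G : ℚ[X] := (geom q).map (Int.castRingHom ℚ) with hG
  have hq' : (q : ℚ) ≠ 0 := by positivity
  have hA1 : A.eval 1 = (H.eval 1 : ℤ) := by
    rw [hA, show (1 : ℚ) = Int.castRingHom ℚ 1 by simp, eval_map_apply]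
    simp
  have hG1 : G.eval 1 = q := by
    rw [hG, show (1 : ℚ) = Int.castRingHom ℚ 1 by simp, eval_map_apply, geom_eval_one]
    simp
  have hGX : G * (1 - X) = 1 - X ^ q := by
    have := congrArg (Polynomial.map (Int.castRingHom ℚ)) (geom_mul q)
    simpa using this
  have hG0 : G ≠ 0 := by
    intro h0
    rw [h0, eval_zero] at hG1
    exact hq' hG1.symm
  have hA0 : A ≠ 0 := by
    intro h0
    rw [h0, eval_zero] at hA1
    exact hH (by exact_mod_cast hA1.symm)
  have hX0 : (1 - X : ℚ[X]) ≠ 0 := by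
    intro h0
    have := congrArg (fun p => Polynomial.eval 0 p) h0
    simp at this
  set B : ℚ[X] := (1 - X) ^ (n + d + 1) * G ^ n with hB
  have hB0 : B ≠ 0 := mul_ne_zero (pow_ne_zero _ hX0) (pow_ne_zero _ hG0)
  set r : RatFunc ℚ := algebraMap ℚ[X] (RatFunc ℚ) A / algebraMap ℚ[X] (RatFunc ℚ) B with hr
  have hcross : r.num * B = A * r.denom := (RatFunc.num_mul_eq_mul_denom_iff hB0).2 hr
  have hmult : r.num.rootMultiplicity 1 + (n + d + 1) = r.denom.rootMultiplicity 1 := by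
    have h1 := congrArg (Polynomial.rootMultiplicity 1) hcross
    have hr0 : r.num ≠ 0 := RatFunc.num_ne_zero (div_ne_zero
      (by simpa using hA0) (by simpa using hB0))
    have hGr : G.rootMultiplicity 1 = 0 := rootMultiplicity_eq_zero (by
      rw [IsRoot, hG1]; exact hq')
    have hAr : A.rootMultiplicity 1 = 0 := rootMultiplicity_eq_zero (by
      rw [IsRoot, hA1]; exact_mod_cast hH)
    have hXr : (1 - X : ℚ[X]).rootMultiplicity 1 = 1 := by
      have : (1 - X : ℚ[X]) = C (-1) * (X - C 1) := by simp
      rw [this, rootMultiplicity_mul (by rw [← this]; exact hX0), rootMultiplicity_C,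
        rootMultiplicity_X_sub_C_self]
    rw [rootMultiplicity_mul (mul_ne_zero hr0 hB0), rootMultiplicity_mul
      (mul_ne_zero hA0 r.denom_ne_zero), hAr, hB, rootMultiplicity_mul hB0, rootMultiplicity_pow_eq hX0,
      rootMultiplicity_pow_eq hG0, hGr, hXr] at h1
    omega
  -- By `hmult`, a zero of the reduced numerator at `1` would also be a zero of the reduced
  -- denominator, against coprimality.
  have hnum : r.num.rootMultiplicity 1 = 0 := by
    by_contra h0
    have h1 : IsRoot r.num 1 := (rootMultiplicity_pos'.1 (Nat.pos_of_ne_zero h0)).2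
    have h2 : IsRoot r.denom 1 := (rootMultiplicity_pos'.1 (by omega)).2
    obtain ⟨a, b, hab⟩ := r.isCoprime_num_denom
    have := congrArg (Polynomial.eval 1) hab
    rw [eval_add, eval_mul, eval_mul, h1.eq_zero, h2.eq_zero] at this
    simp at this
  refine ⟨r, ?_, ?_, ?_⟩
  · have h1 : (B : PowerSeries ℚ) * PowerSeries.mk (fun i => (f i : ℚ)) = (A : PowerSeries ℚ) := by
      have h2 := congrArg (PowerSeries.map (Int.castRingHom ℚ)) h
      have h3 : PowerSeries.map (Int.castRingHom ℚ) (ser f)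
          = PowerSeries.mk (fun i => (f i : ℚ)) := by
        ext i
        simp [ser]
      have h4 : PowerSeries.map (Int.castRingHom ℚ) (H : PowerSeries ℤ) = (A : PowerSeries ℚ) := by
        rw [hA, Polynomial.polynomial_map_coe]
      rw [map_mul, h3, h4] at h2
      rw [← h2]
      congr 1
      have h5 : B = (1 - X) ^ (d + 1) * (1 - X ^ q) ^ n := by
        rw [hB, ← hGX, mul_pow]
        ring
      rw [h5]
      simp
    have h6 : (B : PowerSeries ℚ) ≠ 0 := by simpa using hB0
    refine mul_left_cancel₀ h6 ?_
    rw [mul_left_comm, h1, ← Polynomial.coe_mul, ← Polynomial.coe_mul, mul_comm B, hcross, mul_comm]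
  · rw [poleOrderAtOne, ← hmult, hnum, zero_add]
  · have h1 : (1 - RatFunc.X) ^ (n + d + 1) * r
        = algebraMap ℚ[X] (RatFunc ℚ) A / algebraMap ℚ[X] (RatFunc ℚ) (G ^ n) := by
      have h2 : (1 - RatFunc.X : RatFunc ℚ) = algebraMap ℚ[X] (RatFunc ℚ) (1 - X) := by simp
      have h3 : algebraMap ℚ[X] (RatFunc ℚ) (1 - X) ≠ 0 := (map_ne_zero_iff _
        (RatFunc.algebraMap_injective ℚ)).2 hX0
      rw [hr, hB, h2, map_mul, map_pow, ← mul_div_assoc]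
      exact mul_div_mul_left _ _ (pow_ne_zero _ h3)
    rw [h1]
    set x := algebraMap ℚ[X] (RatFunc ℚ) A / algebraMap ℚ[X] (RatFunc ℚ) (G ^ n) with hx
    have h4 : x.num * G ^ n = A * x.denom :=
      (RatFunc.num_mul_eq_mul_denom_iff (pow_ne_zero _ hG0)).2 hx
    have h5 : x.denom ∣ G ^ n := RatFunc.denom_div_dvd _ _
    have h6 : x.denom.eval 1 ≠ 0 := by
      intro h0
      obtain ⟨b, hb⟩ := h5
      have := congrArg (Polynomial.eval 1) hb
      rw [eval_pow, hG1, eval_mul, h0, zero_mul] at this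
      exact pow_ne_zero _ hq' this
    have h7 := congrArg (Polynomial.eval 1) h4
    rw [eval_mul, eval_mul, eval_pow, hG1, hA1] at h7
    rw [RatFunc.eval, eval₂_id, eval₂_id, div_eq_div_iff h6 (pow_ne_zero _ hq'), h7]

/-! ### Hilbert functions of filtered modules over polynomial rings -/

section Stable

variable {K : Type u} [Field K] {V : Type w} [AddCommGroup V] [Module K V] {ι : Type*}

/-- Sequences of subspaces that are mapped to the next term by all operators of a family. -/
def IsStable (y : ι → Module.End K V) (N : ℕ → Submodule K V) : Prop :=
  ∀ j i, (N i).map (y j) ≤ N (i + 1)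

theorem finrank_map_add_finrank_inf_ker (y : Module.End K V) (E : Submodule K V)
    [FiniteDimensional K E] :
    Module.finrank K ↥(E.map y) + Module.finrank K ↥(E ⊓ LinearMap.ker y)
      = Module.finrank K E := by
  have h1 := LinearMap.finrank_range_add_finrank_ker (y.domRestrict E)
  rw [LinearMap.range_domRestrict, LinearMap.ker_domRestrict] at h1
  rw [← h1, ← Submodule.finrank_map_subtype_eq E, Submodule.map_comap_subtype]

/-- The map `y` induces an isomorphism from `A / (A ∩ y⁻¹ C)` to `(C + y A) / C`. This is the
dimension count of the exact sequence in the Hilbert–Serre induction. -/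
theorem finrank_add_finrank_sup_map (y : Module.End K V) (A C : Submodule K V)
    [FiniteDimensional K A] [FiniteDimensional K C] :
    Module.finrank K ↥(A ⊓ C.comap y) + Module.finrank K ↥(C ⊔ A.map y)
      = Module.finrank K A + Module.finrank K C := by
  have h1 := finrank_map_add_finrank_inf_ker y A
  have : FiniteDimensional K ↥(A ⊓ C.comap y) :=
    Submodule.finiteDimensional_of_le inf_le_left
  have h2 := finrank_map_add_finrank_inf_ker y (A ⊓ C.comap y)
  have h3 : A ⊓ C.comap y ⊓ LinearMap.ker y = A ⊓ LinearMap.ker y := by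
    ext v
    simp only [Submodule.mem_inf, Submodule.mem_comap, LinearMap.mem_ker]
    constructor
    · rintro ⟨⟨h, -⟩, h'⟩
      exact ⟨h, h'⟩
    · rintro ⟨h, h'⟩
      exact ⟨⟨h, by rw [h']; exact C.zero_mem⟩, h'⟩
  have h4 : (A ⊓ C.comap y).map y = C ⊓ A.map y := by
    ext v
    constructor
    · rintro ⟨a, ⟨ha, ha'⟩, rfl⟩
      exact ⟨ha', a, ha, rfl⟩
    · rintro ⟨hv, a, ha, rfl⟩
      exact ⟨a, ⟨ha, hv⟩, rfl⟩
  have h5 := Submodule.finrank_sup_add_finrank_inf_eq C (A.map y)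
  rw [h3, h4] at h2
  omega

/-- The Hilbert–Serre theorem for the graded module `⨁ N₂ i / N₁ i`, on which the operators outside
`s` act as zero. Working with pairs of stable sequences inside one space keeps kernels and cokernels
in the same class of objects. The hypothesis `hN` is the Noetherian property: every stable sequence
below `R` is eventually generated by its preceding term. -/
theorem exists_polynomial_of_isStable [Fintype ι] [DecidableEq ι] {y : ι → Module.End K V}
    (hy : ∀ j l, Commute (y j) (y l)) {R : ℕ → Submodule K V}
    (hR : ∀ i, FiniteDimensional K (R i))
    (hN : ∀ N, IsStable y N → (∀ i, N i ≤ R i) →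
      ∃ i₀, ∀ i ≥ i₀, N (i + 1) ≤ ⨆ j, (N i).map (y j))
    (s : Finset ι) : ∀ N₁ N₂ : ℕ → Submodule K V, IsStable y N₁ → IsStable y N₂ →
      (∀ i, N₁ i ≤ N₂ i) → (∀ i, N₂ i ≤ R i) →
      (∀ j ∉ s, ∀ i, (N₂ i).map (y j) ≤ N₁ (i + 1)) →
      ∃ h : ℤ[X], (1 - PowerSeries.X) ^ s.card * PowerSeries.mk (fun i =>
        (Module.finrank K (N₂ i) : ℤ) - Module.finrank K (N₁ i)) = (h : PowerSeries ℤ) := by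
  induction s using Finset.induction_on with
  | empty =>
    intro N₁ N₂ h₁ h₂ h₁₂ h₂R hs
    obtain ⟨i₀, hi₀⟩ := hN N₂ h₂ h₂R
    -- All operators now act as zero on the quotient, so `hN` forces `N₂ (i + 1) = N₁ (i + 1)` from
    -- `i₀` on and the series is a polynomial.
    refine ⟨∑ i ∈ Finset.range (i₀ + 1), C ((Module.finrank K (N₂ i) : ℤ)
      - Module.finrank K (N₁ i)) * X ^ i, ?_⟩
    ext i
    rw [Finset.card_empty, pow_zero, one_mul, PowerSeries.coeff_mk, Polynomial.coeff_coe,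
      finsetSum_coeff]
    simp only [coeff_C_mul_X_pow]
    rw [Finset.sum_ite_eq]
    split_ifs with hi
    · rfl
    · rw [Finset.mem_range, not_lt] at hi
      obtain ⟨i, rfl⟩ : ∃ l, i = l + 1 := ⟨i - 1, by omega⟩
      have : N₂ (i + 1) = N₁ (i + 1) := le_antisymm ((hi₀ i (by omega)).trans
        (iSup_le fun j => hs j (by simp) i)) (h₁₂ _)
      rw [this, sub_self]
  | insert j s hj ih =>
    intro N₁ N₂ h₁ h₂ h₁₂ h₂R hs
    have fin₂ : ∀ i, FiniteDimensional K (N₂ i) := fun i =>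
      have := hR i
      Submodule.finiteDimensional_of_le (h₂R i)
    have fin₁ : ∀ i, FiniteDimensional K (N₁ i) := fun i =>
      Submodule.finiteDimensional_of_le (h₁₂ i)
    have hcomm : ∀ l (v : V), y j (y l v) = y l (y j v) := fun l v =>
      LinearMap.congr_fun (hy j l) v
    -- `D / N₁` is the kernel and `N₂ / E` the cokernel of `y j` on `N₂ / N₁`. On both of them `y j`
    -- acts as zero, so the induction hypothesis applies with `s`. In degree `0` nothing comes from
    -- below, hence `E 0 = N₁ 0`.
    set D : ℕ → Submodule K V := fun i => N₂ i ⊓ (N₁ (i + 1)).comap (y j) with hD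
    set E : ℕ → Submodule K V := fun i => Nat.casesOn i (N₁ 0)
      (fun i => N₁ (i + 1) ⊔ (N₂ i).map (y j)) with hE
    have hN₁E : ∀ i, N₁ i ≤ E i := fun i => by
      cases i with
      | zero => exact le_rfl
      | succ i => exact le_sup_left
    have hDs : IsStable y D := by
      rintro l i _ ⟨v, ⟨hv, hv'⟩, rfl⟩
      refine ⟨h₂ l i ⟨v, hv, rfl⟩, ?_⟩
      change y j (y l v) ∈ N₁ (i + 1 + 1)
      rw [hcomm]
      exact h₁ l (i + 1) ⟨_, hv', rfl⟩
    have hEs : IsStable y E := by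
      intro l i
      cases i with
      | zero => exact (h₁ l 0).trans le_sup_left
      | succ i =>
        change (N₁ (i + 1) ⊔ (N₂ i).map (y j)).map (y l) ≤ N₁ (i + 1 + 1) ⊔ (N₂ (i + 1)).map (y j)
        rw [Submodule.map_sup]
        refine sup_le_sup (h₁ l _) ?_
        rintro _ ⟨_, ⟨v, hv, rfl⟩, rfl⟩
        exact ⟨y l v, h₂ l i ⟨v, hv, rfl⟩, hcomm l v⟩
    obtain ⟨hd, hhd⟩ := ih N₁ D h₁ hDs
      (fun i v hv => ⟨h₁₂ i hv, h₁ j i ⟨v, hv, rfl⟩⟩) (fun i => inf_le_left.trans (h₂R i)) (by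
        rintro l hl i _ ⟨v, ⟨hv, hv'⟩, rfl⟩
        by_cases hlj : l = j
        · subst hlj
          exact hv'
        · exact hs l (by simp [hlj, hl]) i ⟨v, hv, rfl⟩)
    obtain ⟨he, hhe⟩ := ih E N₂ hEs h₂ (fun i => by
        cases i with
        | zero => exact h₁₂ 0
        | succ i => exact sup_le (h₁₂ _) (h₂ j i)) h₂R (by
        intro l hl i
        by_cases hlj : l = j
        · subst hlj
          exact le_sup_right
        · exact (hs l (by simp [hlj, hl]) i).trans (hN₁E _))
    -- Since `y j` raises the degree by one, the kernel in degree `i` is matched with the cokernel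
    -- in degree `i + 1`; this is the factor `X`.
    refine ⟨he - X * hd, ?_⟩
    rw [Finset.card_insert_of_notMem hj, pow_succ, mul_assoc, Polynomial.coe_sub,
      Polynomial.coe_mul, ← hhd, ← hhe, Polynomial.coe_X, mul_left_comm PowerSeries.X, ← mul_sub]
    congr 1
    ext i
    rw [sub_mul, one_mul, map_sub, map_sub]
    cases i with
    | zero =>
      rw [PowerSeries.coeff_zero_X_mul, PowerSeries.coeff_zero_X_mul, PowerSeries.coeff_mk,
        PowerSeries.coeff_mk]
      rfl
    | succ i =>
      rw [PowerSeries.coeff_succ_X_mul, PowerSeries.coeff_succ_X_mul]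
      simp only [PowerSeries.coeff_mk]
      have h3 := finrank_add_finrank_sup_map (y j) (N₂ i) (N₁ (i + 1))
      have h4 : (Module.finrank K ↥(D i) : ℤ) + Module.finrank K ↥(E (i + 1))
        = Module.finrank K ↥(N₂ i) + Module.finrank K ↥(N₁ (i + 1)) := by exact_mod_cast h3
      linarith

end Stable

/-! ### Hilbert–Serre for modules over the polynomial ring, through the Rees algebra -/

section PolyModule

variable (K : Type u) [Field K] (n : ℕ)

/-- Polynomials of degree at most `i`. -/
def polyDegreeLE (i : ℕ) : Submodule K (P K n) :=
  Submodule.span K {f | ∃ α : Fin n →₀ ℕ, α.degree ≤ i ∧ f = MvPolynomial.monomial α 1}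

theorem finite_degree_le (i : ℕ) : {α : Fin n →₀ ℕ | α.degree ≤ i}.Finite := by
  refine (Set.finite_Iic (Finsupp.equivFunOnFinite.symm fun _ => i : Fin n →₀ ℕ)).subset ?_
  intro α hα
  rw [Set.mem_Iic]
  intro j
  simp only [Finsupp.equivFunOnFinite_symm_apply_apply]
  exact (Finsupp.le_degree j α).trans hα

instance finiteDimensional_polyDegreeLE (i : ℕ) : FiniteDimensional K (polyDegreeLE K n i) := by
  refine FiniteDimensional.span_of_finite K (((finite_degree_le n i).image
    fun α => (MvPolynomial.monomial α 1 : P K n)).subset ?_)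
  rintro _ ⟨α, hα, rfl⟩
  exact ⟨α, hα, rfl⟩

variable {K n}

theorem monomial_mem_polyDegreeLE {α : Fin n →₀ ℕ} {i : ℕ} (h : α.degree ≤ i) :
    (MvPolynomial.monomial α 1 : P K n) ∈ polyDegreeLE K n i :=
  Submodule.subset_span ⟨α, h, rfl⟩

theorem polyDegreeLE_mono : Monotone (polyDegreeLE K n) := fun i j hij => by
  refine Submodule.span_mono ?_
  rintro _ ⟨α, hα, rfl⟩
  exact ⟨α, hα.trans hij, rfl⟩

theorem X_mul_mem_polyDegreeLE (j : Fin n) {i : ℕ} {f : P K n} (hf : f ∈ polyDegreeLE K n i) :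
    MvPolynomial.X j * f ∈ polyDegreeLE K n (i + 1) := by
  induction hf using Submodule.span_induction with
  | mem f hf =>
    obtain ⟨α, hα, rfl⟩ := hf
    rw [MvPolynomial.X, MvPolynomial.monomial_mul, one_mul]
    refine monomial_mem_polyDegreeLE ?_
    rw [map_add, Finsupp.degree_single]
    omega
  | zero => rw [mul_zero]; exact zero_mem _
  | add f g _ _ hf hg => rw [mul_add]; exact add_mem hf hg
  | smul c f _ hf => rw [mul_smul_comm]; exact Submodule.smul_mem _ _ hf

variable {M : Type w} [AddCommGroup M] [Module K M] [Module (P K n) M] [IsScalarTower K (P K n) M]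

variable (K n M) in
/-- The identity and the multiplications by the variables. -/
def varOps (o : Option (Fin n)) : Module.End K M :=
  Algebra.lsmul K K M (o.elim (1 : P K n) MvPolynomial.X)

theorem varOps_none (m : M) : varOps K n M none m = m := by
  simp [varOps]

theorem varOps_some (j : Fin n) (m : M) :
    varOps K n M (some j) m = (MvPolynomial.X j : P K n) • m := by
  simp [varOps]

theorem varOps_commute (o o' : Option (Fin n)) : Commute (varOps K n M o) (varOps K n M o') :=
  (Commute.all _ _).map _

variable (K n) in
/-- The generators of the Rees algebra of `P_n`, filtered by degree. -/
def reesGen (o : Option (Fin n)) : (P K n)[X] := monomial 1 (o.elim (1 : P K n) MvPolynomial.X)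

variable (K n) in
/-- The Rees algebra of `P_n`, filtered by degree. -/
def rees : Subalgebra K (P K n)[X] := Algebra.adjoin K (Set.range (reesGen K n))

/-- The Rees algebra is a quotient of a polynomial ring in `n + 1` variables, so Hilbert's basis
theorem applies. -/
instance isNoetherianRing_rees : IsNoetherianRing (rees K n) := by
  have h : Function.Surjective ((MvPolynomial.aeval (R := K) (reesGen K n)).codRestrict
      (rees K n) fun f => by
        rw [rees, ← MvPolynomial.aeval_range]
        exact ⟨f, rfl⟩) := by
    rintro ⟨f, hf⟩
    have hf' := hf
    rw [rees, ← MvPolynomial.aeval_range] at hf'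
    obtain ⟨g, rfl⟩ := hf'
    exact ⟨g, rfl⟩
  exact isNoetherianRing_of_surjective _ _ _ h

/-- A stable sequence, as a module over the Rees algebra. -/
def reesModule (N : ℕ → Submodule K M) (hN : IsStable (varOps K n M) N) :
    Submodule (rees K n) (PolynomialModule (P K n) M) where
  carrier := {f | ∀ i, f.coeff i ∈ N i}
  zero_mem' := fun i => zero_mem _
  add_mem' := fun {f g} hf hg i => add_mem (hf i) (hg i)
  smul_mem' := by
    rintro ⟨a, ha⟩ f hf
    change ∀ i, (a • f).coeff i ∈ N i
    change ∀ i, f.coeff i ∈ N i at hf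
    induction ha using Algebra.adjoin_induction generalizing f with
    | mem a ha =>
      obtain ⟨o, rfl⟩ := ha
      intro i
      rw [reesGen, PolynomialModule.monomial_smul_apply]
      split_ifs with hi
      · have := hN o (i - 1) ⟨_, hf (i - 1), rfl⟩
        rw [Nat.sub_add_cancel hi] at this
        exact this
      · exact zero_mem _
    | algebraMap c =>
      intro i
      rw [algebraMap_smul]
      exact Submodule.smul_mem _ c (hf i)
    | add a b _ _ ha hb =>
      intro i
      rw [add_smul]
      exact add_mem (ha hf i) (hb hf i)
    | mul a b _ _ ha hb =>
      intro i
      rw [mul_smul]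
      exact ha (hb hf) i

theorem mem_reesModule {N : ℕ → Submodule K M} {hN : IsStable (varOps K n M) N}
    {f : PolynomialModule (P K n) M} : f ∈ reesModule N hN ↔ ∀ i, f.coeff i ∈ N i := Iff.rfl

theorem single_mem_reesModule {N : ℕ → Submodule K M} {hN : IsStable (varOps K n M) N} {i : ℕ}
    {m : M} : PolynomialModule.single (P K n) i m ∈ reesModule N hN ↔ m ∈ N i := by
  rw [mem_reesModule]
  constructor
  · intro h
    simpa using h i
  · intro h l
    rw [PolynomialModule.coeff_single, Finsupp.single_apply]
    split_ifs with hl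
    · exact hl ▸ h
    · exact zero_mem _

theorem monomial_mem_rees {α : Fin n →₀ ℕ} {i : ℕ} (h : α.degree ≤ i) :
    (monomial i (MvPolynomial.monomial α 1 : P K n)) ∈ rees K n := by
  have hg : ∀ o, reesGen K n o ∈ rees K n := fun o => Algebra.subset_adjoin ⟨o, rfl⟩
  -- The generator indexed by `none` is the Rees variable itself; its power fills the gap between
  -- `α.degree` and `i`.
  have h1 : (monomial i (MvPolynomial.monomial α 1 : P K n))
      = reesGen K n none ^ (i - α.degree) * ∏ j, reesGen K n (some j) ^ α j := by
    simp only [reesGen, monomial_pow, Option.elim, one_pow, one_mul]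
    have h2 : ∀ s : Finset (Fin n), ∏ j ∈ s, monomial (α j) ((MvPolynomial.X j : P K n) ^ α j)
        = monomial (∑ j ∈ s, α j) (∏ j ∈ s, (MvPolynomial.X j : P K n) ^ α j) := by
      intro s
      induction s using Finset.induction_on with
      | empty => simp
      | insert j s hj ih =>
        rw [Finset.prod_insert hj, Finset.prod_insert hj, Finset.sum_insert hj, ih,
          monomial_mul_monomial]
    rw [h2, monomial_mul_monomial, one_mul, ← Finsupp.degree_eq_sum, Nat.sub_add_cancel h,
      MvPolynomial.monomial_eq, map_one, one_mul, Finsupp.prod_fintype _ _ (by simp)]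
  rw [h1]
  exact mul_mem (pow_mem (hg _) _) (prod_mem fun j _ => pow_mem (hg _) _)

theorem isStable_polyDegreeLE_smul (W : Submodule K M) :
    IsStable (varOps K n M) (fun i => polyDegreeLE K n i • W) := by
  rintro o i _ ⟨m, hm, rfl⟩
  induction hm using Submodule.smul_induction_on' with
  | smul f hf w hw =>
    cases o with
    | none =>
      rw [varOps_none]
      exact Submodule.smul_mem_smul (polyDegreeLE_mono (Nat.le_succ i) hf) hw
    | some j =>
      rw [varOps_some, ← mul_smul]
      exact Submodule.smul_mem_smul (X_mul_mem_polyDegreeLE j hf) hw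
  | add x _ y _ hx hy => rw [map_add]; exact add_mem hx hy

/-- A spanning set of `W` placed in degree `0` suffices: degree `i` consists of sums of `f • w` with
`f` of degree at most `i`, and such an `f` in degree `i` belongs to the Rees algebra. -/
theorem fg_reesModule (W : Submodule K M) (hW : W.FG) :
    (reesModule (fun i => polyDegreeLE K n i • W) (isStable_polyDegreeLE_smul W)).FG := by
  obtain ⟨t, rfl⟩ := hW
  classical
  refine ⟨t.image (PolynomialModule.single (P K n) 0), le_antisymm ?_ ?_⟩
  · rw [Submodule.span_le]
    intro f hf
    obtain ⟨w, hw, rfl⟩ := Finset.mem_image.1 hf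
    refine single_mem_reesModule.2 ?_
    have h1 : w = (MvPolynomial.monomial (0 : Fin n →₀ ℕ) (1 : K) : P K n) • w := by
      change w = (1 : P K n) • w
      rw [one_smul]
    rw [h1]
    exact Submodule.smul_mem_smul (monomial_mem_polyDegreeLE (by simp)) (Submodule.subset_span hw)
  · set L := Submodule.span (rees K n)
      ((t.image (PolynomialModule.single (P K n) 0) : Finset _) :
        Set (PolynomialModule (P K n) M)) with hL
    have h1 : ∀ w ∈ Submodule.span K (t : Set M), PolynomialModule.single (P K n) 0 w ∈ L := by
      intro w hw
      induction hw using Submodule.span_induction with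
      | mem w hw => exact Submodule.subset_span (Finset.mem_coe.2 (Finset.mem_image_of_mem _ hw))
      | zero => rw [PolynomialModule.single_zero]; exact zero_mem _
      | add a b _ _ ha hb => rw [PolynomialModule.single_add]; exact add_mem ha hb
      | smul c a _ ha =>
        have h2 : PolynomialModule.single (P K n) 0 (c • a)
            = (algebraMap K (rees K n) c) • PolynomialModule.single (P K n) 0 a := by
          rw [algebraMap_smul, ← algebraMap_smul (P K n) c a, PolynomialModule.single_smul,
            algebraMap_smul]
        rw [h2]
        exact Submodule.smul_mem _ _ ha
    have h3 : ∀ i, ∀ m ∈ polyDegreeLE K n i • Submodule.span K (t : Set M),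
        PolynomialModule.single (P K n) i m ∈ L := by
      intro i m hm
      induction hm using Submodule.smul_induction_on' with
      | smul f hf w hw =>
        induction hf using Submodule.span_induction with
        | mem f hf =>
          obtain ⟨α, hα, rfl⟩ := hf
          have h4 := Submodule.smul_mem L (⟨_, monomial_mem_rees hα⟩ : rees K n) (h1 w hw)
          change (monomial i (MvPolynomial.monomial α 1 : P K n))
            • PolynomialModule.single (P K n) 0 w ∈ L at h4
          rwa [PolynomialModule.monomial_smul_single, add_zero] at h4
        | zero => rw [zero_smul, PolynomialModule.single_zero]; exact zero_mem _
        | add a b _ _ ha hb => rw [add_smul, PolynomialModule.single_add]; exact add_mem ha hb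
        | smul c a _ ha =>
          have h2 : PolynomialModule.single (P K n) i ((c • a) • w)
              = (algebraMap K (rees K n) c) • PolynomialModule.single (P K n) i (a • w) := by
            rw [algebraMap_smul, smul_assoc, ← algebraMap_smul (P K n) c (a • w),
              PolynomialModule.single_smul, algebraMap_smul]
          rw [h2]
          exact Submodule.smul_mem _ _ ha
      | add x _ y _ hx hy => rw [PolynomialModule.single_add]; exact add_mem hx hy
    intro f hf
    have h5 : f = ∑ i ∈ f.coeff.support, PolynomialModule.single (P K n) i (f.coeff i) := by
      apply PolynomialModule.coeff_injective
      rw [PolynomialModule.coeff_sum]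
      simp only [PolynomialModule.coeff_single]
      exact (Finsupp.sum_single f.coeff).symm
    rw [h5]
    exact sum_mem fun i _ => h3 i _ (hf i)

/-- The module of a stable sequence is a submodule of a Noetherian module, hence finitely generated;
beyond the degrees of its generators, everything is produced from the preceding term. -/
theorem exists_le_iSup_map_varOps (W : Submodule K M) (hW : W.FG) (N : ℕ → Submodule K M)
    (hN : IsStable (varOps K n M) N) (hNW : ∀ i, N i ≤ polyDegreeLE K n i • W) :
    ∃ i₀, ∀ i ≥ i₀, N (i + 1) ≤ ⨆ o, (N i).map (varOps K n M o) := by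
  have h1 := isNoetherian_of_fg_of_noetherian (R := rees K n)
    (reesModule (fun i => polyDegreeLE K n i • W) (isStable_polyDegreeLE_smul W))
    (fg_reesModule (K := K) (n := n) W hW)
  obtain ⟨t, ht⟩ := isNoetherian_submodule.1 h1 (reesModule N hN) (fun f hf i => hNW i (hf i))
  obtain ⟨i₀, hi₀⟩ : ∃ i₀, ∀ f ∈ t, ∀ i > i₀, f.coeff i = 0 := by
    refine ⟨t.sup fun f => f.coeff.support.sup id, fun f hf i hi => ?_⟩
    by_contra h
    have h2 : i ≤ f.coeff.support.sup id := Finset.le_sup (f := id) (Finsupp.mem_support_iff.2 h)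
    have h3 : f.coeff.support.sup id ≤ t.sup fun f => f.coeff.support.sup id :=
      Finset.le_sup (f := fun f : PolynomialModule (P K n) M => f.coeff.support.sup id) hf
    omega
  refine ⟨i₀, fun i hi => ?_⟩
  -- `N'` agrees with `N` up to degree `i₀` and afterwards keeps only what the operators produce. It
  -- is stable and contains the generators, so it is all of `N`.
  set N' : ℕ → Submodule K M := fun l => Nat.casesOn l (N 0)
    (fun l => if i₀ ≤ l then ⨆ o, (N l).map (varOps K n M o) else N (l + 1)) with hN'
  have hle : ∀ l, N' l ≤ N l := by
    intro l
    cases l with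
    | zero => exact le_rfl
    | succ l =>
      change (if i₀ ≤ l then ⨆ o, (N l).map (varOps K n M o) else N (l + 1)) ≤ N (l + 1)
      split_ifs with h
      · exact iSup_le fun o => hN o l
      · exact le_rfl
  have hs : IsStable (varOps K n M) N' := by
    intro o l
    refine (Submodule.map_mono (hle l)).trans ?_
    change _ ≤ (if i₀ ≤ l then ⨆ o, (N l).map (varOps K n M o) else N (l + 1))
    split_ifs with h
    · exact le_iSup (fun o => (N l).map (varOps K n M o)) o
    · exact hN o l
  have h4 : reesModule N hN ≤ reesModule N' hs := by
    rw [← ht, Submodule.span_le]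
    intro f hf l
    have hfN : f ∈ reesModule N hN := ht ▸ Submodule.subset_span hf
    cases l with
    | zero => exact hfN 0
    | succ l =>
      change _ ∈ (if i₀ ≤ l then ⨆ o, (N l).map (varOps K n M o) else N (l + 1))
      split_ifs with h
      · rw [hi₀ f hf (l + 1) (by omega)]
        exact zero_mem _
      · exact hfN (l + 1)
  intro m hm
  have h5 := single_mem_reesModule.1 (h4 (single_mem_reesModule.2 hm))
  change m ∈ (if i₀ ≤ i then ⨆ o, (N i).map (varOps K n M o) else N (i + 1)) at h5
  rwa [if_pos hi] at h5

/-- The Hilbert series of a finitely generated module over `P_n`, filtered by degree. -/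
theorem exists_polynomial_hilbertSeries (W : Submodule K M) [FiniteDimensional K W]
    (hf : ∀ i, FiniteDimensional K ↥(polyDegreeLE K n i • W)) :
    ∃ h : ℤ[X], (1 - PowerSeries.X) ^ (n + 1)
      * ser (fun i => Module.finrank K ↥(polyDegreeLE K n i • W)) = (h : PowerSeries ℤ) := by
  -- The identity counts as an extra variable, since the dimensions are those of a filtration rather
  -- than of a grading; this accounts for the exponent `n + 1`.
  obtain ⟨h, hh⟩ := exists_polynomial_of_isStable (y := varOps K n M) varOps_commute hf
    (fun N hN hNR => exists_le_iSup_map_varOps W (Module.Finite.iff_fg.1 inferInstance) N hN hNR)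
    Finset.univ (fun _ => ⊥) (fun i => polyDegreeLE K n i • W) (fun j i => by simp)
    (isStable_polyDegreeLE_smul W) (fun i => bot_le) (fun i => le_rfl) (by simp)
  refine ⟨h, ?_⟩
  rw [← hh]
  simp [ser]

end PolyModule

/-! ### The ring of differential operators -/

section Ring

variable (K : Type u) [Field K] (n : ℕ)

/-- The inclusion of `D(P_n)` in the endomorphism ring of `P_n`. -/
def toEnd : D K n →ₐ[K] Module.End K (P K n) :=
  show ↥(diffOps K (P K n)) →ₐ[K] Module.End K (P K n) from (diffOps K (P K n)).val

theorem toEnd_injective : Function.Injective (toEnd K n) := Subtype.val_injective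

theorem toEnd_divPow (β : Fin n →₀ ℕ) : toEnd K n (divPow K n β) = divPowEnd K n β := rfl

theorem toEnd_polyIncl (f : P K n) : toEnd K n (polyIncl K n f) = Algebra.lmul K (P K n) f := rfl

instance : Nontrivial (D K n) := by
  refine ⟨0, 1, fun h => ?_⟩
  have h1 := LinearMap.congr_fun (congrArg (toEnd K n) h) 1
  rw [map_zero, map_one (toEnd K n)] at h1
  exact zero_ne_one h1

/-- The variables, as differential operators. -/
abbrev var (j : Fin n) : D K n := polyIncl K n (MvPolynomial.X j)

theorem divPow_zero : divPow K n 0 = 1 := toEnd_injective K n (divPowEnd_zero K n)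

variable {K n}

theorem divPow_mul_var_of_eq_zero {β : Fin n →₀ ℕ} {j : Fin n} (h : β j = 0) :
    divPow K n β * var K n j = var K n j * divPow K n β := by
  apply toEnd_injective K n
  rw [map_mul, map_mul]
  exact sub_eq_zero.1 (divPowEnd_X_of_eq_zero K n h)

theorem divPow_add_single_mul_var (β : Fin n →₀ ℕ) (j : Fin n) :
    divPow K n (β + Finsupp.single j 1) * var K n j
      = var K n j * divPow K n (β + Finsupp.single j 1) + divPow K n β := by
  apply toEnd_injective K n
  rw [map_add, map_mul, map_mul]
  exact sub_eq_iff_eq_add'.1 (divPowEnd_add_single_X K n β j)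

/-- On a monomial this is, in each variable, the trinomial identity `Nat.choose_mul`. -/
theorem divPow_mul_divPow (α β : Fin n →₀ ℕ) :
    divPow K n α * divPow K n β
      = ((∏ j, (α j + β j).choose (α j) : ℕ) : K) • divPow K n (α + β) := by
  apply toEnd_injective K n
  rw [map_mul, map_smul]
  refine (MvPolynomial.basisMonomials (Fin n) K).ext fun γ => ?_
  rw [MvPolynomial.coe_basisMonomials, Module.End.mul_apply, LinearMap.smul_apply]
  simp only [toEnd_divPow]
  rw [divPowEnd_monomial, divPowEnd_monomial, divPowEnd_monomial, MvPolynomial.smul_monomial,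
    tsub_tsub, add_comm β α]
  congr 1
  rw [one_mul, one_mul, smul_eq_mul, ← Nat.cast_mul, ← Nat.cast_mul, ← Finset.prod_mul_distrib,
    ← Finset.prod_mul_distrib]
  congr 1
  refine Finset.prod_congr rfl fun j _ => ?_
  have h := Nat.choose_mul (n := γ j) (k := α j + β j) (s := β j) (Nat.le_add_left _ _)
  rw [Nat.add_sub_cancel] at h
  rw [Finsupp.tsub_apply, Finsupp.add_apply, ← h, mul_comm, Nat.choose_symm_add]

theorem monomial_eq_polyIncl_mul (α : Fin n →₀ ℕ) (j : Fin n) :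
    polyIncl K n (MvPolynomial.monomial (α + Finsupp.single j 1) 1)
      = var K n j * polyIncl K n (MvPolynomial.monomial α 1) := by
  rw [← map_mul, MvPolynomial.X, MvPolynomial.monomial_mul, one_mul, add_comm]

theorem polyIncl_comm (f g : P K n) :
    polyIncl K n f * polyIncl K n g = polyIncl K n g * polyIncl K n f := by
  rw [← map_mul, ← map_mul, mul_comm]

/-! ### Filtrations by spans of standard monomials -/

/-- Sets of exponents closed under decreasing the exponents. -/
def IsDownClosed (B : Set (Fin n →₀ ℕ)) : Prop :=
  ∀ (β : Fin n →₀ ℕ) (j : Fin n), β + Finsupp.single j 1 ∈ B → β ∈ B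

variable (K) in
/-- The span of the `x^α ∂^[β]` with `β ∈ B` and `|α| + |β| ≤ i`. -/
def stdSpan (B : Set (Fin n →₀ ℕ)) (i : ℕ) : Submodule K (D K n) :=
  Submodule.span K {y | ∃ α β : Fin n →₀ ℕ, β ∈ B ∧ α.degree + β.degree ≤ i ∧
    y = polyIncl K n (MvPolynomial.monomial α 1) * divPow K n β}

variable (K) in
/-- The span of the `∂^[β] x^α` with `β ∈ B` and `|α| + |β| ≤ i`. -/
def stdSpanRight (B : Set (Fin n →₀ ℕ)) (i : ℕ) : Submodule K (D K n) :=
  Submodule.span K {y | ∃ α β : Fin n →₀ ℕ, β ∈ B ∧ α.degree + β.degree ≤ i ∧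
    y = divPow K n β * polyIncl K n (MvPolynomial.monomial α 1)}

theorem canonicalFiltration_eq_stdSpan (i : ℕ) :
    canonicalFiltration K n i = stdSpan K Set.univ i := by
  simp [canonicalFiltration, stdSpan]

variable {B : Set (Fin n →₀ ℕ)}

theorem mem_stdSpan {α β : Fin n →₀ ℕ} {i : ℕ} (hβ : β ∈ B) (h : α.degree + β.degree ≤ i) :
    polyIncl K n (MvPolynomial.monomial α 1) * divPow K n β ∈ stdSpan K B i :=
  Submodule.subset_span ⟨α, β, hβ, h, rfl⟩

theorem mem_stdSpanRight {α β : Fin n →₀ ℕ} {i : ℕ} (hβ : β ∈ B) (h : α.degree + β.degree ≤ i) :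
    divPow K n β * polyIncl K n (MvPolynomial.monomial α 1) ∈ stdSpanRight K B i :=
  Submodule.subset_span ⟨α, β, hβ, h, rfl⟩

theorem stdSpan_mono {B B' : Set (Fin n →₀ ℕ)} (hB : B ⊆ B') {i i' : ℕ} (hi : i ≤ i') :
    stdSpan K B i ≤ stdSpan K B' i' := by
  refine Submodule.span_mono ?_
  rintro _ ⟨α, β, hβ, h, rfl⟩
  exact ⟨α, β, hB hβ, h.trans hi, rfl⟩

theorem stdSpanRight_mono {B B' : Set (Fin n →₀ ℕ)} (hB : B ⊆ B') {i i' : ℕ} (hi : i ≤ i') :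
    stdSpanRight K B i ≤ stdSpanRight K B' i' := by
  refine Submodule.span_mono ?_
  rintro _ ⟨α, β, hβ, h, rfl⟩
  exact ⟨α, β, hB hβ, h.trans hi, rfl⟩

theorem var_mul_mem_stdSpan (j : Fin n) {i : ℕ} {d : D K n} (hd : d ∈ stdSpan K B i) :
    var K n j * d ∈ stdSpan K B (i + 1) := by
  have h : stdSpan K B i ≤ (stdSpan K B (i + 1)).comap (LinearMap.mulLeft K (var K n j)) := by
    rw [stdSpan, Submodule.span_le]
    rintro _ ⟨α, β, hβ, h, rfl⟩
    rw [SetLike.mem_coe, Submodule.mem_comap, LinearMap.mulLeft_apply, ← mul_assoc,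
      ← monomial_eq_polyIncl_mul]
    exact mem_stdSpan hβ (by rw [map_add, Finsupp.degree_single]; omega)
  exact h hd

theorem divPow_mul_var_eq (β : Fin n →₀ ℕ) (j : Fin n) :
    ∃ r : D K n, divPow K n β * var K n j = var K n j * divPow K n β + r ∧
      (r = 0 ∨ ∃ β', β = β' + Finsupp.single j 1 ∧ r = divPow K n β') := by
  by_cases hj : β j = 0
  · exact ⟨0, by rw [add_zero, divPow_mul_var_of_eq_zero hj], Or.inl rfl⟩
  · have hle : Finsupp.single j 1 ≤ β := Finsupp.single_le_iff.2 (Nat.one_le_iff_ne_zero.2 hj)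
    have hb : β - Finsupp.single j 1 + Finsupp.single j 1 = β := tsub_add_cancel_of_le hle
    refine ⟨divPow K n (β - Finsupp.single j 1), ?_, Or.inr ⟨_, hb.symm, rfl⟩⟩
    have h := divPow_add_single_mul_var (K := K) (β - Finsupp.single j 1) j
    rwa [hb] at h

/-- Moving `x_j` to the left past `∂^[β]` creates at most the extra term `∂^[β - e_j]`, which has
lower degree and an exponent still in `B`. -/
theorem mul_var_mem_stdSpan (hB : IsDownClosed B) (j : Fin n) {i : ℕ} {d : D K n}
    (hd : d ∈ stdSpan K B i) : d * var K n j ∈ stdSpan K B (i + 1) := by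
  have h : stdSpan K B i ≤ (stdSpan K B (i + 1)).comap (LinearMap.mulRight K (var K n j)) := by
    rw [stdSpan, Submodule.span_le]
    rintro _ ⟨α, β, hβ, h, rfl⟩
    rw [SetLike.mem_coe, Submodule.mem_comap, LinearMap.mulRight_apply, mul_assoc]
    obtain ⟨r, h1, h2⟩ := divPow_mul_var_eq (K := K) β j
    rw [h1, mul_add, ← mul_assoc, polyIncl_comm, ← monomial_eq_polyIncl_mul]
    refine add_mem (mem_stdSpan hβ (by rw [map_add, Finsupp.degree_single]; omega)) ?_
    obtain rfl | ⟨β', rfl, rfl⟩ := h2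
    · rw [mul_zero]
      exact zero_mem _
    · exact mem_stdSpan (hB _ _ hβ) (by rw [map_add, Finsupp.degree_single] at h; omega)
  exact h hd

theorem var_mul_mem_stdSpanRight (hB : IsDownClosed B) (j : Fin n) {i : ℕ} {d : D K n}
    (hd : d ∈ stdSpanRight K B i) : var K n j * d ∈ stdSpanRight K B (i + 1) := by
  have h : stdSpanRight K B i
      ≤ (stdSpanRight K B (i + 1)).comap (LinearMap.mulLeft K (var K n j)) := by
    rw [stdSpanRight, Submodule.span_le]
    rintro _ ⟨α, β, hβ, h, rfl⟩
    rw [SetLike.mem_coe, Submodule.mem_comap, LinearMap.mulLeft_apply, ← mul_assoc]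
    obtain ⟨r, h1, h2⟩ := divPow_mul_var_eq (K := K) β j
    rw [← sub_eq_iff_eq_add.2 h1, sub_mul, mul_assoc, ← monomial_eq_polyIncl_mul]
    refine sub_mem (mem_stdSpanRight hβ (by rw [map_add, Finsupp.degree_single]; omega)) ?_
    obtain rfl | ⟨β', rfl, rfl⟩ := h2
    · rw [zero_mul]
      exact zero_mem _
    · exact mem_stdSpanRight (hB _ _ hβ) (by rw [map_add, Finsupp.degree_single] at h; omega)
  exact h hd

/-- Induction on exponents, one variable at a time. -/
theorem exponent_induction {motive : (Fin n →₀ ℕ) → Prop} (h0 : motive 0)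
    (h1 : ∀ α j, motive α → motive (α + Finsupp.single j 1)) (α : Fin n →₀ ℕ) : motive α := by
  have main : ∀ (m : ℕ) (α : Fin n →₀ ℕ), α.degree = m → motive α := by
    intro m
    induction m with
    | zero =>
      intro α hα
      rw [Finsupp.degree_eq_zero_iff] at hα
      exact hα ▸ h0
    | succ m ih =>
      intro α hα
      obtain ⟨j, hj⟩ : ∃ j, α j ≠ 0 := by
        by_contra! h
        have : α = 0 := Finsupp.ext h
        rw [this, map_zero] at hα
        omega
      have hb : α - Finsupp.single j 1 + Finsupp.single j 1 = α :=
        tsub_add_cancel_of_le (Finsupp.single_le_iff.2 (Nat.one_le_iff_ne_zero.2 hj))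
      rw [← hb]
      refine h1 _ _ (ih _ ?_)
      have h7 := congrArg Finsupp.degree hb
      rw [map_add, Finsupp.degree_single, hα] at h7
      omega
  exact main _ α rfl

theorem polyIncl_monomial_zero : polyIncl K n (MvPolynomial.monomial 0 1) = 1 := map_one _

theorem stdSpan_eq_stdSpanRight (hB : IsDownClosed B) (i : ℕ) :
    stdSpan K B i = stdSpanRight K B i := by
  refine le_antisymm ?_ ?_
  · rw [stdSpan, Submodule.span_le]
    rintro _ ⟨α, β, hβ, h, rfl⟩
    refine stdSpanRight_mono (K := K) subset_rfl h ?_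
    clear h
    induction α using exponent_induction with
    | h0 =>
      have h2 := mem_stdSpanRight (K := K) (α := 0) (i := 0 + β.degree) hβ (by simp)
      rw [polyIncl_monomial_zero, mul_one] at h2
      rw [polyIncl_monomial_zero, one_mul, map_zero]
      exact h2
    | h1 α j ih =>
      rw [monomial_eq_polyIncl_mul, mul_assoc, map_add, Finsupp.degree_single, add_right_comm]
      exact var_mul_mem_stdSpanRight hB j ih
  · rw [stdSpanRight, Submodule.span_le]
    rintro _ ⟨α, β, hβ, h, rfl⟩
    refine stdSpan_mono (K := K) subset_rfl h ?_
    clear h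
    induction α using exponent_induction with
    | h0 =>
      have h2 := mem_stdSpan (K := K) (α := 0) (i := 0 + β.degree) hβ (by simp)
      rw [polyIncl_monomial_zero, one_mul] at h2
      rw [polyIncl_monomial_zero, mul_one, map_zero]
      exact h2
    | h1 α j ih =>
      rw [monomial_eq_polyIncl_mul, polyIncl_comm, ← mul_assoc, map_add, Finsupp.degree_single,
        add_right_comm]
      exact mul_var_mem_stdSpan hB j ih

theorem isDownClosed_univ : IsDownClosed (Set.univ : Set (Fin n →₀ ℕ)) := fun _ _ _ => trivial

theorem isDownClosed_lt (q : ℕ) : IsDownClosed {β : Fin n →₀ ℕ | ∀ j, β j < q} := by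
  intro β j h l
  have := h l
  rw [Finsupp.add_apply] at this
  omega

/-- Left multiplication by monomials is transparent on the left normal form, and by divided powers
on the right one. As both forms span the same filtration, each factor is applied in the form that
suits it. -/
theorem mul_mem_canonicalFiltration {i l : ℕ} {a b : D K n} (ha : a ∈ canonicalFiltration K n i)
    (hb : b ∈ canonicalFiltration K n l) : a * b ∈ canonicalFiltration K n (i + l) := by
  rw [canonicalFiltration_eq_stdSpan] at *
  have hpoly : ∀ (α : Fin n →₀ ℕ) {l : ℕ} {b : D K n}, b ∈ stdSpan K Set.univ l →
      polyIncl K n (MvPolynomial.monomial α 1) * b ∈ stdSpan K Set.univ (α.degree + l) := by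
    intro α l b hb
    induction α using exponent_induction with
    | h0 => rwa [polyIncl_monomial_zero, one_mul, map_zero, zero_add]
    | h1 α j ih =>
      rw [monomial_eq_polyIncl_mul, mul_assoc, map_add, Finsupp.degree_single, add_right_comm]
      exact var_mul_mem_stdSpan j ih
  have hdiv : ∀ (β : Fin n →₀ ℕ) {l : ℕ} {b : D K n}, b ∈ stdSpan K Set.univ l →
      divPow K n β * b ∈ stdSpan K Set.univ (β.degree + l) := by
    intro β l b hb
    rw [stdSpan_eq_stdSpanRight isDownClosed_univ] at *
    have h : stdSpanRight K Set.univ l ≤ (stdSpanRight K Set.univ (β.degree + l)).comap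
        (LinearMap.mulLeft K (divPow K n β)) := by
      rw [stdSpanRight, Submodule.span_le]
      rintro _ ⟨α, β', hβ, h, rfl⟩
      rw [SetLike.mem_coe, Submodule.mem_comap, LinearMap.mulLeft_apply, ← mul_assoc,
        divPow_mul_divPow, smul_mul_assoc]
      exact Submodule.smul_mem _ _ (mem_stdSpanRight trivial (by rw [map_add]; omega))
    exact h hb
  have h : stdSpan K Set.univ i ≤ (stdSpan K Set.univ (i + l)).comap (LinearMap.mulRight K b) := by
    rw [stdSpan, Submodule.span_le]
    rintro _ ⟨α, β, hβ, h, rfl⟩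
    rw [SetLike.mem_coe, Submodule.mem_comap, LinearMap.mulRight_apply, mul_assoc]
    exact stdSpan_mono subset_rfl (by omega) (hpoly α (hdiv β hb))
  exact h ha

theorem canonicalFiltration_mono : Monotone (canonicalFiltration K n) := fun i l h => by
  rw [canonicalFiltration_eq_stdSpan, canonicalFiltration_eq_stdSpan]
  exact stdSpan_mono subset_rfl h

theorem one_mem_canonicalFiltration : (1 : D K n) ∈ canonicalFiltration K n 0 := by
  rw [canonicalFiltration_eq_stdSpan]
  have h := mem_stdSpan (K := K) (α := (0 : Fin n →₀ ℕ)) (β := 0) (i := 0) (Set.mem_univ _)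
    (by simp)
  rwa [polyIncl_monomial_zero, one_mul, divPow_zero] at h

theorem divPow_mem_canonicalFiltration (β : Fin n →₀ ℕ) :
    divPow K n β ∈ canonicalFiltration K n β.degree := by
  rw [canonicalFiltration_eq_stdSpan]
  have h := mem_stdSpan (K := K) (α := 0) (β := β) (i := β.degree) (Set.mem_univ _) (by simp)
  rwa [polyIncl_monomial_zero, one_mul] at h

theorem monomial_mem_canonicalFiltration (α : Fin n →₀ ℕ) :
    polyIncl K n (MvPolynomial.monomial α 1) ∈ canonicalFiltration K n α.degree := by
  rw [canonicalFiltration_eq_stdSpan]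
  have h := mem_stdSpan (K := K) (α := α) (β := 0) (i := α.degree) (Set.mem_univ _) (by simp)
  rwa [divPow_zero, mul_one] at h

instance finiteDimensional_canonicalFiltration (i : ℕ) :
    FiniteDimensional K (canonicalFiltration K n i) := by
  refine FiniteDimensional.span_of_finite K ((((finite_degree_le n i).prod
    (finite_degree_le n i)).image fun s : (Fin n →₀ ℕ) × (Fin n →₀ ℕ) =>
      polyIncl K n (MvPolynomial.monomial s.1 1) * divPow K n s.2).subset ?_)
  rintro _ ⟨α, β, h, rfl⟩
  refine ⟨(α, β), ⟨?_, ?_⟩, rfl⟩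
  · change α.degree ≤ i
    omega
  · change β.degree ≤ i
    omega

/-! ### Exhaustion -/

/-- The commutators with the variables have order one less and vanish on monomials of degree one
less, so they are zero by induction. The operator is then `P_n`-linear and kills `1`. -/
theorem eq_zero_of_mem_diffOpOrder (i : ℕ) : ∀ {h : Module.End K (P K n)},
    h ∈ diffOpOrder K (P K n) i →
    (∀ γ : Fin n →₀ ℕ, γ.degree ≤ i → h (MvPolynomial.monomial γ 1) = 0) → h = 0 := by
  have key : ∀ {h : Module.End K (P K n)}, h 1 = 0 →
      (∀ j : Fin n, h * Algebra.lmul K (P K n) (MvPolynomial.X j)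
        - Algebra.lmul K (P K n) (MvPolynomial.X j) * h = 0) → h = 0 := by
    intro h h1 hX
    refine LinearMap.ext fun f => ?_
    induction f using MvPolynomial.induction_on with
    | C c =>
      rw [← mul_one (MvPolynomial.C c), MvPolynomial.C_mul', map_smul, h1, smul_zero]
      rfl
    | add f g hf hg => rw [map_add, hf, hg]; simp
    | mul_X f j hf =>
      have h2 := LinearMap.congr_fun (sub_eq_zero.1 (hX j)) f
      simp only [Module.End.mul_apply, Algebra.coe_lmul_eq_mul, LinearMap.mul_apply'] at h2
      rw [mul_comm, h2, hf]
      simp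
  induction i with
  | zero =>
    intro h hh h0
    exact key (h0 0 (by simp)) fun j => hh _
  | succ i ih =>
    intro h hh h0
    refine key (h0 0 (by simp)) fun j => ih (hh _) fun γ hγ => ?_
    rw [LinearMap.sub_apply, Module.End.mul_apply, Module.End.mul_apply, h0 γ (by omega), map_zero,
      sub_zero, Algebra.coe_lmul_eq_mul, LinearMap.mul_apply', MvPolynomial.X,
      MvPolynomial.monomial_mul, one_mul]
    exact h0 _ (by rw [map_add, Finsupp.degree_single]; omega)

theorem divPowEnd_monomial_of_degree_le {β γ : Fin n →₀ ℕ} (h : γ.degree ≤ β.degree) :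
    divPowEnd K n β (MvPolynomial.monomial γ 1) = if γ = β then 1 else 0 := by
  rw [divPowEnd_monomial]
  split_ifs with hγ
  · subst hγ
    simp
  · obtain ⟨j, hj⟩ : ∃ j, γ j < β j := by
      by_contra! hle
      have hle' : β ≤ γ := hle
      have h1 : (γ - β).degree = 0 := by
        have := congrArg Finsupp.degree (tsub_add_cancel_of_le hle')
        rw [map_add] at this
        omega
      rw [Finsupp.degree_eq_zero_iff] at h1
      exact hγ (le_antisymm (tsub_eq_zero_iff_le.1 h1) hle')
    rw [Finset.prod_eq_zero (Finset.mem_univ j) (Nat.choose_eq_zero_of_lt hj)]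
    simp

theorem exists_mem_canonicalFiltration_polyIncl (f : P K n) :
    ∃ l, polyIncl K n f ∈ canonicalFiltration K n l := by
  induction f using MvPolynomial.monomial_add_induction_on with
  | C c =>
    refine ⟨0, ?_⟩
    rw [← MvPolynomial.algebraMap_eq, AlgHom.commutes, Algebra.algebraMap_eq_smul_one]
    exact Submodule.smul_mem _ _ one_mem_canonicalFiltration
  | monomial_add α c f _ _ hf =>
    obtain ⟨l, hl⟩ := hf
    refine ⟨max α.degree l, ?_⟩
    rw [map_add]
    refine add_mem (canonicalFiltration_mono (le_max_left _ _) ?_)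
      (canonicalFiltration_mono (le_max_right _ _) hl)
    have h1 : (MvPolynomial.monomial α c : P K n) = c • MvPolynomial.monomial α 1 := by
      simp [MvPolynomial.smul_monomial]
    rw [h1, map_smul]
    exact Submodule.smul_mem _ _ (monomial_mem_canonicalFiltration α)

theorem exists_mem_of_forall {s : Finset (Fin n →₀ ℕ)} {F : (Fin n →₀ ℕ) → D K n}
    (h : ∀ β ∈ s, ∃ l, F β ∈ canonicalFiltration K n l) :
    ∃ l, ∑ β ∈ s, F β ∈ canonicalFiltration K n l := by
  induction s using Finset.induction_on with
  | empty => exact ⟨0, by simp⟩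
  | insert b s hb ih =>
    obtain ⟨l, hl⟩ := ih fun β hβ => h β (Finset.mem_insert_of_mem hβ)
    obtain ⟨l', hl'⟩ := h b (Finset.mem_insert_self _ _)
    rw [Finset.sum_insert hb]
    exact ⟨max l' l, add_mem (canonicalFiltration_mono (le_max_left _ _) hl')
      (canonicalFiltration_mono (le_max_right _ _) hl)⟩

/-- Values are corrected one degree at a time: for `|β| = i + 1`, the operator `g ∂^[β]` kills every
monomial of degree at most `i + 1` other than `x^β`, which it sends to `g`. -/
theorem exists_interpolation (f : Module.End K (P K n)) (i : ℕ) :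
    ∃ d : D K n, (∃ l, d ∈ canonicalFiltration K n l) ∧ toEnd K n d ∈ diffOpOrder K (P K n) i ∧
      ∀ γ : Fin n →₀ ℕ, γ.degree ≤ i →
        toEnd K n d (MvPolynomial.monomial γ 1) = f (MvPolynomial.monomial γ 1) := by
  induction i with
  | zero =>
    refine ⟨polyIncl K n (f 1), exists_mem_canonicalFiltration_polyIncl _,
      lmul_mem_diffOpOrder _, fun γ hγ => ?_⟩
    have h0 : γ = 0 := by
      rw [← Finsupp.degree_eq_zero_iff]
      omega
    subst h0
    change f 1 * 1 = f 1
    rw [mul_one]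
  | succ i ih =>
    obtain ⟨d, hd, hdo, hdf⟩ := ih
    classical
    set s : Finset (Fin n →₀ ℕ) := (finite_degree_le n (i + 1)).toFinset.filter
      fun β => β.degree = i + 1 with hs
    have hmem : ∀ β, β ∈ s ↔ β.degree = i + 1 := by
      intro β
      rw [hs, Finset.mem_filter, Set.Finite.mem_toFinset]
      exact ⟨fun h => h.2, fun h => ⟨h.le, h⟩⟩
    set g : (Fin n →₀ ℕ) → P K n := fun β =>
      f (MvPolynomial.monomial β 1) - toEnd K n d (MvPolynomial.monomial β 1) with hg
    obtain ⟨l, hl⟩ := hd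
    obtain ⟨l', hl'⟩ := exists_mem_of_forall (s := s)
      (F := fun β => polyIncl K n (g β) * divPow K n β) fun β _ => by
        obtain ⟨l, hl⟩ := exists_mem_canonicalFiltration_polyIncl (g β)
        exact ⟨_, mul_mem_canonicalFiltration hl (divPow_mem_canonicalFiltration β)⟩
    refine ⟨d + ∑ β ∈ s, polyIncl K n (g β) * divPow K n β, ⟨max l l', add_mem
      (canonicalFiltration_mono (le_max_left _ _) hl)
      (canonicalFiltration_mono (le_max_right _ _) hl')⟩, ?_, fun γ hγ => ?_⟩
    · rw [map_add, map_sum]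
      refine add_mem (diffOpOrder_le_succ i hdo) (sum_mem fun β hβ => ?_)
      rw [map_mul, toEnd_polyIncl, toEnd_divPow]
      have h1 := mul_mem_diffOpOrder 0 β.degree (lmul_mem_diffOpOrder (K := K) (g β))
        (divPowEnd_mem K n β)
      rwa [zero_add, (hmem β).1 hβ] at h1
    · rw [map_add, map_sum, LinearMap.add_apply, LinearMap.sum_apply]
      have h2 : ∀ β ∈ s, toEnd K n (polyIncl K n (g β) * divPow K n β)
          (MvPolynomial.monomial γ 1) = if γ = β then g β else 0 := by
        intro β hβ
        rw [map_mul, toEnd_polyIncl, toEnd_divPow, Module.End.mul_apply,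
          divPowEnd_monomial_of_degree_le (by rw [(hmem β).1 hβ]; exact hγ)]
        split_ifs with h
        · change g β * 1 = g β
          rw [mul_one]
        · rw [map_zero]
      rw [Finset.sum_congr rfl h2, Finset.sum_ite_eq]
      split_ifs with h
      · exact add_sub_cancel _ _
      · rw [add_zero]
        have h3 : γ.degree ≠ i + 1 := fun h' => h ((hmem γ).2 h')
        exact hdf γ (by omega)

/-- An operator of order `i` coincides with its interpolation in degrees at most `i`, because their
difference has order `i` and vanishes there. -/
theorem exists_mem_canonicalFiltration (d : D K n) : ∃ l, d ∈ canonicalFiltration K n l := by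
  obtain ⟨i, hi⟩ : ∃ i, toEnd K n d ∈ diffOpOrder K (P K n) i := d.2
  obtain ⟨d', hl, ho, hf⟩ := exists_interpolation (toEnd K n d) i
  have h1 : toEnd K n d' - toEnd K n d = 0 := by
    refine eq_zero_of_mem_diffOpOrder i (sub_mem ho hi) fun γ hγ => ?_
    rw [LinearMap.sub_apply, hf γ hγ, sub_self]
  rw [← toEnd_injective K n (sub_eq_zero.1 h1)]
  exact hl

end Ring

/-! ### The subalgebras `T_k` -/

section Subalgebra

variable {K : Type u} [Field K] {n : ℕ} {p : ℕ}

variable (K) in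
/-- The commutator with a variable. -/
def adVar (j : Fin n) : Module.End K (D K n) :=
  LinearMap.mulRight K (var K n j) - LinearMap.mulLeft K (var K n j)

/-- Each commutator with `x_j` lowers the `j`-th exponent by one. With divided powers no coefficient
appears, so nothing is lost in characteristic `p`. -/
theorem adVar_pow_divPow (j : Fin n) (m : ℕ) (β : Fin n →₀ ℕ) :
    (adVar K j ^ m) (divPow K n (β + Finsupp.single j m)) = divPow K n β := by
  induction m with
  | zero => simp
  | succ m ih =>
    have h : adVar K j (divPow K n (β + Finsupp.single j (m + 1)))
        = divPow K n (β + Finsupp.single j m) := by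
      rw [Finsupp.single_add, ← add_assoc, adVar, LinearMap.sub_apply, LinearMap.mulRight_apply,
        LinearMap.mulLeft_apply, divPow_add_single_mul_var, add_sub_cancel_left]
    rw [pow_succ, Module.End.mul_apply, h, ih]

theorem adVar_pow_divPow_eq_zero {j : Fin n} {m : ℕ} {β : Fin n →₀ ℕ} (h : β j < m) :
    (adVar K j ^ m) (divPow K n β) = 0 := by
  obtain ⟨l, rfl⟩ : ∃ l, m = l + 1 + β j := ⟨m - 1 - β j, by omega⟩
  have hβ : β - Finsupp.single j (β j) + Finsupp.single j (β j) = β :=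
    tsub_add_cancel_of_le (Finsupp.single_le_iff.2 le_rfl)
  have h2 : (adVar K j ^ (β j)) (divPow K n β) = divPow K n (β - Finsupp.single j (β j)) := by
    conv_lhs => rw [← hβ]
    have h3 : (β - Finsupp.single j (β j) + Finsupp.single j (β j)) j = β j := by rw [hβ]
    rw [h3, adVar_pow_divPow]
  rw [pow_add, Module.End.mul_apply, h2, pow_succ, Module.End.mul_apply]
  have h4 : adVar K j (divPow K n (β - Finsupp.single j (β j))) = 0 := by
    rw [adVar, LinearMap.sub_apply, LinearMap.mulRight_apply, LinearMap.mulLeft_apply,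
      divPow_mul_var_of_eq_zero (by simp), sub_self]
  rw [h4, map_zero]

variable (K n) in
/-- Exponents with all entries less than `q`. -/
def expLT (q : ℕ) : Set (Fin n →₀ ℕ) := {β | ∀ j, β j < q}

theorem polyIncl_mem_T (k : ℕ) (f : P K n) : polyIncl K n f ∈ T K n p k :=
  Algebra.subset_adjoin (Or.inl ⟨f, rfl⟩)

theorem divPow_mem_T {k : ℕ} {β : Fin n →₀ ℕ} (hβ : ∀ j, β j < p ^ k) :
    divPow K n β ∈ T K n p k :=
  Algebra.subset_adjoin (Or.inr ⟨β, hβ, rfl⟩)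

theorem mem_T_of_mem_stdSpan {k i : ℕ} {d : D K n} (hd : d ∈ stdSpan K (expLT n (p ^ k)) i) :
    d ∈ T K n p k := by
  have h : stdSpan K (expLT n (p ^ k)) i ≤ Subalgebra.toSubmodule (T K n p k) := by
    rw [stdSpan, Submodule.span_le]
    rintro _ ⟨α, β, hβ, -, rfl⟩
    exact (T K n p k).mul_mem (polyIncl_mem_T k _) (divPow_mem_T hβ)
  exact h hd

variable (K n p) in
/-- The map `(t_γ) ↦ ∑ ∂^[p^k γ] t_γ`. -/
def sumDivPow (k : ℕ) : ((Fin n →₀ ℕ) →₀ T K n p k) →ₗ[K] D K n :=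
  Finsupp.lsum K fun γ =>
    (LinearMap.mulLeft K (divPow K n (p ^ k • γ))).comp (T K n p k).val.toLinearMap

theorem sumDivPow_single (k : ℕ) (γ : Fin n →₀ ℕ) (t : T K n p k) :
    sumDivPow K n p k (Finsupp.single γ t) = divPow K n (p ^ k • γ) * (t : D K n) := by
  simp [sumDivPow]

theorem mem_inducedFiltration {k i : ℕ} {t : T K n p k} :
    t ∈ inducedFiltration K n p k i ↔ (t : D K n) ∈ canonicalFiltration K n i := Iff.rfl

theorem inducedFiltration_mono (k : ℕ) : Monotone (inducedFiltration K n p k) :=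
  fun _ _ h => Submodule.comap_mono (canonicalFiltration_mono h)

theorem one_mem_inducedFiltration (k : ℕ) : (1 : T K n p k) ∈ inducedFiltration K n p k 0 :=
  one_mem_canonicalFiltration

theorem mul_mem_inducedFiltration {k i l : ℕ} {a b : T K n p k}
    (ha : a ∈ inducedFiltration K n p k i) (hb : b ∈ inducedFiltration K n p k l) :
    a * b ∈ inducedFiltration K n p k (i + l) :=
  mul_mem_canonicalFiltration (K := K) ha hb

theorem exists_mem_inducedFiltration {k : ℕ} (t : T K n p k) :
    ∃ l, t ∈ inducedFiltration K n p k l := exists_mem_canonicalFiltration (t : D K n)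

instance finiteDimensional_inducedFiltration (k i : ℕ) :
    FiniteDimensional K (inducedFiltration K n p k i) := by
  have h : Function.Injective ((T K n p k).val.toLinearMap.restrict
      (p := inducedFiltration K n p k i) (q := canonicalFiltration K n i) fun _ h => h) := by
    intro a b hab
    have h1 : ((a : T K n p k) : D K n) = ((b : T K n p k) : D K n) :=
      congrArg (fun x : canonicalFiltration K n i => (x : D K n)) hab
    exact Subtype.ext (Subtype.ext h1)
  exact FiniteDimensional.of_injective _ h

variable (K n p) in
/-- The inclusion of `P_n` in `T_k`. -/
def polyInclT (k : ℕ) : P K n →ₐ[K] T K n p k :=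
  (polyIncl K n).codRestrict (T K n p k) (polyIncl_mem_T k)

end Subalgebra

section Prime

variable {K : Type u} [Field K] {n : ℕ} {p : ℕ} [Fact p.Prime]

theorem mem_T_mono {k k' : ℕ} (h : k ≤ k') {d : D K n} (hd : d ∈ T K n p k) : d ∈ T K n p k' := by
  have hle : T K n p k ≤ T K n p k' := by
    refine Algebra.adjoin_le ?_
    rintro _ (⟨f, rfl⟩ | ⟨β, hβ, rfl⟩)
    · exact polyIncl_mem_T k' f
    · exact divPow_mem_T fun j => (hβ j).trans_le
        (Nat.pow_le_pow_right (Fact.out : p.Prime).pos h)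
  exact hle hd

/-- Every exponent occurring in `F_l` has entries at most `l < p ^ l`, so `F_l` lies in `T_l`. -/
theorem exists_mem_T (d : D K n) : ∃ k, d ∈ T K n p k := by
  obtain ⟨l, hl⟩ := exists_mem_canonicalFiltration d
  refine ⟨l, ?_⟩
  have h : canonicalFiltration K n l ≤ Subalgebra.toSubmodule (T K n p l) := by
    rw [canonicalFiltration, Submodule.span_le]
    rintro _ ⟨α, β, h, rfl⟩
    refine (T K n p l).mul_mem (polyIncl_mem_T l _) (divPow_mem_T fun j => ?_)
    have h1 := Finsupp.le_degree j β
    have h2 : l < p ^ l := Nat.lt_pow_self (Fact.out : p.Prime).one_lt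
    omega
  exact h hl

end Prime

/-! ### Characteristic `p`: $\mathcal D$ as a filtered free right $T_k$-module -/

section CharP

variable {K : Type u} [Field K] {n : ℕ} {p : ℕ} [Fact p.Prime] [CharP K p]

/-- A case of Lucas' theorem: the coefficient of `X ^ b` in `(1 + X ^ p ^ k) ^ g * (1 + X) ^ b`
comes from the second factor alone. -/
theorem cast_choose_mul_add (k g : ℕ) {b : ℕ} (hb : b < p ^ k) :
    (((p ^ k * g + b).choose (p ^ k * g) : ℕ) : K) = 1 := by
  have h1 : (p ^ k * g + b).choose (p ^ k * g) = (p ^ k * g + b).choose b := by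
    rw [Nat.choose_symm_add]
  rw [h1, ← coeff_one_add_X_pow, pow_add, pow_mul, add_pow_char_pow, one_pow]
  obtain ⟨r, hr⟩ : ∃ r : K[X], (1 + X ^ p ^ k) ^ g = 1 + X ^ p ^ k * r := by
    obtain ⟨r, hr⟩ := sub_dvd_pow_sub_pow (1 + X ^ p ^ k : K[X]) 1 g
    refine ⟨r, ?_⟩
    rw [one_pow, add_sub_cancel_left] at hr
    rw [← hr]
    ring
  rw [hr, add_mul, one_mul, mul_assoc, coeff_add, coeff_X_pow_mul', if_neg (by omega), add_zero,
    coeff_one_add_X_pow, Nat.choose_self, Nat.cast_one]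

theorem divPow_smul_mul_divPow (k : ℕ) (γ : Fin n →₀ ℕ) {β : Fin n →₀ ℕ}
    (hβ : ∀ j, β j < p ^ k) :
    divPow K n (p ^ k • γ) * divPow K n β = divPow K n (p ^ k • γ + β) := by
  rw [divPow_mul_divPow]
  have h : ((∏ j, ((p ^ k • γ) j + β j).choose ((p ^ k • γ) j) : ℕ) : K) = 1 := by
    rw [Nat.cast_prod]
    refine Finset.prod_eq_one fun j _ => ?_
    rw [Finsupp.smul_apply, smul_eq_mul]
    exact cast_choose_mul_add k (γ j) (hβ j)
  rw [h, one_smul]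

/-- Left and right multiplication by `x_j` commute, so the `p ^ k`-th power of their difference is
the difference of their `p ^ k`-th powers. The commutator with `x_j ^ p ^ k` thus lowers the
exponent by `p ^ k` in one step. -/
theorem adVar_pow_char_pow (k : ℕ) (j : Fin n) (d : D K n) :
    (adVar K j ^ p ^ k) d = d * var K n j ^ p ^ k - var K n j ^ p ^ k * d := by
  have : CharP (Module.End K (D K n)) p := charP_of_injective_algebraMap
    (FaithfulSMul.algebraMap_injective K (Module.End K (D K n))) p
  rw [adVar, sub_pow_char_pow_of_commute p k (LinearMap.commute_mulLeft_right _ _).symm,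
    LinearMap.pow_mulRight, LinearMap.pow_mulLeft]
  rfl

theorem divPow_add_mul_var_pow (k : ℕ) (j : Fin n) (β : Fin n →₀ ℕ) :
    divPow K n (β + Finsupp.single j (p ^ k)) * var K n j ^ p ^ k
      - var K n j ^ p ^ k * divPow K n (β + Finsupp.single j (p ^ k)) = divPow K n β := by
  rw [← adVar_pow_char_pow, adVar_pow_divPow]

theorem divPow_mul_var_pow_of_lt (k : ℕ) {j : Fin n} {β : Fin n →₀ ℕ} (h : β j < p ^ k) :
    divPow K n β * var K n j ^ p ^ k = var K n j ^ p ^ k * divPow K n β := by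
  rw [← sub_eq_zero, ← adVar_pow_char_pow, adVar_pow_divPow_eq_zero h]

theorem mul_var_pow_of_mem_T {k : ℕ} {d : D K n} (hd : d ∈ T K n p k) (j : Fin n) :
    d * var K n j ^ p ^ k = var K n j ^ p ^ k * d := by
  have h : T K n p k ≤ Subalgebra.centralizer K {var K n j ^ p ^ k} := by
    refine Algebra.adjoin_le ?_
    rintro _ (⟨f, rfl⟩ | ⟨β, hβ, rfl⟩)
    · rw [SetLike.mem_coe, Subalgebra.mem_centralizer_iff]
      rintro _ rfl
      rw [← map_pow, polyIncl_comm]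
    · rw [SetLike.mem_coe, Subalgebra.mem_centralizer_iff]
      rintro _ rfl
      exact (divPow_mul_var_pow_of_lt k (hβ j)).symm
  exact ((Subalgebra.mem_centralizer_iff K).1 (h hd) _ rfl).symm

/-- The coefficients `t_γ` commute with `x_j ^ p ^ k`, so the commutator acts only on `∂^[p^k γ]`,
replacing `γ` by `γ - e_j`, or giving zero if `γ j = 0`. -/
theorem sumDivPow_shift (k : ℕ) (j : Fin n) (t : (Fin n →₀ ℕ) →₀ T K n p k) :
    sumDivPow K n p k t * var K n j ^ p ^ k - var K n j ^ p ^ k * sumDivPow K n p k t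
      = sumDivPow K n p k (Finsupp.lcomapDomain (R := K) (fun γ => γ + Finsupp.single j 1)
        (add_left_injective _) t) := by
  induction t using Finsupp.induction_linear with
  | zero => simp
  | add s t hs ht =>
    rw [map_add, map_add, map_add, ← hs, ← ht, add_mul, mul_add]
    abel
  | single γ t =>
    rw [sumDivPow_single, mul_assoc, mul_var_pow_of_mem_T t.2 j, ← mul_assoc, ← mul_assoc,
      ← sub_mul]
    by_cases hj : γ j = 0
    · rw [divPow_mul_var_pow_of_lt k (by
        rw [Finsupp.smul_apply, hj, smul_zero]
        exact pow_pos (Fact.out : p.Prime).pos k), sub_self, zero_mul]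
      have h0 : Finsupp.lcomapDomain (R := K) (fun γ => γ + Finsupp.single j 1)
          (add_left_injective _) (Finsupp.single γ t) = 0 := by
        ext δ
        have hne : γ ≠ δ + Finsupp.single j 1 := by
          rintro rfl
          simp at hj
        simp [Finsupp.lcomapDomain, hne]
      rw [h0, map_zero]
    · have hb : γ - Finsupp.single j 1 + Finsupp.single j 1 = γ :=
        tsub_add_cancel_of_le (Finsupp.single_le_iff.2 (Nat.one_le_iff_ne_zero.2 hj))
      set δ := γ - Finsupp.single j 1 with hδ
      rw [← hb]
      have h1 : Finsupp.lcomapDomain (R := K) (fun γ => γ + Finsupp.single j 1)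
          (add_left_injective _) (Finsupp.single (δ + Finsupp.single j 1) t)
          = Finsupp.single δ t :=
        Finsupp.comapDomain_single (fun γ => γ + Finsupp.single j 1) δ t _
      rw [h1, sumDivPow_single, smul_add, Finsupp.smul_single, smul_eq_mul, mul_one,
        divPow_add_mul_var_pow]

/-- Induction on a bound for the degrees in the support. The commutators with the `x_j ^ p ^ k`
shift a relation down, so by induction all its coefficients at `γ ≠ 0` vanish; the remaining one is
the relation itself. -/
theorem sumDivPow_injective (k : ℕ) : Function.Injective (sumDivPow K n p k) := by
  have main : ∀ (m : ℕ) (t : (Fin n →₀ ℕ) →₀ T K n p k), (∀ γ, m ≤ γ.degree → t γ = 0) →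
      sumDivPow K n p k t = 0 → t = 0 := by
    intro m
    induction m with
    | zero => exact fun t ht _ => Finsupp.ext fun γ => ht γ (Nat.zero_le _)
    | succ m ih =>
      intro t ht h0
      have h1 : ∀ j γ, t (γ + Finsupp.single j 1) = 0 := by
        intro j γ
        have h2 := sumDivPow_shift k j t
        rw [h0, zero_mul, mul_zero, sub_self] at h2
        have h3 := ih _ (fun δ hδ => ht (δ + Finsupp.single j 1) (by
          rw [map_add, Finsupp.degree_single]; omega)) h2.symm
        exact DFunLike.congr_fun h3 γ
      have h4 : t = Finsupp.single 0 (t 0) := by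
        ext γ
        induction γ using exponent_induction with
        | h0 => simp
        | h1 γ j _ =>
          rw [h1, Finsupp.single_apply, if_neg]
          intro h
          have := DFunLike.congr_fun h j
          simp at this
      rw [h4, sumDivPow_single, smul_zero, divPow_zero, one_mul] at h0
      have h5 : t 0 = 0 := Subtype.ext h0
      rw [h4, h5, Finsupp.single_zero]
  rw [injective_iff_map_eq_zero]
  intro t ht
  refine main ((t.support.sup Finsupp.degree) + 1) t (fun γ hγ => ?_) ht
  by_contra h
  have : γ.degree ≤ t.support.sup Finsupp.degree :=
    Finset.le_sup (f := Finsupp.degree) (Finsupp.mem_support_iff.2 h)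
  omega

/-- In the right normal form, division of the entries of `β` by `p ^ k` splits `∂^[β]` as `∂^[p^k γ]
∂^[β₀]`. Degrees add up exactly, so the expansion respects the filtrations. The separate vanishing
clause is needed because the subtraction is truncated. -/
theorem exists_sumDivPow_eq (k : ℕ) {i : ℕ} {d : D K n} (hd : d ∈ canonicalFiltration K n i) :
    ∃ t, sumDivPow K n p k t = d ∧ ∀ γ, (t γ : D K n) ∈ stdSpan K (expLT n (p ^ k))
      (i - p ^ k * γ.degree) ∧ (i < p ^ k * γ.degree → t γ = 0) := by
  rw [canonicalFiltration_eq_stdSpan, stdSpan_eq_stdSpanRight isDownClosed_univ] at hd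
  have hq : 0 < p ^ k := pow_pos (Fact.out : p.Prime).pos k
  induction hd using Submodule.span_induction with
  | mem d hd =>
    obtain ⟨α, β, -, h, rfl⟩ := hd
    set γ : Fin n →₀ ℕ := Finsupp.equivFunOnFinite.symm fun j => β j / p ^ k with hγ
    set β₀ : Fin n →₀ ℕ := Finsupp.equivFunOnFinite.symm fun j => β j % p ^ k with hβ₀
    have hβ : β = p ^ k • γ + β₀ := by
      ext j
      simp [hγ, hβ₀, Nat.div_add_mod]
    have hlt : ∀ j, β₀ j < p ^ k := fun j => by
      simpa [hβ₀] using Nat.mod_lt _ hq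
    have hdeg : β.degree = p ^ k * γ.degree + β₀.degree := by
      rw [hβ, map_add, map_nsmul, smul_eq_mul]
    have hmem : divPow K n β₀ * polyIncl K n (MvPolynomial.monomial α 1)
        ∈ stdSpan K (expLT n (p ^ k)) (i - p ^ k * γ.degree) := by
      rw [stdSpan_eq_stdSpanRight (B := expLT n (p ^ k)) (isDownClosed_lt _)]
      exact mem_stdSpanRight hlt (by omega)
    refine ⟨Finsupp.single γ ⟨_, mem_T_of_mem_stdSpan hmem⟩, ?_, fun δ => ?_⟩
    · rw [sumDivPow_single, ← mul_assoc, divPow_smul_mul_divPow k γ hlt, ← hβ]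
    · rw [Finsupp.single_apply]
      split_ifs with hδ
      · subst hδ
        exact ⟨hmem, fun h' => by omega⟩
      · exact ⟨zero_mem _, fun _ => rfl⟩
  | zero => exact ⟨0, map_zero _, fun γ => ⟨zero_mem _, fun _ => rfl⟩⟩
  | add a b _ _ ha hb =>
    obtain ⟨s, hs, hs'⟩ := ha
    obtain ⟨t, ht, ht'⟩ := hb
    refine ⟨s + t, by rw [map_add, hs, ht], fun γ => ⟨add_mem (hs' γ).1 (ht' γ).1, fun h => ?_⟩⟩
    rw [Finsupp.add_apply, (hs' γ).2 h, (ht' γ).2 h, add_zero]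
  | smul c a _ ha =>
    obtain ⟨s, hs, hs'⟩ := ha
    refine ⟨c • s, by rw [map_smul, hs], fun γ => ⟨Submodule.smul_mem _ _ (hs' γ).1, fun h => ?_⟩⟩
    rw [Finsupp.smul_apply, (hs' γ).2 h, smul_zero]

variable (K n p) in
/-- `D(P_n)` is a free right module over `T_k`, with basis the `∂^[p^k γ]`. -/
def equivSumDivPow (k : ℕ) : ((Fin n →₀ ℕ) →₀ T K n p k) ≃ₗ[K] D K n :=
  LinearEquiv.ofBijective (sumDivPow K n p k) ⟨sumDivPow_injective k, fun d => by
    obtain ⟨l, hl⟩ := exists_mem_canonicalFiltration d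
    obtain ⟨t, ht, -⟩ := exists_sumDivPow_eq k hl
    exact ⟨t, ht⟩⟩

theorem equivSumDivPow_apply (k : ℕ) (t : (Fin n →₀ ℕ) →₀ T K n p k) :
    equivSumDivPow K n p k t = sumDivPow K n p k t := rfl

/-- By uniqueness of coordinates, the expansion of an element of `T_k` is concentrated at `γ = 0`,
and its filtered bound there is the claim. -/
theorem mem_inducedFiltration_iff {k i : ℕ} {t : T K n p k} :
    t ∈ inducedFiltration K n p k i ↔ (t : D K n) ∈ stdSpan K (expLT n (p ^ k)) i := by
  rw [mem_inducedFiltration]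
  constructor
  · intro h
    obtain ⟨s, hs, hs'⟩ := exists_sumDivPow_eq k h
    have h1 : s = Finsupp.single 0 t := by
      apply sumDivPow_injective k
      rw [hs, sumDivPow_single, smul_zero, divPow_zero, one_mul]
    have h2 := (hs' 0).1
    rwa [h1, Finsupp.single_eq_same, map_zero, mul_zero, Nat.sub_zero] at h2
  · intro h
    rw [canonicalFiltration_eq_stdSpan]
    exact stdSpan_mono (Set.subset_univ _) le_rfl h

end CharP

/-! ### Filtrations of modules -/

section FilteredModules

variable {K : Type u} [Field K] {A : Type v} [Ring A] [Algebra K A]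
variable {M : Type w} [AddCommGroup M] [Module K M] [Module A M] [IsScalarTower K A M]

instance finiteDimensional_smul (F : Submodule K A) (W : Submodule K M) [FiniteDimensional K F]
    [FiniteDimensional K W] : FiniteDimensional K ↥(F • W) := by
  set g : F ⊗[K] W →ₗ[K] M := TensorProduct.lift
    (((Algebra.lsmul K K M).toLinearMap.domRestrict₁₂ F W)) with hg
  have h : F • W ≤ LinearMap.range g := by
    rw [Submodule.smul_le]
    intro a ha w hw
    exact ⟨(⟨a, ha⟩ : F) ⊗ₜ (⟨w, hw⟩ : W), by
      rw [hg, TensorProduct.lift.tmul]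
      rfl⟩
  exact Submodule.finiteDimensional_of_le h

theorem hilb_mono_of_le {F G : ℕ → Submodule K A} {W W' : Submodule K M} {i l : ℕ}
    [FiniteDimensional K ↥(G l • W')] (h : F i • W ≤ G l • W') : hilb F W i ≤ hilb G W' l :=
  Submodule.finrank_mono h

namespace IsFiniteFiltration

variable {F : ℕ → Submodule K A} (hF : IsFiniteFiltration F)

include hF

theorem smul_smul_le (i l : ℕ) (W : Submodule K M) : F i • F l • W ≤ F (i + l) • W := by
  rw [Submodule.smul_le]
  intro a ha m hm
  induction hm using Submodule.smul_induction_on' with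
  | smul b hb w hw =>
    rw [← mul_smul]
    exact Submodule.smul_mem_smul (hF.mul_mem i l a ha b hb) hw
  | add x _ y _ hx hy => rw [smul_add]; exact add_mem hx hy

theorem le_smul (i : ℕ) (W : Submodule K M) : W ≤ F i • W := fun w hw => by
  rw [← one_smul A w]
  exact Submodule.smul_mem_smul (hF.mono (Nat.zero_le i) hF.one_mem) hw

theorem exists_mem_smul {W : Submodule K M} (hW : IsGenerating A W) (m : M) :
    ∃ i, m ∈ F i • W := by
  have hm : m ∈ Submodule.span A (W : Set M) := by rw [hW.2]; trivial
  induction hm using Submodule.span_induction with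
  | mem w hw => exact ⟨0, hF.le_smul 0 W hw⟩
  | zero => exact ⟨0, zero_mem _⟩
  | add x y _ _ hx hy =>
    obtain ⟨i, hi⟩ := hx
    obtain ⟨l, hl⟩ := hy
    exact ⟨max i l, add_mem (Submodule.smul_mono_left (hF.mono (le_max_left i l)) hi)
      (Submodule.smul_mono_left (hF.mono (le_max_right i l)) hl)⟩
  | smul a x _ hx =>
    obtain ⟨i, hi⟩ := hx
    obtain ⟨l, hl⟩ := hF.exhaust a
    exact ⟨l + i, hF.smul_smul_le l i W (Submodule.smul_mem_smul hl hi)⟩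

theorem exists_le_smul {W : Submodule K M} (hW : IsGenerating A W) (W' : Submodule K M)
    [FiniteDimensional K W'] : ∃ i, W' ≤ F i • W := by
  obtain ⟨s, rfl⟩ := Module.Finite.iff_fg.1 (inferInstance : FiniteDimensional K W')
  choose f hf using hF.exists_mem_smul hW
  refine ⟨s.sup f, Submodule.span_le.2 fun m hm => ?_⟩
  exact Submodule.smul_mono_left (hF.mono (Finset.le_sup hm)) (hf m)

theorem exists_le (V : Submodule K A) [FiniteDimensional K V] : ∃ i, V ≤ F i := by
  obtain ⟨s, rfl⟩ := Module.Finite.iff_fg.1 (inferInstance : FiniteDimensional K V)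
  choose f hf using hF.exhaust
  refine ⟨s.sup f, Submodule.span_le.2 fun m hm => hF.mono (Finset.le_sup hm) (hf m)⟩

theorem exists_hilb_le {W : Submodule K M} (hW : IsGenerating A W) (W' : Submodule K M)
    [FiniteDimensional K W'] : ∃ b, ∀ i, hilb F W' i ≤ hilb F W (i + b) := by
  have := hW.1
  have := hF.finite
  obtain ⟨b, hb⟩ := hF.exists_le_smul hW W'
  refine ⟨b, fun i => hilb_mono_of_le ?_⟩
  exact (Submodule.smul_mono le_rfl hb).trans (hF.smul_smul_le i b W)

theorem pow_le {V : Submodule K A} {a : ℕ} (hV : V ≤ F a) (i : ℕ) : V ^ i ≤ F (a * i) := by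
  induction i with
  | zero =>
    rw [pow_zero, Submodule.one_le]
    exact hF.one_mem
  | succ i ih =>
    rw [pow_succ, Submodule.mul_le]
    intro x hx y hy
    rw [mul_add, mul_one]
    exact hF.mul_mem _ _ x (ih hx) y (hV hy)

theorem gkDim_le {W : Submodule K M} (hW : IsGenerating A W) {d : ℕ} {c : ℝ}
    (hd : Asymp (hilb F W) d c) : gkDim K A M ≤ d := by
  have := hW.1
  have := hF.finite
  refine iSup_le fun V => iSup_le fun _ => iSup_le fun W' => iSup_le fun _ => ?_
  obtain ⟨a, ha⟩ := hF.exists_le V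
  obtain ⟨b, hb⟩ := hF.exists_le_smul hW W'
  -- The dilation factor must be positive, while `a` may be `0`.
  refine hd.growth_le (a := a + 1) (b := b) (Nat.succ_pos a) (Eventually.of_forall fun i => ?_)
  refine Submodule.finrank_mono ((Submodule.smul_mono (hF.pow_le (ha.trans
    (hF.mono (Nat.le_succ a))) i) hb).trans (hF.smul_smul_le _ _ W))

end IsFiniteFiltration

end FilteredModules

/-! ### Hilbert functions of modules over `T_k` -/

theorem ser_shift (f : ℕ → ℕ) (b : ℕ) : ∃ h : ℤ[X],
    ser f = PowerSeries.X ^ b * ser (fun i => f (i + b)) + (h : PowerSeries ℤ) := by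
  refine ⟨PowerSeries.trunc b (ser f), (PowerSeries.eq_X_pow_mul_shift_add_trunc b (ser f)).trans ?_⟩
  simp only [ser, PowerSeries.coeff_mk]

/-- The zero of `h` at `1` is cancelled against the denominator. It cannot exhaust the denominator,
as the series would then be a polynomial although all `f i` are positive. -/
theorem exists_normalized_series {f : ℕ → ℕ} {m : ℕ} {h : ℤ[X]}
    (hf : (1 - PowerSeries.X) ^ (m + 1) * ser f = (h : PowerSeries ℤ)) (hpos : ∀ i, 0 < f i) :
    ∃ (d : ℕ) (N : ℤ[X]), d ≤ m ∧ (1 - PowerSeries.X) ^ (d + 1) * ser f = (N : PowerSeries ℤ) ∧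
      N.eval 1 ≠ 0 := by
  have hX : (1 - PowerSeries.X : PowerSeries ℤ) ≠ 0 := by
    simpa using one_sub_X_pow_ne_zero one_pos
  have hs : ∀ N : ℤ[X], ser f ≠ (N : PowerSeries ℤ) := by
    intro N hN
    have h1 := congrArg (PowerSeries.coeff (N.natDegree + 1)) hN
    rw [ser, PowerSeries.coeff_mk, Polynomial.coeff_coe,
      coeff_eq_zero_of_natDegree_lt (Nat.lt_succ_self _)] at h1
    have := hpos (N.natDegree + 1)
    omega
  have h0 : h ≠ 0 := by
    rintro rfl
    rw [Polynomial.coe_zero] at hf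
    refine hs 0 ?_
    rw [Polynomial.coe_zero]
    exact (mul_eq_zero.1 hf).resolve_left (pow_ne_zero _ hX)
  obtain ⟨N, hN, hN1⟩ := exists_eq_pow_rootMultiplicity_mul_and_not_dvd h h0 1
  rw [dvd_iff_isRoot] at hN1
  set a := rootMultiplicity 1 h with ha
  have h2 : (h : PowerSeries ℤ) = (1 - PowerSeries.X) ^ a * ((C (-1) ^ a * N : ℤ[X]) :
      PowerSeries ℤ) := by
    have h3 : (X - C 1 : ℤ[X]) = (1 - X) * C (-1) := by simp
    rw [hN, h3, mul_pow, mul_assoc, Polynomial.coe_mul]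
    simp
  rw [h2] at hf
  rcases Nat.lt_or_ge m a with hma | hma
  · exfalso
    obtain ⟨l, hl⟩ := Nat.exists_eq_add_of_lt hma
    rw [hl, show m + l + 1 = (m + 1) + l by ring, pow_add _ (m + 1) l, mul_assoc] at hf
    refine hs ((1 - X) ^ l * (C (-1) ^ (m + 1 + l) * N)) ?_
    rw [mul_left_cancel₀ (pow_ne_zero _ hX) hf]
    simp
  · refine ⟨m - a, C (-1) ^ a * N, Nat.sub_le _ _, ?_, ?_⟩
    · rw [show m + 1 = a + (m - a + 1) by omega, pow_add, mul_assoc] at hf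
      exact mul_left_cancel₀ (pow_ne_zero _ hX) hf
    · rw [eval_mul, eval_pow, eval_C]
      exact mul_ne_zero (pow_ne_zero _ (by norm_num)) hN1

/-! ### $T_k$ over $P_n$: Hilbert series and Gelfand–Kirillov dimension -/

section TModules

variable {K : Type u} [Field K] {n : ℕ} {p : ℕ} {k : ℕ}

variable (K n) in
theorem isFiniteFiltration_canonicalFiltration :
    IsFiniteFiltration (A := D K n) (canonicalFiltration K n) where
  mono := canonicalFiltration_mono
  exhaust := exists_mem_canonicalFiltration
  one_mem := one_mem_canonicalFiltration
  mul_mem _ _ _ ha _ hb := mul_mem_canonicalFiltration ha hb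
  finite _ := inferInstance

variable (K n p k) in
theorem isFiniteFiltration_inducedFiltration :
    IsFiniteFiltration (A := T K n p k) (inducedFiltration K n p k) where
  mono := inducedFiltration_mono k
  exhaust := exists_mem_inducedFiltration
  one_mem := one_mem_inducedFiltration k
  mul_mem _ _ _ ha _ hb := mul_mem_inducedFiltration ha hb
  finite _ := inferInstance

theorem exists_add_eq_of_le_degree (α : Fin n →₀ ℕ) {l : ℕ} (h : l ≤ α.degree) :
    ∃ α₁ α₂ : Fin n →₀ ℕ, α₁ + α₂ = α ∧ α₁.degree = l := by
  induction α using exponent_induction generalizing l with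
  | h0 => exact ⟨0, 0, add_zero 0, by simpa using h.antisymm' (Nat.zero_le _)⟩
  | h1 α j ih =>
    rw [map_add, Finsupp.degree_single] at h
    rcases Nat.lt_or_ge α.degree l with h' | h'
    · exact ⟨α + Finsupp.single j 1, 0, add_zero _, by
        rw [map_add, Finsupp.degree_single]; omega⟩
    · obtain ⟨α₁, α₂, h1, h2⟩ := ih h'
      exact ⟨α₁, α₂ + Finsupp.single j 1, by rw [← add_assoc, h1], h2⟩

theorem degree_le_of_forall_lt {q : ℕ} {β : Fin n →₀ ℕ} (h : ∀ j, β j < q) :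
    β.degree ≤ n * q := by
  rw [Finsupp.degree_eq_sum]
  refine (Finset.sum_le_sum fun j _ => (h j).le).trans ?_
  simp

theorem polyInclT_mem_inducedFiltration {l : ℕ} {f : P K n} (hf : f ∈ polyDegreeLE K n l) :
    polyInclT K n p k f ∈ inducedFiltration K n p k l := by
  have h : polyDegreeLE K n l ≤ (inducedFiltration K n p k l).comap
      (polyInclT K n p k).toLinearMap := by
    rw [polyDegreeLE, Submodule.span_le]
    rintro _ ⟨α, hα, rfl⟩
    exact canonicalFiltration_mono hα (monomial_mem_canonicalFiltration α)
  exact h hf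

variable [Fact p.Prime] [CharP K p]

/-- The divided powers in `T_k` have degree at most `n * p ^ k`, so any degree beyond that comes
from the monomial `x^α`, from which a factor of degree at most `l` can be split off. -/
theorem inducedFiltration_add_le (l : ℕ) :
    inducedFiltration K n p k (l + n * p ^ k)
      ≤ (polyDegreeLE K n l).map (polyInclT K n p k).toLinearMap
        * inducedFiltration K n p k (n * p ^ k) := by
  intro t ht
  rw [mem_inducedFiltration_iff] at ht
  have h : stdSpan K (expLT n (p ^ k)) (l + n * p ^ k)
      ≤ ((polyDegreeLE K n l).map (polyInclT K n p k).toLinearMap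
        * inducedFiltration K n p k (n * p ^ k)).map (T K n p k).val.toLinearMap := by
    rw [stdSpan, Submodule.span_le]
    rintro _ ⟨α, β, hβ, h, rfl⟩
    have hβ' := degree_le_of_forall_lt hβ
    obtain ⟨α₁, α₂, rfl, h1, h2⟩ : ∃ α₁ α₂ : Fin n →₀ ℕ, α₁ + α₂ = α ∧ α₁.degree ≤ l ∧
        α₂.degree + β.degree ≤ n * p ^ k := by
      rcases Nat.lt_or_ge α.degree l with h' | h'
      · exact ⟨α, 0, add_zero α, h'.le, by simpa using hβ'⟩
      · obtain ⟨α₁, α₂, h1, h2⟩ := exists_add_eq_of_le_degree α h'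
        refine ⟨α₁, α₂, h1, h2.le, ?_⟩
        rw [← h1, map_add] at h
        omega
    have hmem : polyIncl K n (MvPolynomial.monomial α₂ 1) * divPow K n β
        ∈ stdSpan K (expLT n (p ^ k)) (n * p ^ k) := mem_stdSpan hβ h2
    refine ⟨polyInclT K n p k (MvPolynomial.monomial α₁ 1) * ⟨_, mem_T_of_mem_stdSpan hmem⟩,
      Submodule.mul_mem_mul ⟨_, monomial_mem_polyDegreeLE h1, rfl⟩
        (mem_inducedFiltration_iff.2 hmem), ?_⟩
    change polyIncl K n _ * (polyIncl K n _ * divPow K n β) = _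
    rw [← mul_assoc, ← map_mul, MvPolynomial.monomial_mul, one_mul]
  obtain ⟨s, hs, hst⟩ := h ht
  have : s = t := Subtype.ext hst
  exact this ▸ hs

variable {M : Type w} [AddCommGroup M] [Module K M] [Module (T K n p k) M]
  [IsScalarTower K (T K n p k) M]

theorem inducedFiltration_add_smul (l : ℕ) (W : Submodule K M) :
    inducedFiltration K n p k (l + n * p ^ k) • W
      = (polyDegreeLE K n l).map (polyInclT K n p k).toLinearMap
        • inducedFiltration K n p k (n * p ^ k) • W := by
  refine le_antisymm ?_ ?_
  · refine (Submodule.smul_mono_left (inducedFiltration_add_le l)).trans ?_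
    rw [← smul_eq_mul, Submodule.smul_assoc]
  · refine le_trans (Submodule.smul_mono_left ?_)
      ((isFiniteFiltration_inducedFiltration K n p k).smul_smul_le l _ W)
    rintro _ ⟨f, hf, rfl⟩
    exact polyInclT_mem_inducedFiltration hf

theorem exists_series_hilb_inducedFiltration [Nontrivial M] (W : Submodule K M)
    (hW : IsGenerating (T K n p k) W) :
    ∃ (d : ℕ) (N : ℤ[X]), d ≤ n ∧ (1 - PowerSeries.X) ^ (d + 1)
      * ser (hilb (A := T K n p k) (inducedFiltration K n p k) W) = (N : PowerSeries ℤ) ∧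
        N.eval 1 ≠ 0 := by
  have := hW.1
  let _ : Module (P K n) M := Module.compHom M (polyInclT K n p k).toRingHom
  have hsmul : ∀ (f : P K n) (m : M), f • m = polyInclT K n p k f • m := fun _ _ => rfl
  have : IsScalarTower K (P K n) M := ⟨fun c f m => by
    rw [hsmul, hsmul, map_smul, smul_assoc]⟩
  -- Up to the shift by `n * p ^ k`, the filtration of the `T_k`-module is the degree filtration of
  -- a `P_n`-module with generating space `W'`.
  set W' := inducedFiltration K n p k (n * p ^ k) • W with hW'
  have heq : ∀ l, inducedFiltration K n p k (l + n * p ^ k) • W = polyDegreeLE K n l • W' := by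
    intro l
    rw [inducedFiltration_add_smul]
    refine le_antisymm (Submodule.smul_le.2 ?_) (Submodule.smul_le.2 ?_)
    · rintro _ ⟨f, hf, rfl⟩ m hm
      exact Submodule.smul_mem_smul (r := f) hf hm
    · intro f hf m hm
      rw [hsmul]
      exact Submodule.smul_mem_smul ⟨f, hf, rfl⟩ hm
  obtain ⟨h, hh⟩ := exists_polynomial_hilbertSeries (K := K) (n := n) W' fun i => inferInstance
  obtain ⟨h', hh'⟩ := ser_shift (hilb (A := T K n p k) (inducedFiltration K n p k) W) (n * p ^ k)
  have h1 : (fun i => hilb (A := T K n p k) (inducedFiltration K n p k) W (i + n * p ^ k))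
      = fun i => Module.finrank K ↥(polyDegreeLE K n i • W') := by
    funext i
    rw [hilb, heq]
  rw [h1] at hh'
  refine exists_normalized_series (m := n) (h := X ^ (n * p ^ k) * h + (1 - X) ^ (n + 1) * h')
    ?_ fun i => ?_
  · rw [hh', mul_add, mul_left_comm, hh]
    simp
  · have hne : W ≠ ⊥ := by
      rintro rfl
      have h2 := hW.2
      rw [Submodule.bot_coe, Submodule.span_singleton_eq_bot.2 rfl] at h2
      exact bot_ne_top h2
    have h3 : 0 < Module.finrank K W := by
      have := Submodule.nontrivial_iff_ne_bot.2 hne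
      exact Module.finrank_pos
    refine h3.trans_le (Submodule.finrank_mono ?_)
    exact (isFiniteFiltration_inducedFiltration K n p k).le_smul i W

/-- For the lower bound, take `V` to be the first filtration step: `V ^ i` contains the polynomials
of degree at most `i`, which suffices once `W` is enlarged to its filtration step `n * p ^ k`. -/
theorem gkDim_eq {W : Submodule K M} (hW : IsGenerating (T K n p k) W) {d : ℕ} {c : ℝ}
    (hd : Asymp (hilb (A := T K n p k) (inducedFiltration K n p k) W) d c) :
    gkDim K (T K n p k) M = d := by
  have hF := isFiniteFiltration_inducedFiltration K n p k
  have := hW.1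
  refine le_antisymm (hF.gkDim_le hW hd) ?_
  refine le_iSup_of_le (inducedFiltration K n p k 1) (le_iSup_of_le inferInstance
    (le_iSup_of_le (inducedFiltration K n p k (n * p ^ k) • W) (le_iSup_of_le inferInstance ?_)))
  have hfin : ∀ i, FiniteDimensional K ↥(inducedFiltration K n p k 1 ^ i) := fun i =>
    Submodule.finiteDimensional_of_le (hF.pow_le le_rfl i)
  refine hd.le_growth (a := 1) (b := 0) one_pos (Eventually.of_forall fun i => ?_)
  rw [one_mul, add_zero]
  refine Submodule.finrank_mono ((Submodule.smul_mono_left (hF.mono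
    (Nat.le_add_right i (n * p ^ k)))).trans ?_)
  rw [inducedFiltration_add_smul]
  refine Submodule.smul_mono_left ?_
  rw [Submodule.map_le_iff_le_comap, polyDegreeLE, Submodule.span_le]
  rintro _ ⟨α, hα, rfl⟩
  rw [SetLike.mem_coe, Submodule.mem_comap]
  have hone : (1 : T K n p k) ∈ inducedFiltration K n p k 1 := hF.mono zero_le_one hF.one_mem
  induction α using exponent_induction generalizing i with
  | h0 =>
    have h1 : (polyInclT K n p k).toLinearMap (MvPolynomial.monomial 0 1) = 1 :=
      map_one (polyInclT K n p k)
    rw [h1]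
    simpa using Submodule.pow_mem_pow _ hone i
  | h1 α j ih =>
    rw [map_add, Finsupp.degree_single] at hα
    obtain ⟨i, rfl⟩ : ∃ l, i = l + 1 := ⟨i - 1, by omega⟩
    have h2 := Submodule.mul_mem_mul (ih i (by omega)) (polyInclT_mem_inducedFiltration (p := p)
      (k := k) (monomial_mem_polyDegreeLE (K := K) (α := Finsupp.single j 1) (i := 1) (by simp)))
    rw [← pow_succ, AlgHom.toLinearMap_apply, ← map_mul, MvPolynomial.monomial_mul, one_mul] at h2
    exact h2

end TModules

/-! ### Induced modules -/

/-- Exponents `γ` with `q |γ| ≤ i`, supported in `s`. -/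
def scaledExp {n : ℕ} (q : ℕ) (s : Finset (Fin n)) (i : ℕ) : Set (Fin n →₀ ℕ) :=
  {γ | q * γ.degree ≤ i ∧ ∀ j ∉ s, γ j = 0}

theorem finite_scaledExp {n q : ℕ} (hq : 0 < q) (s : Finset (Fin n)) (i : ℕ) :
    (scaledExp q s i).Finite :=
  (finite_degree_le n i).subset fun _ hγ => (Nat.le_mul_of_pos_left _ hq).trans hγ.1

/-- The sum of the `h (i - q |γ|)` over the `γ` supported in `s` with `q |γ| ≤ i`. -/
def scaledSum {n q : ℕ} (hq : 0 < q) (h : ℕ → ℕ) (s : Finset (Fin n)) (i : ℕ) : ℕ :=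
  ∑ γ ∈ (finite_scaledExp hq s i).toFinset, h (i - q * γ.degree)

theorem scaledSum_insert_of_lt {n q : ℕ} (hq : 0 < q) (h : ℕ → ℕ) (s : Finset (Fin n))
    (j : Fin n) {i : ℕ} (hi : i < q) :
    scaledSum hq h (insert j s) i = scaledSum hq h s i := by
  have h1 : scaledExp q (insert j s) i = scaledExp q s i := by
    ext γ
    constructor
    · rintro ⟨h1, h2⟩
      have h3 : γ = 0 := by
        rw [← Finsupp.degree_eq_zero_iff]
        by_contra h0
        have := Nat.le_mul_of_pos_right q (Nat.pos_of_ne_zero h0)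
        omega
      exact ⟨h1, fun l _ => by rw [h3]; rfl⟩
    · rintro ⟨h1, h2⟩
      exact ⟨h1, fun l hl => h2 l fun h' => hl (Finset.mem_insert_of_mem h')⟩
  simp only [scaledSum, h1]

/-- The exponents with `γ j = 0` give the first sum; the others are `δ + e_j`, and lowering by `e_j`
removes `q` from the degree bound. In series form this is one factor `1 / (1 - X ^ q)` per variable.
-/
theorem scaledSum_insert_add {n q : ℕ} (hq : 0 < q) (h : ℕ → ℕ) {s : Finset (Fin n)}
    {j : Fin n} (hj : j ∉ s) (i : ℕ) :
    scaledSum hq h (insert j s) (i + q)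
      = scaledSum hq h s (i + q) + scaledSum hq h (insert j s) i := by
  classical
  rw [scaledSum, ← Finset.sum_filter_add_sum_filter_not _ (fun γ : Fin n →₀ ℕ => γ j = 0)]
  congr 1
  · refine Finset.sum_congr (Finset.ext fun γ => ?_) fun _ _ => rfl
    rw [Finset.mem_filter, Set.Finite.mem_toFinset, Set.Finite.mem_toFinset]
    constructor
    · rintro ⟨⟨h1, h2⟩, h3⟩
      refine ⟨h1, fun l hl => ?_⟩
      by_cases hlj : l = j
      · rw [hlj, h3]
      · exact h2 l (by simp [hlj, hl])
    · rintro ⟨h1, h2⟩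
      exact ⟨⟨h1, fun l hl => h2 l fun h' => hl (Finset.mem_insert_of_mem h')⟩, h2 j hj⟩
  · symm
    refine Finset.sum_bij (fun γ _ => γ + Finsupp.single j 1) (fun γ hγ => ?_)
      (fun γ _ γ' _ h => add_right_cancel h) (fun γ hγ => ?_) (fun γ hγ => ?_)
    · rw [Set.Finite.mem_toFinset] at hγ
      rw [Finset.mem_filter, Set.Finite.mem_toFinset]
      refine ⟨⟨?_, fun l hl => ?_⟩, by simp⟩
      · rw [map_add, Finsupp.degree_single, mul_add, mul_one]
        exact Nat.add_le_add_right hγ.1 q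
      · have hlj : j ≠ l := by
          rintro rfl
          simp at hl
        simp [hγ.2 l hl, hlj]
    · rw [Finset.mem_filter, Set.Finite.mem_toFinset] at hγ
      obtain ⟨⟨h1, h2⟩, h3⟩ := hγ
      have hb : γ - Finsupp.single j 1 + Finsupp.single j 1 = γ :=
        tsub_add_cancel_of_le (Finsupp.single_le_iff.2 (Nat.one_le_iff_ne_zero.2 h3))
      refine ⟨γ - Finsupp.single j 1, ?_, hb⟩
      rw [Set.Finite.mem_toFinset]
      refine ⟨?_, fun l hl => ?_⟩
      · rw [← hb, map_add, Finsupp.degree_single, mul_add, mul_one] at h1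
        exact Nat.le_of_add_le_add_right h1
      · rw [Finsupp.tsub_apply, h2 l hl, Nat.zero_sub]
    · rw [map_add, Finsupp.degree_single, mul_add, mul_one, Nat.add_sub_add_right]

theorem one_sub_X_pow_mul_ser_scaledSum {n q : ℕ} (hq : 0 < q) (h : ℕ → ℕ) (s : Finset (Fin n)) :
    (1 - PowerSeries.X ^ q) ^ s.card * ser (scaledSum hq h s) = ser h := by
  classical
  induction s using Finset.induction_on with
  | empty =>
    rw [Finset.card_empty, pow_zero, one_mul]
    congr 1
    funext i
    have h1 : (finite_scaledExp hq (∅ : Finset (Fin n)) i).toFinset = {0} := by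
      ext γ
      rw [Set.Finite.mem_toFinset, Finset.mem_singleton]
      constructor
      · rintro ⟨-, h2⟩
        exact Finsupp.ext fun j => h2 j (by simp)
      · rintro rfl
        exact ⟨by simp, fun _ _ => rfl⟩
    rw [scaledSum, h1]
    simp
  | insert j s hj ih =>
    rw [← ih, Finset.card_insert_of_notMem hj, pow_succ, mul_assoc]
    congr 1
    ext i
    rw [sub_mul, one_mul, map_sub, PowerSeries.coeff_X_pow_mul']
    simp only [ser, PowerSeries.coeff_mk]
    split_ifs with hi
    · obtain ⟨i, rfl⟩ := Nat.exists_eq_add_of_le' hi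
      rw [scaledSum_insert_add hq h hj, Nat.add_sub_cancel]
      push_cast
      ring
    · rw [scaledSum_insert_of_lt hq h _ _ (by omega), sub_zero]

/-! ### Coordinates and Hilbert series of induced modules -/

section InducedT

variable {K : Type u} [Field K] {n : ℕ} {p : ℕ} {k : ℕ}
variable (N : Type w) [AddCommGroup N] [Module K N] [Module (T K n p k) N]

variable (p k) in
/-- The map `(x_γ) ↦ ∑ ∂^[p^k γ] ⊗ x_γ`. -/
def sumInduced : ((Fin n →₀ ℕ) →₀ N) →ₗ[K] Induced (T K n p k) N :=
  Finsupp.lsum K fun γ => (Algebra.lsmul K K _ (divPow K n (p ^ k • γ))).comp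
    (toInduced (T K n p k) N)

theorem sumInduced_single (γ : Fin n →₀ ℕ) (x : N) :
    sumInduced p k N (Finsupp.single γ x)
      = divPow K n (p ^ k • γ) • toInduced (T K n p k) N x := by
  rw [sumInduced, Finsupp.lsum_single]
  rfl

theorem toInduced_smul (t : T K n p k) (x : N) :
    toInduced (T K n p k) N (t • x) = (t : D K n) • toInduced (T K n p k) N x := by
  symm
  refine (Submodule.Quotient.eq _).2 (Submodule.subset_span ⟨1, t, x, ?_⟩)
  have h1 : (1 * (t : D K n)) ⊗ₜ[K] x = (t : D K n) • ((1 : D K n) ⊗ₜ[K] x) := by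
    rw [TensorProduct.smul_tmul', smul_eq_mul, mul_one, one_mul]
  rw [h1]
  rfl

theorem isGenerating_map_toInduced {W : Submodule K N} (hW : IsGenerating (T K n p k) W) :
    IsGenerating (D K n) (W.map (toInduced (T K n p k) N)) := by
  have := hW.1
  refine ⟨inferInstance, eq_top_iff.2 ?_⟩
  set S := Submodule.span (D K n) ((W.map (toInduced (T K n p k) N) : Submodule K _) :
    Set (Induced (T K n p k) N)) with hS
  have h1 : ∀ x : N, toInduced (T K n p k) N x ∈ S := by
    intro x
    have hx : x ∈ Submodule.span (T K n p k) (W : Set N) := by rw [hW.2]; trivial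
    induction hx using Submodule.span_induction with
    | mem x hx => exact Submodule.subset_span ⟨x, hx, rfl⟩
    | zero => rw [map_zero]; exact zero_mem _
    | add x y _ _ hx hy => rw [map_add]; exact add_mem hx hy
    | smul t x _ hx => rw [toInduced_smul]; exact S.smul_mem _ hx
  rintro ⟨z⟩ -
  change Submodule.Quotient.mk z ∈ S
  induction z using TensorProduct.induction_on with
  | zero => exact zero_mem _
  | add y z hy hz => exact add_mem hy hz
  | tmul a x =>
    have h2 : a ⊗ₜ[K] x = a • ((1 : D K n) ⊗ₜ[K] x) := by
      rw [TensorProduct.smul_tmul', smul_eq_mul, mul_one]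
    rw [h2, Submodule.Quotient.mk_smul]
    exact S.smul_mem a (h1 x)

variable [IsScalarTower K (T K n p k) N]

variable (p k) in
/-- The finitely supported families with `γ`-th entry in `T_{k, i - p^k |γ|} W`. -/
def gradedFamilies (W : Submodule K N) (i : ℕ) : Submodule K ((Fin n →₀ ℕ) →₀ N) :=
  Finsupp.submodule fun γ : Fin n →₀ ℕ => if i < p ^ k * γ.degree then ⊥ else
    inducedFiltration K n p k (i - p ^ k * γ.degree) • W

theorem mem_gradedFamilies {W : Submodule K N} {i : ℕ} {f : (Fin n →₀ ℕ) →₀ N} :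
    f ∈ gradedFamilies p k N W i ↔ ∀ γ : Fin n →₀ ℕ,
      f γ ∈ inducedFiltration K n p k (i - p ^ k * γ.degree) • W ∧
        (i < p ^ k * γ.degree → f γ = 0) := by
  rw [gradedFamilies, Finsupp.mem_submodule_iff]
  refine forall_congr' fun γ => ?_
  split_ifs with h
  · rw [Submodule.mem_bot]
    exact ⟨fun h' => ⟨h' ▸ zero_mem _, fun _ => h'⟩, fun h' => h'.2 h⟩
  · exact ⟨fun h' => ⟨h', fun h'' => absurd h'' h⟩, fun h' => h'.1⟩

/-- Only the finitely many `γ` with `p ^ k * |γ| ≤ i` carry an entry, so the families form a finite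
product. -/
theorem finrank_gradedFamilies (W : Submodule K N) [FiniteDimensional K W] (hq : 0 < p ^ k)
    (i : ℕ) : Module.finrank K ↥(gradedFamilies (n := n) p k N W i)
      = scaledSum hq (hilb (A := T K n p k) (inducedFiltration K n p k) W)
        (Finset.univ : Finset (Fin n)) i := by
  set s := (finite_scaledExp hq (Finset.univ : Finset (Fin n)) i).toFinset with hs
  have hmem : ∀ γ, γ ∈ s ↔ p ^ k * γ.degree ≤ i := fun γ => by
    rw [hs, Set.Finite.mem_toFinset]
    exact ⟨fun h => h.1, fun h => ⟨h, fun j hj => absurd (Finset.mem_univ j) hj⟩⟩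
  let e : ↥(gradedFamilies (n := n) p k N W i) →ₗ[K]
      ((γ : s) → ↥(inducedFiltration K n p k (i - p ^ k * (γ : Fin n →₀ ℕ).degree) • W)) :=
    LinearMap.pi fun γ => ((Finsupp.lapply (γ : Fin n →₀ ℕ)).comp (Submodule.subtype _)).codRestrict
      _ fun f => ((mem_gradedFamilies N).1 f.2 γ).1
  have hinj : Function.Injective e := by
    rw [injective_iff_map_eq_zero]
    intro f hf
    refine Subtype.ext (Finsupp.ext fun γ => ?_)
    by_cases hγ : γ ∈ s
    · exact congrArg Subtype.val (congrFun hf ⟨γ, hγ⟩)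
    · exact ((mem_gradedFamilies N).1 f.2 γ).2 (by rw [hmem] at hγ; omega)
  have hsurj : Function.Surjective e := by
    intro y
    classical
    let f : (Fin n →₀ ℕ) →₀ N := Finsupp.onFinset s
      (fun γ => if h : γ ∈ s then (y ⟨γ, h⟩ : N) else 0) fun γ hγ => by
        by_contra h
        exact hγ (dif_neg h)
    have hfs : ∀ γ (h : γ ∈ s), f γ = y ⟨γ, h⟩ := fun γ h => dif_pos h
    have hfn : ∀ γ, γ ∉ s → f γ = 0 := fun γ h => dif_neg h
    refine ⟨⟨f, (mem_gradedFamilies N).2 fun γ => ⟨?_, fun h => hfn γ fun h' => ?_⟩⟩, ?_⟩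
    · by_cases h : γ ∈ s
      · rw [hfs γ h]
        exact (y ⟨γ, h⟩).2
      · rw [hfn γ h]
        exact zero_mem _
    · rw [hmem] at h'
      omega
    · funext γ
      exact Subtype.ext (hfs γ γ.2)
  rw [LinearEquiv.finrank_eq (LinearEquiv.ofBijective e ⟨hinj, hsurj⟩), Module.finrank_pi_fintype,
    scaledSum, ← hs, ← Finset.sum_coe_sort s]
  rfl

variable [Fact p.Prime] [CharP K p]

variable (p k) in
/-- The map `∑ ∂^[p^k γ] t_γ ⊗ x ↦ (t_γ x)`. -/
def tensorCoord : D K n ⊗[K] N →ₗ[K] ((Fin n →₀ ℕ) →₀ N) :=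
  TensorProduct.lift ((Finsupp.lsum K fun γ =>
    (Algebra.lsmul K K N).toLinearMap.compr₂ (Finsupp.lsingle γ)).comp
      (equivSumDivPow K n p k).symm.toLinearMap)

theorem tensorCoord_single (γ : Fin n →₀ ℕ) (t : T K n p k) (x : N) :
    tensorCoord p k N ((divPow K n (p ^ k • γ) * (t : D K n)) ⊗ₜ[K] x) = Finsupp.single γ (t • x) := by
  rw [← sumDivPow_single, ← equivSumDivPow_apply, tensorCoord, TensorProduct.lift.tmul,
    LinearMap.comp_apply, LinearEquiv.coe_coe, LinearEquiv.symm_apply_apply, Finsupp.lsum_single]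
  rfl

theorem tensorCoord_mul (a : D K n) (b : T K n p k) (x : N) :
    tensorCoord p k N ((a * (b : D K n)) ⊗ₜ[K] x) = tensorCoord p k N (a ⊗ₜ[K] (b • x)) := by
  obtain ⟨t, rfl⟩ := (equivSumDivPow K n p k).surjective a
  rw [equivSumDivPow_apply]
  induction t using Finsupp.induction_linear with
  | zero => simp
  | add s t hs ht => rw [map_add, add_mul, TensorProduct.add_tmul, TensorProduct.add_tmul, map_add,
      map_add, hs, ht]
  | single γ t =>
    rw [sumDivPow_single, mul_assoc, tensorCoord_single, ← mul_smul]
    exact tensorCoord_single N γ (t * b) x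

theorem tensorCoord_eq_zero {z : D K n ⊗[K] N} (hz : z ∈ balancedRel (T K n p k) N) :
    tensorCoord p k N z = 0 := by
  -- The relations form a `D`-submodule while `tensorCoord` is only `K`-linear, so the induction
  -- must carry an arbitrary multiplier.
  suffices h : ∀ c : D K n, tensorCoord p k N (c • z) = 0 by
    simpa using h 1
  induction hz using Submodule.span_induction with
  | mem z hz =>
    obtain ⟨a, b, x, rfl⟩ := hz
    intro c
    rw [smul_sub, TensorProduct.smul_tmul', TensorProduct.smul_tmul', smul_eq_mul, smul_eq_mul,
      map_sub, ← mul_assoc, tensorCoord_mul, sub_self]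
  | zero => simp
  | add x y _ _ hx hy => intro c; rw [smul_add, map_add, hx, hy, add_zero]
  | smul d x _ hx => intro c; rw [← mul_smul]; exact hx _

/-- `tensorCoord` vanishes on the relations and recovers the family from a representative of its
image, so it is a left inverse. -/
theorem sumInduced_injective : Function.Injective (sumInduced (K := K) (n := n) p k N) := by
  have h : ∀ f : (Fin n →₀ ℕ) →₀ N, ∃ z : D K n ⊗[K] N, Submodule.Quotient.mk z = sumInduced (K := K) (n := n) p k N f ∧
      tensorCoord p k N z = f := by
    intro f
    induction f using Finsupp.induction_linear with
    | zero => exact ⟨0, by simp⟩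
    | add f g hf hg =>
      obtain ⟨y, hy, hy'⟩ := hf
      obtain ⟨z, hz, hz'⟩ := hg
      exact ⟨y + z, by rw [Submodule.Quotient.mk_add, hy, hz, map_add], by rw [map_add, hy', hz']⟩
    | single γ x =>
      refine ⟨(divPow K n (p ^ k • γ) * ((1 : T K n p k) : D K n)) ⊗ₜ[K] x, ?_, ?_⟩
      · rw [sumInduced_single]
        have h1 : (divPow K n (p ^ k • γ) * ((1 : T K n p k) : D K n)) ⊗ₜ[K] x
            = divPow K n (p ^ k • γ) • ((1 : D K n) ⊗ₜ[K] x) := by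
          rw [TensorProduct.smul_tmul', smul_eq_mul]
          rfl
        rw [h1]
        rfl
      · rw [tensorCoord_single, one_smul]
  rw [injective_iff_map_eq_zero]
  intro f hf
  obtain ⟨z, hz, rfl⟩ := h f
  rw [hf, Submodule.Quotient.mk_eq_zero] at hz
  exact tensorCoord_eq_zero N hz

theorem toInduced_injective : Function.Injective (toInduced (T K n p k) N) := by
  intro x y h
  have h1 := sumInduced_injective (K := K) (n := n) (p := p) (k := k) N
    (a₁ := Finsupp.single 0 x) (a₂ := Finsupp.single 0 y) (by
    rw [sumInduced_single, sumInduced_single, h])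
  exact Finsupp.single_injective 0 h1

/-- The filtered expansion of operators in `F_i`, applied to `1 ⊗ x`: the coefficients in `T_k` pass
through the tensor product and act on `x`. -/
theorem canonicalFiltration_smul_map_toInduced (W : Submodule K N) (i : ℕ) :
    canonicalFiltration K n i • W.map (toInduced (T K n p k) N)
      = (gradedFamilies p k N W i).map (sumInduced p k N) := by
  refine le_antisymm ?_ ?_
  · rw [Submodule.smul_le]
    rintro a ha _ ⟨x, hx, rfl⟩
    obtain ⟨t, rfl, ht⟩ := exists_sumDivPow_eq (p := p) k ha
    refine ⟨t.mapRange (fun s => s • x) (zero_smul _ x), (mem_gradedFamilies N).2 fun γ => ?_, ?_⟩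
    · rw [Finsupp.mapRange_apply]
      exact ⟨Submodule.smul_mem_smul (mem_inducedFiltration_iff.2 (ht γ).1) hx, fun h => by
        rw [(ht γ).2 h, zero_smul]⟩
    · clear ha ht
      induction t using Finsupp.induction_linear with
      | zero => simp
      | add s t hs ht => rw [Finsupp.mapRange_add (fun a b => add_smul a b x), map_add, map_add,
          add_smul, hs, ht]
      | single γ t =>
        rw [Finsupp.mapRange_single, sumInduced_single, sumDivPow_single, toInduced_smul, mul_smul]
  · rintro _ ⟨f, hf, rfl⟩
    rw [SetLike.mem_coe, mem_gradedFamilies] at hf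
    have h1 : f = ∑ γ ∈ f.support, Finsupp.single γ (f γ) := (Finsupp.sum_single f).symm
    rw [h1, map_sum]
    refine sum_mem fun γ hγ => ?_
    have hle : p ^ k * γ.degree ≤ i := by
      by_contra h
      exact Finsupp.mem_support_iff.1 hγ ((hf γ).2 (by omega))
    rw [sumInduced_single]
    have h2 := (hf γ).1
    generalize f γ = m at h2
    induction h2 using Submodule.smul_induction_on' with
    | smul t ht x hx =>
      rw [toInduced_smul, ← mul_smul]
      refine Submodule.smul_mem_smul ?_ ⟨x, hx, rfl⟩
      have h3 := mul_mem_canonicalFiltration (divPow_mem_canonicalFiltration (K := K) (p ^ k • γ)) ht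
      rwa [map_nsmul, smul_eq_mul, Nat.add_sub_cancel' hle] at h3
    | add x _ y _ hx hy => rw [map_add, smul_add]; exact add_mem hx hy

theorem ser_hilb_map_toInduced (W : Submodule K N) [FiniteDimensional K W] :
    (1 - PowerSeries.X ^ p ^ k) ^ n * ser (hilb (A := D K n) (canonicalFiltration K n)
        (W.map (toInduced (T K n p k) N)))
      = ser (hilb (A := T K n p k) (inducedFiltration K n p k) W) := by
  have hq : 0 < p ^ k := pow_pos (Fact.out : p.Prime).pos k
  have h1 : hilb (A := D K n) (canonicalFiltration K n) (W.map (toInduced (T K n p k) N))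
      = scaledSum hq (hilb (A := T K n p k) (inducedFiltration K n p k) W)
        (Finset.univ : Finset (Fin n)) := by
    funext i
    rw [hilb, canonicalFiltration_smul_map_toInduced,
      ← LinearEquiv.finrank_eq (Submodule.equivMapOfInjective _ (sumInduced_injective N) _),
      finrank_gradedFamilies]
  have h2 := one_sub_X_pow_mul_ser_scaledSum hq
    (hilb (A := T K n p k) (inducedFiltration K n p k) W) (Finset.univ : Finset (Fin n))
  rwa [Finset.card_univ, Fintype.card_fin, ← h1] at h2

end InducedT

/-! ### Presentations over `T_k` -/

section Presentation

variable {K : Type u} [Field K] {n : ℕ} {p : ℕ} {k : ℕ} {r : ℕ}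

variable (K n p k r) in
/-- The inclusion of the free modules of rank `r`. -/
def inclFree : (Fin r → T K n p k) →ₗ[T K n p k] (Fin r → D K n) where
  toFun v i := (v i : D K n)
  map_add' _ _ := rfl
  map_smul' _ _ := rfl

/-- The `T_k`-module with generators `1, …, r` and relations `S`. -/
abbrev Presented (S : Set (Fin r → T K n p k)) : Type u :=
  (Fin r → T K n p k) ⧸ Submodule.span (T K n p k) S

/-- The `D`-module with generators `1, …, r` and relations `S`. -/
abbrev PresentedD (S : Set (Fin r → T K n p k)) : Type u :=
  (Fin r → D K n) ⧸ Submodule.span (D K n) (inclFree K n p k r '' S)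

variable (S : Set (Fin r → T K n p k))

/-- The generators of a presented module. -/
def presentedGen (i : Fin r) : Presented S := Submodule.Quotient.mk (Pi.single i 1)

/-- The generators of a presented module. -/
def presentedDGen (i : Fin r) : PresentedD S := Submodule.Quotient.mk (Pi.single i 1)

theorem mk_eq_sum_presentedGen (v : Fin r → T K n p k) :
    (Submodule.Quotient.mk v : Presented S) = ∑ i, v i • presentedGen S i := by
  conv_lhs => rw [pi_eq_sum_univ' v]
  rw [← Submodule.mkQ_apply, map_sum]
  rfl

theorem mk_eq_sum_presentedDGen (v : Fin r → D K n) :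
    (Submodule.Quotient.mk v : PresentedD S) = ∑ i, v i • presentedDGen S i := by
  conv_lhs => rw [pi_eq_sum_univ' v]
  rw [← Submodule.mkQ_apply, map_sum]
  rfl

theorem linearCombination_inclFree (v : Fin r → T K n p k) :
    Fintype.linearCombination (D K n)
      (fun i => toInduced (T K n p k) (Presented S) (presentedGen S i)) (inclFree K n p k r v)
      = toInduced (T K n p k) (Presented S) (Submodule.Quotient.mk v) := by
  rw [Fintype.linearCombination_apply, mk_eq_sum_presentedGen, map_sum]
  refine Finset.sum_congr rfl fun i _ => ?_
  rw [toInduced_smul]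
  rfl

/-- The map from the presented `D`-module to the induced module. -/
def presentedToInduced : PresentedD S →ₗ[D K n] Induced (T K n p k) (Presented S) :=
  Submodule.liftQ _ (Fintype.linearCombination (D K n)
    fun i => toInduced (T K n p k) (Presented S) (presentedGen S i)) (by
      rw [Submodule.span_le]
      rintro _ ⟨v, hv, rfl⟩
      rw [SetLike.mem_coe, LinearMap.mem_ker, linearCombination_inclFree,
        (Submodule.Quotient.mk_eq_zero _).2 (Submodule.subset_span hv), map_zero])

/-- The map of presented modules induced by the inclusion of `T_k` in `D`. -/
def presentedIncl : Presented S →ₗ[T K n p k] PresentedD S :=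
  Submodule.liftQ _ (((Submodule.mkQ (Submodule.span (D K n)
    (inclFree K n p k r '' S))).restrictScalars (T K n p k)).comp (inclFree K n p k r)) (by
      rw [Submodule.span_le]
      intro v hv
      rw [SetLike.mem_coe, LinearMap.mem_ker]
      exact (Submodule.Quotient.mk_eq_zero _).2 (Submodule.subset_span ⟨v, hv, rfl⟩))

/-- The map from the induced module to the presented `D`-module. -/
def inducedToPresented : Induced (T K n p k) (Presented S) →ₗ[D K n] PresentedD S :=
  Submodule.liftQ _ (TensorProduct.AlgebraTensorModule.lift
    (LinearMap.toSpanSingleton (D K n) _ ((presentedIncl S).restrictScalars K))) (by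
      rw [balancedRel, Submodule.span_le]
      rintro _ ⟨a, b, x, rfl⟩
      rw [SetLike.mem_coe, LinearMap.mem_ker, map_sub, sub_eq_zero]
      change (a * (b : D K n)) • presentedIncl S x = a • presentedIncl S (b • x)
      rw [map_smul, mul_smul]
      rfl)

theorem inducedToPresented_toInduced (x : Presented S) :
    inducedToPresented S (toInduced (T K n p k) (Presented S) x) = presentedIncl S x :=
  one_smul (D K n) (presentedIncl S x)

theorem presentedIncl_gen (i : Fin r) : presentedIncl S (presentedGen S i) = presentedDGen S i := by
  change Submodule.Quotient.mk (inclFree K n p k r (Pi.single i 1)) = Submodule.Quotient.mk _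
  congr 1
  funext l
  change ((Pi.single i (1 : T K n p k) : Fin r → T K n p k) l : D K n) = _
  by_cases h : l = i
  · subst h
    simp
  · simp [h]

theorem presentedToInduced_gen (i : Fin r) : presentedToInduced S (presentedDGen S i)
    = toInduced (T K n p k) (Presented S) (presentedGen S i) := by
  change Fintype.linearCombination (D K n) _ (Pi.single i 1) = _
  rw [Fintype.linearCombination_apply_single, one_smul]

theorem toInduced_mem_span (x : Presented S) : toInduced (T K n p k) (Presented S) x ∈
    Submodule.span (D K n) (Set.range fun i =>
      toInduced (T K n p k) (Presented S) (presentedGen S i)) := by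
  obtain ⟨v, rfl⟩ := Submodule.Quotient.mk_surjective _ x
  rw [mk_eq_sum_presentedGen, map_sum]
  refine sum_mem fun i _ => ?_
  rw [toInduced_smul]
  exact Submodule.smul_mem _ _ (Submodule.subset_span ⟨i, rfl⟩)

theorem span_toInduced (N : Type w) [AddCommGroup N] [Module K N] [Module (T K n p k) N] :
    Submodule.span (D K n) (Set.range (toInduced (T K n p k) N)) = ⊤ := by
  rw [eq_top_iff]
  rintro ⟨z⟩ -
  change Submodule.Quotient.mk z ∈ _
  induction z using TensorProduct.induction_on with
  | zero => exact zero_mem _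
  | add y z hy hz => exact add_mem hy hz
  | tmul a x =>
    have h2 : a ⊗ₜ[K] x = a • ((1 : D K n) ⊗ₜ[K] x) := by
      rw [TensorProduct.smul_tmul', smul_eq_mul, mul_one]
    rw [h2, Submodule.Quotient.mk_smul]
    exact Submodule.smul_mem _ a (Submodule.subset_span ⟨x, rfl⟩)

/-- Induction is compatible with presentations. -/
def presentedEquiv : PresentedD S ≃ₗ[D K n] Induced (T K n p k) (Presented S) :=
  LinearEquiv.ofLinearMap (presentedToInduced S) (inducedToPresented S) (by
    have h : Submodule.span (D K n) (Set.range fun i =>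
        toInduced (T K n p k) (Presented S) (presentedGen S i)) = ⊤ := by
      rw [eq_top_iff, ← span_toInduced, Submodule.span_le]
      rintro _ ⟨x, rfl⟩
      exact toInduced_mem_span S x
    refine LinearMap.ext_on h ?_
    rintro _ ⟨i, rfl⟩
    rw [LinearMap.comp_apply, inducedToPresented_toInduced, presentedIncl_gen,
      presentedToInduced_gen]
    rfl) (by
    have h : Submodule.span (D K n) (Set.range (presentedDGen S)) = ⊤ := by
      rw [eq_top_iff]
      intro x _
      obtain ⟨v, rfl⟩ := Submodule.Quotient.mk_surjective _ x
      rw [mk_eq_sum_presentedDGen]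
      exact sum_mem fun i _ => Submodule.smul_mem _ _ (Submodule.subset_span ⟨i, rfl⟩)
    refine LinearMap.ext_on h ?_
    rintro _ ⟨i, rfl⟩
    rw [LinearMap.comp_apply, presentedToInduced_gen, inducedToPresented_toInduced,
      presentedIncl_gen]
    rfl)

theorem presentedEquiv_gen (i : Fin r) : presentedEquiv S (presentedDGen S i)
    = toInduced (T K n p k) (Presented S) (presentedGen S i) := presentedToInduced_gen S i

/-- The span of the generators of a presented module. -/
def presentedSpan : Submodule K (Presented S) := Submodule.span K (Set.range (presentedGen S))

theorem isGenerating_presentedSpan : IsGenerating (T K n p k) (presentedSpan S) := by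
  refine ⟨FiniteDimensional.span_of_finite K (Set.finite_range _), ?_⟩
  rw [eq_top_iff]
  intro x _
  obtain ⟨v, rfl⟩ := Submodule.Quotient.mk_surjective _ x
  rw [mk_eq_sum_presentedGen]
  exact sum_mem fun i _ => Submodule.smul_mem _ _ (Submodule.subset_span
    (Submodule.subset_span ⟨i, rfl⟩))

end Presentation

/-! ### Descent of finite presentations to some $T_k$ -/

section Existence

variable {K : Type u} [Field K] {n : ℕ} (p : ℕ) [Fact p.Prime]
variable {M : Type v} [AddCommGroup M] [Module K M] [Module (D K n) M] [IsScalarTower K (D K n) M]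

theorem exists_forall_mem_T (s : Finset (D K n)) : ∃ k, ∀ d ∈ s, d ∈ T K n p k := by
  choose f hf using exists_mem_T (K := K) (n := n) (p := p)
  exact ⟨s.sup f, fun d hd => mem_T_mono (Finset.le_sup hd) (hf d)⟩

/-- The generators are a basis of `W`, and the finitely many entries of the finitely many relations
lie in one `T_k`. Keeping track of `W` matters: it shows that every generating subspace of `M` comes
from a `T_k`-module, for a `k` depending on `W`. -/
theorem exists_presentation [Module.FinitePresentation (D K n) M] {W : Submodule K M}
    (hW : IsGenerating (D K n) W) :
    ∃ (k r : ℕ) (S : Set (Fin r → T K n p k))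
      (e : M ≃ₗ[D K n] Induced (T K n p k) (Presented S)),
      W.map (e.restrictScalars K).toLinearMap
        = (presentedSpan S).map (toInduced (T K n p k) (Presented S)) := by
  have := hW.1
  set r := Module.finrank K W with hr
  set b := Module.finBasis K W with hb
  set g : (Fin r → D K n) →ₗ[D K n] M :=
    Fintype.linearCombination (D K n) fun i => (b i : M) with hg
  have hbW : W = Submodule.span K (Set.range fun i => (b i : M)) := by
    have h1 := congrArg (Submodule.map W.subtype) b.span_eq
    rw [Submodule.map_span, ← Set.range_comp, Submodule.map_top, Submodule.range_subtype] at h1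
    exact h1.symm
  have hsurj : Function.Surjective g := by
    rw [← LinearMap.range_eq_top, hg, Fintype.range_linearCombination, eq_top_iff, ← hW.2,
      Submodule.span_le]
    intro w hw
    rw [hbW] at hw
    exact Submodule.span_subset_span K (D K n) _ hw
  obtain ⟨t, ht⟩ := Module.FinitePresentation.fg_ker g hsurj
  classical
  obtain ⟨k, hk⟩ := exists_forall_mem_T p (t.biUnion fun v => Finset.univ.image v)
  have hk' : ∀ v ∈ t, ∀ i, v i ∈ T K n p k := fun v hv i => hk _ (Finset.mem_biUnion.2
    ⟨v, hv, Finset.mem_image_of_mem _ (Finset.mem_univ i)⟩)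
  set S : Set (Fin r → T K n p k) := {v | inclFree K n p k r v ∈ t} with hS
  have hSt : inclFree K n p k r '' S = t := by
    ext v
    constructor
    · rintro ⟨v, hv, rfl⟩
      exact hv
    · intro hv
      exact ⟨fun i => ⟨v i, hk' v hv i⟩, hv, rfl⟩
  let e₁ : PresentedD S ≃ₗ[D K n] ((Fin r → D K n) ⧸ LinearMap.ker g) :=
    Submodule.quotEquivOfEq _ _ (by rw [hSt, ht])
  let e₂ := LinearMap.quotKerEquivOfSurjective g hsurj
  have he : ∀ i, (e₁.trans e₂) (presentedDGen S i) = b i := by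
    intro i
    change g (Pi.single i 1) = _
    rw [hg, Fintype.linearCombination_apply_single, one_smul]
  refine ⟨k, r, S, (e₁.trans e₂).symm.trans (presentedEquiv S), ?_⟩
  conv_lhs => rw [hbW]
  rw [presentedSpan, Submodule.map_span, Submodule.map_span, ← Set.range_comp, ← Set.range_comp]
  congr 2
  funext i
  change presentedEquiv S ((e₁.trans e₂).symm (b i)) = _
  rw [← he i, LinearEquiv.symm_apply_apply, presentedEquiv_gen]
  rfl

end Existence

/-! ### Dimension and multiplicity -/

theorem exists_isGenerating {K : Type u} [Field K] {A : Type v} [Ring A] [Algebra K A]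
    {M : Type w} [AddCommGroup M] [Module K M] [Module A M] [IsScalarTower K A M]
    [Module.Finite A M] : ∃ W : Submodule K M, IsGenerating A W := by
  obtain ⟨s, hs⟩ := Module.Finite.fg_top (R := A) (M := M)
  refine ⟨Submodule.span K (s : Set M), FiniteDimensional.span_finset K s, ?_⟩
  rw [Submodule.span_span_of_tower, hs]

section Transport

variable {K : Type u} [Field K] {A : Type v} [Ring A] [Algebra K A]
variable {M : Type w} [AddCommGroup M] [Module K M] [Module A M] [IsScalarTower K A M]
variable {M₂ : Type*} [AddCommGroup M₂] [Module K M₂] [Module A M₂] [IsScalarTower K A M₂]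

theorem smul_map_equiv (e : M ≃ₗ[A] M₂) (F : Submodule K A) (W : Submodule K M) :
    F • W.map (e.restrictScalars K).toLinearMap
      = (F • W).map (e.restrictScalars K).toLinearMap := by
  refine le_antisymm (Submodule.smul_le.2 ?_) ?_
  · rintro a ha _ ⟨w, hw, rfl⟩
    exact ⟨a • w, Submodule.smul_mem_smul ha hw, map_smul e a w⟩
  · rw [Submodule.map_le_iff_le_comap, Submodule.smul_le]
    intro a ha w hw
    change e (a • w) ∈ F • W.map (e.restrictScalars K).toLinearMap
    rw [map_smul]
    exact Submodule.smul_mem_smul ha ⟨w, hw, rfl⟩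

theorem hilb_map_equiv (e : M ≃ₗ[A] M₂) (F : ℕ → Submodule K A) (W : Submodule K M) :
    hilb F (W.map (e.restrictScalars K).toLinearMap) = hilb F W := by
  funext i
  rw [hilb, smul_map_equiv]
  exact LinearEquiv.finrank_map_eq (e.restrictScalars K) _

theorem IsGenerating.map_equiv {W : Submodule K M} (hW : IsGenerating A W) (e : M ≃ₗ[A] M₂) :
    IsGenerating A (W.map (e.restrictScalars K).toLinearMap) := by
  have := hW.1
  refine ⟨inferInstance, ?_⟩
  have h : ((W.map (e.restrictScalars K).toLinearMap : Submodule K M₂) : Set M₂) = e '' W := rfl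
  rw [h, ← LinearEquiv.coe_toLinearMap, Submodule.span_image, hW.2, Submodule.map_top,
    LinearEquiv.range]

end Transport

section Nontrivial

variable {K : Type u} [Field K] {n : ℕ} {p : ℕ}

theorem nontrivial_of_induced {k : ℕ} {N : Type w} [AddCommGroup N] [Module K N]
    [Module (T K n p k) N] [Nontrivial (Induced (T K n p k) N)] : Nontrivial N := by
  by_contra h
  rw [not_nontrivial_iff_subsingleton] at h
  have h1 := span_toInduced (K := K) (n := n) (p := p) (k := k) N
  have h2 : Set.range (toInduced (T K n p k) N) = {0} := by
    ext x
    constructor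
    · rintro ⟨y, rfl⟩
      rw [Subsingleton.elim y 0, map_zero]
      rfl
    · rintro rfl
      exact ⟨0, map_zero _⟩
  rw [h2, Submodule.span_singleton_eq_bot.2 rfl] at h1
  exact bot_ne_top h1

end Nontrivial

/-! ### Invariants of modules induced from $T_k$ -/

section Main

variable {K : Type u} [Field K] {n : ℕ} {p : ℕ} [Fact p.Prime] [CharP K p]

/-- The Hilbert function of `T_k`-modules and of the induced modules. -/
theorem exists_series_induced {k : ℕ} {N : Type w} [AddCommGroup N] [Module K N]
    [Module (T K n p k) N] [IsScalarTower K (T K n p k) N] [Nontrivial N] {W : Submodule K N}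
    (hW : IsGenerating (T K n p k) W) :
    ∃ (d e : ℕ), d ≤ n ∧ 0 < e ∧
      Asymp (hilb (A := T K n p k) (inducedFiltration K n p k) W) d ((e : ℝ) / d !) ∧
      (∃ h : ℚ[X], h.degree = d ∧ h.leadingCoeff = (e : ℚ) / d ! ∧
        ∀ᶠ i : ℕ in atTop, (hilb (A := T K n p k) (inducedFiltration K n p k) W i : ℚ)
          = h.eval (i : ℚ)) ∧
      IsAlmostPolynomial (hilb (A := D K n) (canonicalFiltration K n)
          (W.map (toInduced (T K n p k) N))) (p ^ k) (n + d)
        ((e : ℚ) / ((p : ℚ) ^ (k * n) * (n + d)!))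
        {c | ∃ z : ℤ, c = (z : ℚ) / ((p : ℚ) ^ (k * (n + d)) * (n + d)!)} ∧
      ∃ r : RatFunc ℚ, IsPoincareSeries (hilb (A := D K n) (canonicalFiltration K n)
          (W.map (toInduced (T K n p k) N))) r ∧ poleOrderAtOne r = n + d + 1 ∧
        ((1 - RatFunc.X) ^ (n + d + 1) * r).eval (RingHom.id ℚ) 1
          = (e : ℚ) / (p : ℚ) ^ (k * n) := by
  have := hW.1
  have hq : 0 < p ^ k := pow_pos (Fact.out : p.Prime).pos k
  obtain ⟨d, H, hd, hH, hH1⟩ := exists_series_hilb_inducedFiltration W hW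
  -- An almost polynomial of period `1` is a polynomial for large `i`.
  have h1 := isAlmostPolynomial_of_mixed_series (q := 1) (n := 0) (d := d) one_pos (by
    rw [pow_zero, mul_one]
    exact hH) hH1
  rw [zero_add] at h1
  have h2 := h1.asymp one_pos
  -- `H(1)` is `d!` times the leading coefficient of a Hilbert function, hence positive.
  obtain ⟨e, he⟩ : ∃ e : ℕ, (e : ℤ) = H.eval 1 := by
    refine ⟨(H.eval 1).toNat, Int.toNat_of_nonneg ?_⟩
    have h3 := h2.1
    push_cast at h3
    rw [pow_zero, one_mul] at h3
    have h4 : (0 : ℝ) < d ! := by exact_mod_cast Nat.factorial_pos d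
    have h5 : (0 : ℝ) < ((H.eval 1 : ℤ) : ℝ) := by
      rwa [div_pos_iff_of_pos_right h4] at h3
    exact_mod_cast h5.le
  have he0 : 0 < e := by
    rcases Nat.eq_zero_or_pos e with h | h
    · rw [h] at he
      exact absurd he.symm hH1
    · exact h
  have hD : (1 - PowerSeries.X) ^ (d + 1) * (1 - PowerSeries.X ^ p ^ k) ^ n
      * ser (hilb (A := D K n) (canonicalFiltration K n) (W.map (toInduced (T K n p k) N)))
      = (H : PowerSeries ℤ) := by
    rw [mul_assoc, ser_hilb_map_toInduced, hH]
  have hcast : ∀ m : ℕ, ((p ^ k : ℕ) : ℚ) ^ m = (p : ℚ) ^ (k * m) := fun m => by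
    rw [Nat.cast_pow, pow_mul]
  refine ⟨d, e, hd, he0, ?_, ?_, ?_, ?_⟩
  · rw [← he] at h2
    simpa using h2
  · obtain ⟨q, hq, hq'⟩ := h1
    refine ⟨q 0, (hq' 0).1, ?_, ?_⟩
    · rw [(hq' 0).2.1, ← he]
      simp
    · filter_upwards [hq] with i hi
      rw [hi, Subsingleton.elim (i : ZMod 1) 0]
  · have h6 := isAlmostPolynomial_of_mixed_series hq hD hH1
    rwa [← he, hcast, hcast, Int.cast_natCast] at h6
  · obtain ⟨r, hr, hr', hr''⟩ := exists_poincareSeries hq hD hH1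
    refine ⟨r, hr, hr', ?_⟩
    rw [hr'', ← he, hcast, Int.cast_natCast]

variable {M : Type v} [AddCommGroup M] [Module K M] [Module (D K n) M] [IsScalarTower K (D K n) M]

/-- Both changes, of the filtration and of the generating subspace, cost only an affine substitution
in `i`, to which `growth` is insensitive. -/
theorem growth_hilb_eq {W : Submodule K M} (hW : IsGenerating (D K n) W) {m : ℕ} {c : ℝ}
    (hm : Asymp (hilb (A := D K n) (canonicalFiltration K n) W) m c) {F : ℕ → Submodule K (D K n)}
    (hF : IsStandardType K n F) {W' : Submodule K M} (hW' : IsGenerating (D K n) W') :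
    growth (hilb (A := D K n) F W') = m := by
  have hC := isFiniteFiltration_canonicalFiltration K n
  have := hW.1
  have := hW'.1
  have := hF.1.finite
  obtain ⟨b, hb⟩ := hC.exists_hilb_le hW W'
  obtain ⟨b', hb'⟩ := hC.exists_hilb_le hW' W
  obtain ⟨x, y, z, t, hx, hz, hE⟩ := hF.2
  refine le_antisymm (hm.growth_le (a := x) (b := y + b) hx ?_)
    (hm.le_growth (a := z) (b := z * b' + t) hz ?_)
  · filter_upwards [hE] with i hi
    rw [← add_assoc]
    exact (hilb_mono_of_le (Submodule.smul_mono_left hi.1)).trans (hb _)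
  · filter_upwards [(tendsto_add_atTop_nat b').eventually hE] with i hi
    refine (hb' i).trans (hilb_mono_of_le (Submodule.smul_mono_left ?_))
    rw [← add_assoc, ← mul_add]
    exact hi.2

theorem isStandardType_canonicalFiltration : IsStandardType K n (canonicalFiltration K n) :=
  ⟨isFiniteFiltration_canonicalFiltration K n, 1, 0, 1, 0, one_pos, one_pos,
    Eventually.of_forall fun i => by simp⟩

theorem Dim_eq {W : Submodule K M} (hW : IsGenerating (D K n) W) {m : ℕ} {c : ℝ}
    (hm : Asymp (hilb (A := D K n) (canonicalFiltration K n) W) m c) : Dim K n M = m := by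
  refine le_antisymm (iInf₂_le_of_le W hW hm.growth_eq.le) (le_iInf₂ fun W' hW' => ?_)
  rw [growth_hilb_eq hW hm isStandardType_canonicalFiltration hW']

/-- Each generating subspace `W'` has its own presentation over some `T_k`, which makes its Hilbert
function an almost polynomial of some period. Comparison with `W` by shifts then identifies degree
and leading coefficient, whatever the period. -/
theorem hasMultiplicity_of_asymp (p : ℕ) [Fact p.Prime] [CharP K p] [Nontrivial M] [Module.FinitePresentation (D K n) M]
    {W : Submodule K M} (hW : IsGenerating (D K n) W) {m : ℕ} {c : ℚ}
    (hm : Asymp (hilb (A := D K n) (canonicalFiltration K n) W) m c) :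
    HasMultiplicity (A := D K n) M (canonicalFiltration K n) (m ! * c) := by
  have hC := isFiniteFiltration_canonicalFiltration K n
  have := hW.1
  intro W' hW'
  have := hW'.1
  obtain ⟨k, r, S, e, he⟩ := exists_presentation p hW'
  have : Nontrivial (Induced (T K n p k) (Presented S)) := e.symm.toEquiv.nontrivial
  have : Nontrivial (Presented S) := nontrivial_of_induced (K := K) (n := n) (p := p) (k := k)
  have hq : 0 < p ^ k := pow_pos (Fact.out : p.Prime).pos k
  obtain ⟨d, e', -, -, -, -, h1, -⟩ := exists_series_induced (isGenerating_presentedSpan S)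
  rw [← he, hilb_map_equiv] at h1
  obtain ⟨b, hb⟩ := hC.exists_hilb_le hW W'
  obtain ⟨b', hb'⟩ := hC.exists_hilb_le hW' W
  obtain ⟨h2, h3⟩ := (h1.asymp hq).eq_of_le hm hb hb'
  have h4 : (e' : ℚ) / ((p : ℚ) ^ (k * n) * (n + d)!) = c := by exact_mod_cast h3
  rw [h2] at h1 h4
  rw [h4] at h1
  obtain ⟨q, hq1, hq2⟩ := h1
  exact ⟨p ^ k, m, c, hq, ⟨q, hq1, fun s => ⟨(hq2 s).1, (hq2 s).2.1, fun _ => trivial⟩⟩, rfl⟩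

theorem dimension_of_induced [Nontrivial M] [Module.FinitePresentation (D K n) M] (k : ℕ)
    (M' : Type w) [AddCommGroup M'] [Module K M']
    [Module (T K n p k) M'] [IsScalarTower K (T K n p k) M'] [Module.Finite (T K n p k) M']
    (iso : M ≃ₗ[D K n] Induced (T K n p k) M') :
    ∃ d e' : ℕ,
      gkDim K (T K n p k) M' = d ∧ d ≤ n ∧
      Dim K n M = ((n + d : ℕ) : ℝ≥0∞) ∧
      (∀ F, IsStandardType K n F → ∀ N₀ : Submodule K M, IsGenerating (D K n) N₀ →
        growth (hilb (A := D K n) F N₀) = Dim K n M) ∧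
      HasMultiplicity (A := D K n) M (canonicalFiltration K n) ((e' : ℚ) / (p : ℚ) ^ (k * n)) ∧
      ∀ M₀' : Submodule K M', IsGenerating (T K n p k) M₀' →
        (∃ h : ℚ[X], h.degree = d ∧ h.leadingCoeff = (e' : ℚ) / d ! ∧
          ∀ᶠ i : ℕ in atTop, (hilb (A := T K n p k) (inducedFiltration K n p k) M₀' i : ℚ) = h.eval (i : ℚ)) ∧
        ∃ M₀ : Submodule K M,
          M₀ = M₀'.map ((iso.symm.restrictScalars K).toLinearMap ∘ₗ
            toInduced (T K n p k) M') ∧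
          IsGenerating (D K n) M₀ ∧
          IsAlmostPolynomial (hilb (A := D K n) (canonicalFiltration K n) M₀) (p ^ k) (n + d)
            ((e' : ℚ) / ((p : ℚ) ^ (k * n) * (n + d)!))
            {c | ∃ z : ℤ, c = (z : ℚ) / ((p : ℚ) ^ (k * (n + d)) * (n + d)!)} ∧
          ∃ r : RatFunc ℚ, IsPoincareSeries (hilb (A := D K n) (canonicalFiltration K n) M₀) r ∧
            Dim K n M + 1 = (poleOrderAtOne r : ℝ≥0∞) ∧
            ((1 - RatFunc.X) ^ (n + d + 1) * r).eval (RingHom.id ℚ) 1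
              = (e' : ℚ) / (p : ℚ) ^ (k * n) := by
  have hF := isFiniteFiltration_inducedFiltration K n p k
  have : Nontrivial (Induced (T K n p k) M') := iso.symm.toEquiv.nontrivial
  have : Nontrivial M' := nontrivial_of_induced (K := K) (n := n) (p := p) (k := k)
  have hq : 0 < p ^ k := pow_pos (Fact.out : p.Prime).pos k
  obtain ⟨W, hW⟩ := exists_isGenerating (K := K) (A := T K n p k) (M := M')
  have := hW.1
  obtain ⟨d, e, hd, he, hasy, -, hap, -⟩ := exists_series_induced hW
  have hmap : ∀ V : Submodule K M', V.map ((iso.symm.restrictScalars K).toLinearMap ∘ₗ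
      toInduced (T K n p k) M') = (V.map (toInduced (T K n p k) M')).map
        (iso.symm.restrictScalars K).toLinearMap := fun V => Submodule.map_comp _ _ _
  have hgen : ∀ V : Submodule K M', IsGenerating (T K n p k) V → IsGenerating (D K n)
      (V.map ((iso.symm.restrictScalars K).toLinearMap ∘ₗ toInduced (T K n p k) M')) := by
    intro V hV
    rw [hmap]
    exact (isGenerating_map_toInduced M' hV).map_equiv iso.symm
  have hhilb : ∀ V : Submodule K M', hilb (A := D K n) (canonicalFiltration K n)
      (V.map ((iso.symm.restrictScalars K).toLinearMap ∘ₗ toInduced (T K n p k) M'))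
      = hilb (A := D K n) (canonicalFiltration K n) (V.map (toInduced (T K n p k) M')) := by
    intro V
    rw [hmap, hilb_map_equiv]
  have hasyD := hap.asymp hq
  rw [← hhilb] at hasyD
  have hDim := Dim_eq (hgen W hW) hasyD
  refine ⟨d, e, gkDim_eq hW hasy, hd, hDim, fun F hF' N₀ hN₀ => ?_, ?_, fun V hV => ?_⟩
  · rw [hDim]
    exact growth_hilb_eq (hgen W hW) hasyD hF' hN₀
  · have h1 := hasMultiplicity_of_asymp (p := p) (hgen W hW) hasyD
    have h2 : ((n + d)! : ℚ) * ((e : ℚ) / ((p : ℚ) ^ (k * n) * (n + d)!))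
        = (e : ℚ) / (p : ℚ) ^ (k * n) := by
      have := Nat.factorial_ne_zero (n + d)
      have hp : (p : ℚ) ≠ 0 := by exact_mod_cast (Fact.out : p.Prime).ne_zero
      field_simp
    rwa [h2] at h1
  · have := hV.1
    obtain ⟨d', e', -, -, hasy', hpoly, hap', r, hr, hr', hr''⟩ := exists_series_induced hV
    obtain ⟨b, hb⟩ := hF.exists_hilb_le hW V
    obtain ⟨b', hb'⟩ := hF.exists_hilb_le hV W
    -- The numbers `d` and `e` were fixed by one auxiliary subspace `W`; those found for `V`
    -- coincide with them by comparison of Hilbert functions over `T_k`.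
    obtain ⟨rfl, h2⟩ := hasy'.eq_of_le hasy hb hb'
    obtain rfl : e' = e := by
      have h3 : (d' ! : ℝ) ≠ 0 := by exact_mod_cast Nat.factorial_ne_zero d'
      exact_mod_cast (div_left_inj' h3).1 h2
    refine ⟨hpoly, _, rfl, hgen V hV, ?_, r, ?_, ?_, hr''⟩
    · rwa [hhilb]
    · rwa [hhilb]
    · rw [hDim, hr']
      norm_cast

end Main

/-! ### Modules of given dimension -/

section Examples

variable {K : Type u} [Field K] {n : ℕ} {p : ℕ}

variable (K n p) in
/-- The variables of index at least `j`, as relations between one generator. -/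
def tailRel (j : ℕ) : Set (Fin 1 → T K n p 0) :=
  {v | ∃ l : Fin n, j ≤ l ∧ v = fun _ => polyInclT K n p 0 (MvPolynomial.X l)}

/-- Exponents supported in the first `j` variables. -/
def headExp {j i : ℕ} (_hj : j ≤ n) (a : Fin j → Fin (i + 1)) : Fin n →₀ ℕ :=
  Finsupp.equivFunOnFinite.symm fun l => if h : (l : ℕ) < j then a ⟨l, h⟩ else 0

theorem headExp_apply_of_lt {j i : ℕ} (hj : j ≤ n) (a : Fin j → Fin (i + 1)) {l : Fin n}
    (h : (l : ℕ) < j) : headExp hj a l = a ⟨l, h⟩ := dif_pos h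

theorem headExp_apply_of_le {j i : ℕ} (hj : j ≤ n) (a : Fin j → Fin (i + 1)) {l : Fin n}
    (h : j ≤ (l : ℕ)) : headExp hj a l = 0 := dif_neg (by omega)

theorem headExp_injective {j i : ℕ} (hj : j ≤ n) :
    Function.Injective (headExp (i := i) hj) := by
  intro a b h
  funext l
  have h1 := DFunLike.congr_fun h (⟨l, l.2.trans_le hj⟩ : Fin n)
  rw [headExp_apply_of_lt hj a l.2, headExp_apply_of_lt hj b l.2] at h1
  exact Fin.ext h1

theorem degree_headExp_le {j i : ℕ} (hj : j ≤ n) (a : Fin j → Fin (i + 1)) :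
    (headExp hj a).degree ≤ j * i := by
  rw [Finsupp.degree_eq_sum]
  have h1 : ∀ l : Fin n, headExp hj a l ≤ if (l : ℕ) < j then i else 0 := by
    intro l
    split_ifs with h
    · rw [headExp_apply_of_lt hj a h]
      exact Nat.lt_succ_iff.1 (a _).2
    · rw [headExp_apply_of_le hj a (not_lt.1 h)]
  refine (Finset.sum_le_sum fun l _ => h1 l).trans ?_
  rw [← Finset.sum_filter, Finset.sum_const, smul_eq_mul]
  refine Nat.mul_le_mul_right i ?_
  have h2 : (Finset.univ.filter fun l : Fin n => (l : ℕ) < j).card ≤ (Finset.range j).card :=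
    Finset.card_le_card_of_injOn (fun l => (l : ℕ)) (fun l hl => by simpa using hl)
      (fun a _ b _ h => Fin.ext h)
  simpa using h2

theorem exists_headExp_eq {j i : ℕ} (hj : j ≤ n) {α : Fin n →₀ ℕ} (hα : α.degree ≤ i)
    (h : ∀ l : Fin n, j ≤ l → α l = 0) : ∃ a : Fin j → Fin (i + 1), headExp hj a = α := by
  refine ⟨fun l => ⟨α ⟨l, l.2.trans_le hj⟩,
    Nat.lt_succ_iff.2 ((Finsupp.le_degree _ α).trans hα)⟩, Finsupp.ext fun l => ?_⟩
  by_cases hl : (l : ℕ) < j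
  · rw [headExp_apply_of_lt hj _ hl]
  · rw [headExp_apply_of_le hj _ (not_lt.1 hl), h l (not_lt.1 hl)]

/-- The monomials applied to the generator. -/
def monomialGen (j : ℕ) (α : Fin n →₀ ℕ) : Presented (tailRel K n p j) :=
  polyInclT K n p 0 (MvPolynomial.monomial α 1) • presentedGen (tailRel K n p j) 0

theorem monomialGen_eq_zero {j : ℕ} {α : Fin n →₀ ℕ} {l : Fin n} (hl : j ≤ l) (h : α l ≠ 0) :
    monomialGen (K := K) (p := p) j α = 0 := by
  have hb : α - Finsupp.single l 1 + Finsupp.single l 1 = α :=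
    tsub_add_cancel_of_le (Finsupp.single_le_iff.2 (Nat.one_le_iff_ne_zero.2 h))
  have h1 : (MvPolynomial.monomial α 1 : P K n)
      = MvPolynomial.monomial (α - Finsupp.single l 1) 1 * MvPolynomial.X l := by
    rw [MvPolynomial.X, MvPolynomial.monomial_mul, one_mul, hb]
  have h2 : polyInclT K n p 0 (MvPolynomial.X l) • presentedGen (tailRel K n p j) 0 = 0 := by
    rw [presentedGen, ← Submodule.Quotient.mk_smul]
    refine (Submodule.Quotient.mk_eq_zero _).2 (Submodule.subset_span ⟨l, hl, ?_⟩)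
    funext i
    rw [Subsingleton.elim i 0]
    simp
  rw [monomialGen, h1, map_mul, mul_smul, h2, smul_zero]

theorem finitePresentation_presentedD {k r : ℕ} {S : Set (Fin r → T K n p k)} (hS : S.Finite) :
    Module.FinitePresentation (D K n) (PresentedD S) := by
  refine Module.finitePresentation_of_surjective (Submodule.mkQ _) (Submodule.mkQ_surjective _) ?_
  rw [Submodule.ker_mkQ]
  exact Submodule.fg_span (hS.image _)

theorem tailRel_finite (j : ℕ) : (tailRel K n p j).Finite := by
  refine (Set.finite_range fun (l : Fin n) (_ : Fin 1) =>
    polyInclT K n p 0 (MvPolynomial.X l)).subset ?_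
  rintro _ ⟨l, -, rfl⟩
  exact ⟨l, rfl⟩

variable [Fact p.Prime] [CharP K p]

/-- For `k = 0` the condition `β j < p ^ 0` leaves only `β = 0`, so `T_0` is `P_n` with its degree
filtration. -/
theorem exists_polyInclT_eq {i : ℕ} {t : T K n p 0} (ht : t ∈ inducedFiltration K n p 0 i) :
    ∃ f ∈ polyDegreeLE K n i, polyInclT K n p 0 f = t := by
  rw [mem_inducedFiltration_iff] at ht
  have h : stdSpan K (expLT n (p ^ 0)) i ≤ (polyDegreeLE K n i).map
      (polyIncl K n).toLinearMap := by
    rw [stdSpan, Submodule.span_le]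
    rintro _ ⟨α, β, hβ, h, rfl⟩
    obtain rfl : β = 0 := Finsupp.ext fun l => by
      have := hβ l
      rw [pow_zero] at this
      simpa using this
    refine ⟨_, monomial_mem_polyDegreeLE (α := α) (by simpa using h), ?_⟩
    rw [divPow_zero, mul_one]
    rfl
  obtain ⟨f, hf, hft⟩ := h ht
  exact ⟨f, hf, Subtype.ext hft⟩

/-- Monomials involving a variable of index at least `j` vanish in the quotient; the others of
degree at most `i` have their exponents in a box of side `i + 1`. -/
theorem hilb_tail_le {j : ℕ} (hj : j ≤ n) (i : ℕ) :
    hilb (A := T K n p 0) (inducedFiltration K n p 0) (presentedSpan (tailRel K n p j)) i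
      ≤ (i + 1) ^ j := by
  have h : inducedFiltration K n p 0 i • presentedSpan (tailRel K n p j)
      ≤ Submodule.span K (Set.range fun a : Fin j → Fin (i + 1) =>
        monomialGen (K := K) (p := p) j (headExp hj a)) := by
    rw [Submodule.smul_le]
    intro t ht w hw
    obtain ⟨f, hf, rfl⟩ := exists_polyInclT_eq ht
    induction hw using Submodule.span_induction with
    | mem w hw =>
      obtain ⟨l, rfl⟩ := hw
      rw [Subsingleton.elim l 0]
      induction hf using Submodule.span_induction with
      | mem f hf =>
        obtain ⟨α, hα, rfl⟩ := hf
        change monomialGen j α ∈ _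
        by_cases hs : ∀ l : Fin n, j ≤ l → α l = 0
        · obtain ⟨a, rfl⟩ := exists_headExp_eq hj hα hs
          exact Submodule.subset_span ⟨a, rfl⟩
        · push Not at hs
          obtain ⟨l, hl, hl'⟩ := hs
          rw [monomialGen_eq_zero hl hl']
          exact zero_mem _
      | zero => rw [map_zero, zero_smul]; exact zero_mem _
      | add f g _ _ hf hg =>
        rw [map_add, add_smul]
        exact add_mem (hf (polyInclT_mem_inducedFiltration ‹_›))
          (hg (polyInclT_mem_inducedFiltration ‹_›))
      | smul c f _ hf =>
        rw [map_smul, smul_assoc]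
        exact Submodule.smul_mem _ _ (hf (polyInclT_mem_inducedFiltration ‹_›))
    | zero => rw [smul_zero]; exact zero_mem _
    | add x y _ _ hx hy => rw [smul_add]; exact add_mem hx hy
    | smul c x _ hx => rw [smul_comm]; exact Submodule.smul_mem _ _ hx
  have h2 : FiniteDimensional K ↥(Submodule.span K (Set.range fun a : Fin j → Fin (i + 1) =>
      monomialGen (K := K) (p := p) j (headExp hj a))) :=
    FiniteDimensional.span_of_finite K (Set.finite_range _)
  refine (Submodule.finrank_mono h).trans ((finrank_range_le_card _).trans ?_)
  simp

variable (K n) in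
/-- Setting the variables of index at least `j` to zero. -/
def truncVars (j : ℕ) : P K n →ₐ[K] P K n :=
  MvPolynomial.aeval fun l => if (l : ℕ) < j then MvPolynomial.X l else 0

theorem toEnd_var_mul_apply_one {t : D K n} (ht : t ∈ T K n p 0) (l : Fin n) :
    toEnd K n (t * var K n l) 1 = MvPolynomial.X l * toEnd K n t 1 := by
  have h := mul_var_pow_of_mem_T ht l
  rw [pow_zero, pow_one] at h
  rw [h]
  rfl

/-- The multiplier `t` is there for the induction over the span, whose scalars act on the left. On a
generator it is moved past the variable by commutativity of `T_0` with the variables. -/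
theorem truncVars_eq_zero {j : ℕ} {v : Fin 1 → T K n p 0}
    (hv : v ∈ Submodule.span (T K n p 0) (tailRel K n p j)) (t : T K n p 0) :
    truncVars K n j (toEnd K n (t * v 0 : D K n) 1) = 0 := by
  induction hv using Submodule.span_induction generalizing t with
  | mem v hv =>
    obtain ⟨l, hl, rfl⟩ := hv
    change truncVars K n j (toEnd K n (t * var K n l) 1) = 0
    rw [toEnd_var_mul_apply_one t.2, map_mul, truncVars, MvPolynomial.aeval_X,
      if_neg (not_lt.2 hl), zero_mul]
  | zero =>
    rw [Pi.zero_apply, ZeroMemClass.coe_zero, mul_zero, map_zero, LinearMap.zero_apply, map_zero]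
  | add x y _ _ hx hy =>
    rw [Pi.add_apply, Subalgebra.coe_add, mul_add, map_add, LinearMap.add_apply, map_add, hx, hy,
      add_zero]
  | smul s x _ hx =>
    have h := hx (t * s)
    rwa [Subalgebra.coe_mul, mul_assoc] at h

variable (K n p) in
/-- Evaluation at `1`, with the variables of index at least `j` set to zero. -/
def evalTail (j : ℕ) : Presented (tailRel K n p j) →ₗ[K] P K n :=
  (Submodule.liftQ ((Submodule.span (T K n p 0) (tailRel K n p j)).restrictScalars K)
    ((truncVars K n j).toLinearMap.comp ((LinearMap.applyₗ (1 : P K n)).comp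
      ((toEnd K n).toLinearMap.comp ((T K n p 0).val.toLinearMap.comp (LinearMap.proj 0))))) (by
      intro v hv
      have h := truncVars_eq_zero hv 1
      rw [Subalgebra.coe_one, one_mul] at h
      exact h)).comp
    (Submodule.Quotient.restrictScalarsEquiv K _).symm.toLinearMap

theorem evalTail_monomialGen {j i : ℕ} (hj : j ≤ n) (a : Fin j → Fin (i + 1)) :
    evalTail K n p j (monomialGen j (headExp hj a)) = MvPolynomial.monomial (headExp hj a) 1 := by
  have h1 : evalTail K n p j (monomialGen j (headExp hj a))
      = truncVars K n j (MvPolynomial.monomial (headExp hj a) 1 * 1) := by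
    rw [monomialGen, presentedGen, ← Submodule.Quotient.mk_smul]
    change truncVars K n j (toEnd K n ((polyInclT K n p 0 (MvPolynomial.monomial (headExp hj a) 1)
      * (Pi.single 0 1 : Fin 1 → T K n p 0) 0 : T K n p 0) : D K n) 1) = _
    rw [Pi.single_eq_same, mul_one]
    rfl
  rw [h1, mul_one, truncVars, MvPolynomial.aeval_monomial, map_one, one_mul,
    MvPolynomial.monomial_eq, map_one, one_mul]
  refine Finset.prod_congr rfl fun l hl => ?_
  have h : (l : ℕ) < j := by
    by_contra h
    exact Finsupp.mem_support_iff.1 hl (headExp_apply_of_le hj a (not_lt.1 h))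
  simp only [if_pos h]

/-- `evalTail` sends these elements to distinct monomials of `P_n`, so the quotient is no smaller
than expected. -/
theorem linearIndependent_monomialGen {j : ℕ} (hj : j ≤ n) (i : ℕ) :
    LinearIndependent K fun a : Fin j → Fin (i + 1) =>
      monomialGen (K := K) (p := p) j (headExp hj a) := by
  refine LinearIndependent.of_comp (evalTail K n p j) ?_
  have h := (MvPolynomial.basisMonomials (Fin n) K).linearIndependent.comp _
    (headExp_injective (i := i) hj)
  rw [MvPolynomial.coe_basisMonomials] at h
  have h2 : (evalTail K n p j ∘ fun a : Fin j → Fin (i + 1) => monomialGen j (headExp hj a))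
      = (fun s => MvPolynomial.monomial s 1) ∘ headExp hj :=
    funext fun a => evalTail_monomialGen hj a
  rw [h2]
  exact h

theorem le_hilb_tail {j : ℕ} (hj : j ≤ n) (i : ℕ) :
    (i + 1) ^ j ≤ hilb (A := T K n p 0) (inducedFiltration K n p 0)
      (presentedSpan (tailRel K n p j)) (j * i) := by
  have hW := (isGenerating_presentedSpan (tailRel K n p j)).1
  have h : Submodule.span K (Set.range fun a : Fin j → Fin (i + 1) =>
        monomialGen (K := K) (p := p) j (headExp hj a))
      ≤ inducedFiltration K n p 0 (j * i) • presentedSpan (tailRel K n p j) := by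
    rw [Submodule.span_le]
    rintro _ ⟨a, rfl⟩
    exact Submodule.smul_mem_smul
      (polyInclT_mem_inducedFiltration (monomial_mem_polyDegreeLE (degree_headExp_le hj a)))
      (Submodule.subset_span ⟨0, rfl⟩)
  refine le_trans (le_of_eq ?_) (Submodule.finrank_mono h)
  rw [finrank_span_eq_card (linearIndependent_monomialGen hj i)]
  simp

theorem nontrivial_presented_tailRel {j : ℕ} (hj : j ≤ n) :
    Nontrivial (Presented (tailRel K n p j)) :=
  nontrivial_of_ne _ _ ((linearIndependent_monomialGen hj 0).ne_zero fun _ => 0)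

theorem gkDim_presented_tailRel {j : ℕ} (hj : j ≤ n) :
    gkDim K (T K n p 0) (Presented (tailRel K n p j)) = j := by
  have := nontrivial_presented_tailRel (K := K) (p := p) hj
  have hW := isGenerating_presentedSpan (tailRel K n p j)
  have hWf := hW.1
  obtain ⟨d, e, -, -, hd, -⟩ := exists_series_induced hW
  rw [gkDim_eq hW hd, ← hd.growth_eq]
  -- The box of side `i + 1` lies in degrees at most `j * i`; the dilation `j + 1` is used so that
  -- it is positive even for `j = 0`.
  refine le_antisymm ((asymp_add_one_pow j).growth_le (a := 1) (b := 0) one_pos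
    (Eventually.of_forall fun i => ?_)) ((asymp_add_one_pow j).le_growth (a := j + 1) (b := 0)
    j.succ_pos (Eventually.of_forall fun i => ?_))
  · simpa using hilb_tail_le hj i
  · refine (le_hilb_tail hj i).trans (hilb_mono_of_le (Submodule.smul_mono_left
      (inducedFiltration_mono 0 ?_)))
    rw [add_zero]
    exact Nat.mul_le_mul_right i j.le_succ

variable (K n) in
theorem exists_Dim_eq (p : ℕ) [Fact p.Prime] [CharP K p] {j : ℕ} (hj : j ≤ n) :
    ∃ (M : Type u) (_ : AddCommGroup M) (_ : Module K M) (_ : Module (D K n) M)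
      (_ : IsScalarTower K (D K n) M),
      Nontrivial M ∧ Module.FinitePresentation (D K n) M ∧ Dim K n M = ((n + j : ℕ) : ℝ≥0∞) := by
  have := nontrivial_presented_tailRel (K := K) (p := p) hj
  have hI : Nontrivial (Induced (T K n p 0) (Presented (tailRel K n p j))) :=
    (toInduced_injective (K := K) (n := n) (p := p) (k := 0) _).nontrivial
  have hD : Nontrivial (PresentedD (tailRel K n p j)) :=
    (presentedEquiv (tailRel K n p j)).toEquiv.nontrivial
  have hF := finitePresentation_presentedD (tailRel_finite (K := K) (n := n) (p := p) j)
  obtain ⟨d, e, h1, -, h2, -⟩ := dimension_of_induced 0 _ (presentedEquiv (tailRel K n p j))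
  rw [gkDim_presented_tailRel hj, Nat.cast_inj] at h1
  rw [← h1] at h2
  exact ⟨_, _, _, _, inferInstance, hD, hF, h2⟩

end Examples

end PrimeDiffOp

end

theorem mainTheorem4 (K : Type u) [Field K] (p : ℕ) [Fact p.Prime] [CharP K p] (n : ℕ) :
    (∀ (M : Type v) [AddCommGroup M] [Module K M] [Module (D K n) M] [IsScalarTower K (D K n) M]
        [Nontrivial M] [Module.FinitePresentation (D K n) M],
      (∃ (k : ℕ) (M' : Type u) (_ : AddCommGroup M') (_ : Module K M')
          (_ : Module (T K n p k) M') (_ : IsScalarTower K (T K n p k) M'),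
        Module.Finite (T K n p k) M' ∧ Nonempty (M ≃ₗ[D K n] Induced (T K n p k) M')) ∧
      ∀ (k : ℕ) (M' : Type w) [AddCommGroup M'] [Module K M']
          [Module (T K n p k) M'] [IsScalarTower K (T K n p k) M'] [Module.Finite (T K n p k) M']
          (iso : M ≃ₗ[D K n] Induced (T K n p k) M'),
        ∃ d e' : ℕ,
          gkDim K (T K n p k) M' = d ∧ d ≤ n ∧
          Dim K n M = ((n + d : ℕ) : ℝ≥0∞) ∧
          (∀ F, IsStandardType K n F → ∀ N₀ : Submodule K M, IsGenerating (D K n) N₀ →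
            growth (hilb (A := D K n) F N₀) = Dim K n M) ∧
          HasMultiplicity (A := D K n) M (canonicalFiltration K n) ((e' : ℚ) / (p : ℚ) ^ (k * n)) ∧
          ∀ M₀' : Submodule K M', IsGenerating (T K n p k) M₀' →
            (∃ h : ℚ[X], h.degree = d ∧ h.leadingCoeff = (e' : ℚ) / d ! ∧
              ∀ᶠ i : ℕ in atTop, (hilb (A := T K n p k) (inducedFiltration K n p k) M₀' i : ℚ) = h.eval (i : ℚ)) ∧
            ∃ M₀ : Submodule K M,
              M₀ = M₀'.map ((iso.symm.restrictScalars K).toLinearMap ∘ₗ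
                toInduced (T K n p k) M') ∧
              IsGenerating (D K n) M₀ ∧
              IsAlmostPolynomial (hilb (A := D K n) (canonicalFiltration K n) M₀) (p ^ k) (n + d)
                ((e' : ℚ) / ((p : ℚ) ^ (k * n) * (n + d)!))
                {c | ∃ z : ℤ, c = (z : ℚ) / ((p : ℚ) ^ (k * (n + d)) * (n + d)!)} ∧
              ∃ r : RatFunc ℚ, IsPoincareSeries (hilb (A := D K n) (canonicalFiltration K n) M₀) r ∧
                Dim K n M + 1 = (poleOrderAtOne r : ℝ≥0∞) ∧
                ((1 - RatFunc.X) ^ (n + d + 1) * r).eval (RingHom.id ℚ) 1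
                  = (e' : ℚ) / (p : ℚ) ^ (k * n)) ∧
    ∀ m : ℕ, n ≤ m → m ≤ 2 * n →
      ∃ (M : Type u) (_ : AddCommGroup M) (_ : Module K M) (_ : Module (D K n) M)
        (_ : IsScalarTower K (D K n) M),
        Nontrivial M ∧ Module.FinitePresentation (D K n) M ∧ Dim K n M = (m : ℝ≥0∞) := by
  refine ⟨fun M _ _ _ _ _ _ => ⟨?_, fun k M' _ _ _ _ _ iso => dimension_of_induced k M' iso⟩,
    fun m hm hm' => ?_⟩
  · obtain ⟨W, hW⟩ := exists_isGenerating (K := K) (A := D K n) (M := M)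
    obtain ⟨k, r, S, e, -⟩ := exists_presentation p hW
    exact ⟨k, Presented S, inferInstance, inferInstance, inferInstance, inferInstance,
      inferInstance, ⟨e⟩⟩
  · have h := exists_Dim_eq (K := K) n p (j := m - n) (by omega)
    rwa [Nat.add_sub_cancel' hm] at h
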